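/- Let $(M,g)$ be a compact connected Riemannian manifold (smooth, without boundary) of dimension $n\ge 2$ with Levi-Civita connection $\nabla$ and volume measure $dv_g$, and let $(\bar M,\bar g)$ be a complete Riemannian manifold of dimension $m\ge 2$. For a smooth map $f:M\to\bar M$ put $g^*:=f^*\bar g$, $e(f):=\operatorname{trace}_g g^*$ and $E_U(f):=\tfrac12\int_U e(f)\,dv_g$ for open $U\subset M$, $E(f):=E_M(f)$; $f$ is harmonic if for every relatively compact open $U$ it is a critical point of $E_U$ with respect to all smooth variations with compact support in $U$. For a symmetric two-tensor $\varphi$ and a one-form $\theta$ on $M$ let $(\delta\varphi)(Y)=-\sum_i(\nabla_{X_i}\varphi)(X_i,Y)$ and $\delta\theta=-\sum_i(\nabla_{X_i}\theta)(X_i)$, where $X_1,\dots,X_n$ is a local orthonormal frame, let $\delta^*\theta=\tfrac12 L_{\theta^\#}g$, where $\theta^\#$ is the vector field $g$-dual to $\theta$, and let $\Delta_S\theta:=2\,\delta\delta^*\theta-d\,\delta\theta$ be the Sampson Laplacian. A vector field $\xi$ on $M$ is an infinitesimal harmonic transformation if the local transformations $\Phi_t$ generated by $\xi$ (so that $\Phi_0=\mathrm{id}$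 and $\partial_t\Phi_t|_{t=0}=\xi$) are harmonic to first order, i.e. the $t$-derivative of their tension field vanishes at $t=0$; equivalently, $\operatorname{trace}_g(L_\xi\nabla)=0$. Let $f:(M,g)\to(\bar M,\bar g)$ be harmonic, and let $$g^*=(\delta^*\theta+\lambda g)+\varphi_{TT}$$ be a York decomposition of $g^*$, with $\theta$ a smooth one-form, $\lambda\in C^\infty(M)$, and $\varphi_{TT}$ a smooth symmetric two-tensor such that $\delta\varphi_{TT}=0$ and $\operatorname{trace}_g\varphi_{TT}=0$. Then $$\Delta_S\theta=-(n-2)\,d\lambda .$$ Moreover: 1. if $n=2$, then $\theta^\#$ is an infinitesimal harmonic transformation; 2. if $n>2$, then $\theta^\#$ is an infinitesimal harmonic transformation if and only if $\lambda$ is constant; 3. if $n>2$ and $\theta^\#$ is an infinitesimal harmonic transformation, then $\lambda$ is a constant, $\lambda\ge 0$, and $E(f)=\tfrac n2\,\lambda\operatorname{Vol}(M,g)$. -/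

import Mathlib

open scoped Manifold ContDiff Topology Bundle
open MeasureTheory Set Filter

noncomputable section

namespace RiemGeom

/-- The model space `ℝⁿ` with its Euclidean norm. -/
abbrev Rn (n : ℕ) : Type := EuclideanSpace ℝ (Fin n)

/-- A smooth Riemannian metric on the tangent bundle of a (boundaryless) `n`-manifold. -/
abbrev RiemMetric (n : ℕ) (M : Type*) [TopologicalSpace M] [ChartedSpace (Rn n) M]
    [IsManifold (𝓡 n) ∞ M] : Type _ :=
  Bundle.ContMDiffRiemannianMetric (𝓡 n) ∞ (Rn n) (fun x : M ↦ TangentSpace (𝓡 n) x)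

/-- Smooth one-forms. -/
abbrev OneForm (n : ℕ) (M : Type*) [TopologicalSpace M] [ChartedSpace (Rn n) M]
    [IsManifold (𝓡 n) ∞ M] : Type _ :=
  ContMDiffSection (𝓡 n) (Rn n →L[ℝ] ℝ) ∞ (fun x : M ↦ TangentSpace (𝓡 n) x →L[ℝ] ℝ)

/-- Smooth covariant two-tensor fields. -/
abbrev TwoTensor (n : ℕ) (M : Type*) [TopologicalSpace M] [ChartedSpace (Rn n) M]
    [IsManifold (𝓡 n) ∞ M] : Type _ :=
  ContMDiffSection (𝓡 n) (Rn n →L[ℝ] Rn n →L[ℝ] ℝ) ∞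
    (fun x : M ↦ TangentSpace (𝓡 n) x →L[ℝ] TangentSpace (𝓡 n) x →L[ℝ] ℝ)

section Coordinates

variable {n : ℕ} {M : Type*} [TopologicalSpace M] [ChartedSpace (Rn n) M]

/-- Partial derivative `∂ᵢ F` of a function of `n` real variables. -/
def pd (i : Fin n) (F : Rn n → ℝ) (y : Rn n) : ℝ :=
  fderiv ℝ F y (EuclideanSpace.single i 1)

/-- The coordinate vector `∂ᵢ` of the chart at `p`, at the point with coordinates `y`. -/
def coordVec (p : M) (y : Rn n) (i : Fin n) :
    TangentSpace (𝓡 n) ((extChartAt (𝓡 n) p).symm y) :=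
  mfderiv (𝓡 n) (𝓡 n) (extChartAt (𝓡 n) p).symm y (EuclideanSpace.single i (1 : ℝ) : Rn n)

/-- The components `vⁱ` at `p`, in the chart at `p`, of a tangent vector `v` at `p`. -/
def vecComp (p : M) (v : TangentSpace (𝓡 n) p) (i : Fin n) : ℝ :=
  let c : Rn n := mfderiv (𝓡 n) (𝓡 n) (extChartAt (𝓡 n) p) p v
  c i

/-- The components `ξⁱ(y)` of a vector field in the chart at `p`. -/
def coordField (ξ : ∀ x : M, TangentSpace (𝓡 n) x) (p : M) (y : Rn n) (i : Fin n) : ℝ :=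
  let c : Rn n := mfderiv (𝓡 n) (𝓡 n) (extChartAt (𝓡 n) p) ((extChartAt (𝓡 n) p).symm y)
    (ξ ((extChartAt (𝓡 n) p).symm y))
  c i

/-- The components `θᵢ(y)` of a one-form in the chart at `p`. -/
def coordForm (θ : ∀ x : M, TangentSpace (𝓡 n) x → ℝ) (p : M) (y : Rn n) (i : Fin n) : ℝ :=
  θ _ (coordVec p y i)

/-- The components `hᵢⱼ(y)` of a two-tensor field in the chart at `p`. -/
def coordTensor (h : ∀ x : M, TangentSpace (𝓡 n) x → TangentSpace (𝓡 n) x → ℝ)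
    (p : M) (y : Rn n) : Matrix (Fin n) (Fin n) ℝ :=
  Matrix.of fun i j ↦ h _ (coordVec p y i) (coordVec p y j)

variable [IsManifold (𝓡 n) ∞ M] (g : RiemMetric n M)

/-- The components `gᵢⱼ(y)` of the metric in the chart at `p`. -/
def coordMetric (p : M) (y : Rn n) : Matrix (Fin n) (Fin n) ℝ :=
  coordTensor (fun x v w ↦ g.inner x v w) p y

/-- The components `gⁱʲ(y)` of the inverse metric in the chart at `p`. -/
def coordInv (p : M) (y : Rn n) : Matrix (Fin n) (Fin n) ℝ :=
  (coordMetric g p y)⁻¹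

/-- The Christoffel symbols `Γᵏᵢⱼ(y)` of the Levi-Civita connection in the chart at `p`. -/
def christoffel (p : M) (k i j : Fin n) (y : Rn n) : ℝ :=
  (1 / 2) * ∑ l, coordInv g p y k l *
    (pd i (fun z ↦ coordMetric g p z j l) y + pd j (fun z ↦ coordMetric g p z i l) y
      - pd l (fun z ↦ coordMetric g p z i j) y)

/-- `trace_g h = gⁱʲ hᵢⱼ`, computed at `x` in the chart at `x`. -/
def metricTrace (h : ∀ x : M, TangentSpace (𝓡 n) x → TangentSpace (𝓡 n) x → ℝ) (x : M) : ℝ :=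
  ∑ i, ∑ j, coordInv g x (extChartAt (𝓡 n) x x) i j *
    coordTensor h x (extChartAt (𝓡 n) x x) i j

/-- The components `(∇h)ᵢⱼₖ = ∇ᵢ hⱼₖ` of the covariant derivative of a two-tensor field, in the
chart at `p`. -/
def covTensor (h : ∀ x : M, TangentSpace (𝓡 n) x → TangentSpace (𝓡 n) x → ℝ)
    (p : M) (i j k : Fin n) (y : Rn n) : ℝ :=
  pd i (fun z ↦ coordTensor h p z j k) y
    - ∑ l, christoffel g p l i j y * coordTensor h p y l k
    - ∑ l, christoffel g p l i k y * coordTensor h p y j l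

/-- The components `∇ᵢ θⱼ` of the covariant derivative of a one-form, in the chart at `p`. -/
def covForm (θ : ∀ x : M, TangentSpace (𝓡 n) x → ℝ) (p : M) (i j : Fin n) (y : Rn n) : ℝ :=
  pd i (fun z ↦ coordForm θ p z j) y - ∑ l, christoffel g p l i j y * coordForm θ p y l

/-- The divergence of a two-tensor field: `(δh)(w) = - gⁱʲ (∇ᵢ hⱼₖ) wᵏ`. -/
def divTensor (h : ∀ x : M, TangentSpace (𝓡 n) x → TangentSpace (𝓡 n) x → ℝ)
    (x : M) (w : TangentSpace (𝓡 n) x) : ℝ :=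
  -∑ k, (∑ i, ∑ j, coordInv g x (extChartAt (𝓡 n) x x) i j *
    covTensor g h x i j k (extChartAt (𝓡 n) x x)) * vecComp x w k

/-- The codifferential of a one-form: `δθ = - gⁱʲ ∇ᵢ θⱼ`. -/
def divForm (θ : ∀ x : M, TangentSpace (𝓡 n) x → ℝ) (x : M) : ℝ :=
  -∑ i, ∑ j, coordInv g x (extChartAt (𝓡 n) x x) i j *
    covForm g θ x i j (extChartAt (𝓡 n) x x)

/-- The Lie derivative of the metric,
`(L_ξ g)ᵢⱼ = ξᵏ ∂ₖ gᵢⱼ + gₖⱼ ∂ᵢ ξᵏ + gᵢₖ ∂ⱼ ξᵏ`, as a two-tensor field. -/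
def lieMetric (ξ : ∀ x : M, TangentSpace (𝓡 n) x) (x : M) (v w : TangentSpace (𝓡 n) x) : ℝ :=
  let y := extChartAt (𝓡 n) x x
  ∑ i, ∑ j, (∑ k, (coordField ξ x y k * pd k (fun z ↦ coordMetric g x z i j) y
      + coordMetric g x y k j * pd i (fun z ↦ coordField ξ x z k) y
      + coordMetric g x y i k * pd j (fun z ↦ coordField ξ x z k) y)) * vecComp x v i * vecComp x w j

/-- The value of the metric at `x` as a bilinear form. -/
def bilin (x : M) : LinearMap.BilinForm ℝ (TangentSpace (𝓡 n) x) :=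
  LinearMap.mk₂ ℝ (fun v w ↦ g.inner x v w) (by simp) (by simp) (by simp) (by simp)

theorem bilin_nondegenerate (x : M) : (bilin g x).Nondegenerate := by
  constructor
  · intro v hv
    by_contra h
    exact (g.pos x v h).ne' (hv v)
  · intro v hv
    by_contra h
    exact (g.pos x v h).ne' (hv v)

instance (x : M) : FiniteDimensional ℝ (TangentSpace (𝓡 n) x) :=
  inferInstanceAs (FiniteDimensional ℝ (Rn n))

/-- The vector field `θ^#`, determined by `g(θ^#, v) = θ(v)`. -/
def sharp (θ : OneForm n M) (x : M) : TangentSpace (𝓡 n) x :=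
  ((bilin g x).toDual (bilin_nondegenerate g x)).symm (θ x : TangentSpace (𝓡 n) x →ₗ[ℝ] ℝ)

theorem inner_sharp (θ : OneForm n M) (x : M) (v : TangentSpace (𝓡 n) x) :
    g.inner x (sharp g θ x) v = θ x v :=
  LinearMap.BilinForm.apply_toDual_symm_apply (hB := bilin_nondegenerate g x)
    (θ x : TangentSpace (𝓡 n) x →ₗ[ℝ] ℝ) v

/-- `δ*θ = ½ L_ξ g` with `ξ = θ^#`. -/
def deltaStar (θ : OneForm n M) (x : M) (v w : TangentSpace (𝓡 n) x) : ℝ :=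
  (1 / 2) * lieMetric g (sharp g θ) x v w

/-- The differential of a real function. -/
def differential (u : M → ℝ) (x : M) (w : TangentSpace (𝓡 n) x) : ℝ :=
  mfderiv (𝓡 n) 𝓘(ℝ, ℝ) u x w

/-- The Sampson Laplacian on one-forms, `Δ_S = 2 δ δ* - d δ`. -/
def sampsonLaplacian (θ : OneForm n M) (x : M) (w : TangentSpace (𝓡 n) x) : ℝ :=
  2 * divTensor g (deltaStar g θ) x w
    - differential (divForm g (fun x v ↦ θ x v)) x w

/-- `TT`-tensors: smooth symmetric two-tensor fields, divergence free and trace free. -/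
structure IsTT (φ : TwoTensor n M) : Prop where
  symm : ∀ (x : M) (v w : TangentSpace (𝓡 n) x), φ x v w = φ x w v
  div : ∀ (x : M) (w : TangentSpace (𝓡 n) x), divTensor g (fun x v w ↦ φ x v w) x w = 0
  trace : ∀ x : M, metricTrace g (fun x v w ↦ φ x v w) x = 0

/-- The components, in the chart at `p`, of the tension field at `p` of a map `Φ : M → M` that
is smooth near `p` and maps `p` into the domain of the chart at `p`:
`τᵏ = gⁱʲ (∂ᵢ∂ⱼ Φᵏ - Γˡᵢⱼ ∂ₗ Φᵏ + (Γᵏₐᵦ ∘ Φ) ∂ᵢ Φᵃ ∂ⱼ Φᵇ)`. -/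
def coordTension (p : M) (Φ : M → M) (k : Fin n) : ℝ :=
  let y := extChartAt (𝓡 n) p p
  let u : Rn n → Rn n := fun z ↦ extChartAt (𝓡 n) p (Φ ((extChartAt (𝓡 n) p).symm z))
  ∑ i, ∑ j, coordInv g p y i j *
    (pd i (pd j (fun z ↦ u z k)) y
      - ∑ l, christoffel g p l i j y * pd l (fun z ↦ u z k) y
      + ∑ a, ∑ b, christoffel g p k a b (u y) * pd i (fun z ↦ u z a) y * pd j (fun z ↦ u z b) y)

/-- `ξ` is an infinitesimal harmonic transformation: the local transformations `Φₜ` of `M`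
generated by `ξ` (so `Φ₀ = id` and `∂ₜ Φₜ = ξ` at `t = 0`) are harmonic to first order in `t`,
that is, the `t`-derivative at `t = 0` of their tension field vanishes at every point. As
`Φ₀ = id` has zero tension, this derivative is a tangent vector that does not depend on
coordinates; it is `trace_g (L_ξ ∇)`, and so is the same for all families generated by `ξ`. -/
def IsInfinitesimalHarmonic (ξ : ∀ x : M, TangentSpace (𝓡 n) x) : Prop :=
  ∀ (p : M) (Φ : ℝ → M → M),
    ContMDiffAt (𝓘(ℝ, ℝ).prod (𝓡 n)) (𝓡 n) ∞ (fun q : ℝ × M ↦ Φ q.1 q.2) (0, p) →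
    (∀ᶠ x in 𝓝 p, Φ 0 x = x ∧
      HasMFDerivAt 𝓘(ℝ, ℝ) (𝓡 n) (fun t ↦ Φ t x) 0
        ((1 : ℝ →L[ℝ] ℝ).smulRight (ξ (Φ 0 x)))) →
    ∀ k, HasDerivAt (fun t ↦ coordTension g p (Φ t) k) 0 0

variable [MeasurableSpace M]

/-- The measure `√det(gᵢⱼ) dy¹⋯dyⁿ` of the chart at `p`, carried to `M`; it is the Riemannian
volume measure restricted to the domain of that chart. -/
def chartVolume (p : M) : Measure M :=
  (((volume : Measure (Rn n)).restrict (extChartAt (𝓡 n) p).target).withDensity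
    (fun y ↦ ENNReal.ofReal √(coordMetric g p y).det)).map (extChartAt (𝓡 n) p).symm

/-- The Riemannian volume measure `dv_g`: the least measure that dominates the volume measures
of all charts (these agree on overlaps). -/
def riemVol : Measure M := ⨆ p : M, chartVolume g p

end Coordinates

section Maps

variable {n m : ℕ} {M N : Type*}
  [TopologicalSpace M] [ChartedSpace (Rn n) M] [IsManifold (𝓡 n) ∞ M] [MeasurableSpace M]
  [TopologicalSpace N] [ChartedSpace (Rn m) N] [IsManifold (𝓡 m) ∞ N]

/-- The pullback metric `f^* ḡ`. -/
def pullbackMetric (gbar : RiemMetric m N) (f : M → N) (x : M) (v w : TangentSpace (𝓡 n) x) : ℝ :=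
  gbar.inner (f x) (mfderiv (𝓡 n) (𝓡 m) f x v) (mfderiv (𝓡 n) (𝓡 m) f x w)

/-- The energy density `e(f) = trace_g (f^* ḡ)`. -/
def energyDensity (g : RiemMetric n M) (gbar : RiemMetric m N) (f : M → N) (x : M) : ℝ :=
  metricTrace g (pullbackMetric gbar f) x

/-- The energy of `f` over `U`: `½ ∫_U e(f) dv_g`. -/
def energyOn (g : RiemMetric n M) (gbar : RiemMetric m N) (U : Set M) (f : M → N) : ℝ :=
  (1 / 2) * ∫ x in U, energyDensity g gbar f x ∂(riemVol g)

/-- The energy `E(f) = ½ ∫_M e(f) dv_g`. -/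
def energy (g : RiemMetric n M) (gbar : RiemMetric m N) (f : M → N) : ℝ :=
  energyOn g gbar univ f

/-- A smooth map is harmonic if it is a critical point of the energy over every relatively
compact open set `U`, under all smooth variations with compact support in `U`. -/
def IsHarmonicMap (g : RiemMetric n M) (gbar : RiemMetric m N) (f : M → N) : Prop :=
  ContMDiff (𝓡 n) (𝓡 m) ∞ f ∧
  ∀ (U K : Set M) (F : ℝ → M → N) (ε : ℝ), IsOpen U → IsCompact (closure U) →
    IsCompact K → K ⊆ U → 0 < ε →
    ContMDiffOn (𝓘(ℝ, ℝ).prod (𝓡 n)) (𝓡 m) ∞ (fun q : ℝ × M ↦ F q.1 q.2)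
      (Ioo (-ε) ε ×ˢ univ) →
    F 0 = f → (∀ t ∈ Ioo (-ε) ε, ∀ x ∉ K, F t x = f x) →
    HasDerivAt (fun t ↦ energyOn g gbar U (F t)) 0 0

/-- Completeness of a Riemannian manifold: every sequence that is Cauchy for the Riemannian
distance converges. -/
def IsCompleteMetric (gbar : RiemMetric m N) : Prop :=
  letI : Bundle.RiemannianBundle (fun x : N ↦ TangentSpace (𝓡 m) x) :=
    ⟨gbar.toRiemannianMetric⟩
  ∀ u : ℕ → N,
    (∀ ε : ENNReal, 0 < ε → ∃ k, ∀ a ≥ k, ∀ b ≥ k,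
      Manifold.riemannianEDist (𝓡 m) (u a) (u b) < ε) →
    ∃ x, Tendsto u atTop (𝓝 x)

end Maps

end RiemGeom

end

open RiemGeom

/-!
A harmonic map `f` is in particular critical for the variations `f ∘ ψₜ` that move points of `M`.
In a chart, for `ψₜ(y) = y + t η(y) e_c`, the derivative of the energy is, up to sign, the
integral of `η` against the `c`-component of the divergence of `S(h) = h - ½ (trace h) g`, for
`h = f^*ḡ`, so `div S(h) = 0`. In a York decomposition `h = (δ^*θ + λ g) + φ` the `TT`-tensor `φ`
does not contribute to `div S(h)`, the conformal part contributes `(1 - n/2) dλ`, and `δ^*θ`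
contributes `-½ Δ_S θ`; this is the formula for `Δ_S θ`. By the Koszul formula `div S(L_ξ g)` is
the `g`-dual of `trace_g (L_ξ ∇)`, and the latter is the derivative of the tension field of the
local transformations generated by `ξ`. Hence `θ^#` is an infinitesimal harmonic transformation
exactly when `Δ_S θ = 0`. Finally `trace_g h = -δθ + n λ`, and `δθ` integrates to zero.
-/

noncomputable section

namespace RiemGeom

section PartialDerivatives

variable {n : ℕ} {y : Rn n} {F F' : Rn n → ℝ}

theorem pd_congr {i : Fin n} (h : F =ᶠ[𝓝 y] F') : pd i F y = pd i F' y := by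
  rw [pd, pd, h.fderiv_eq]

theorem pd_const (i : Fin n) (c : ℝ) : pd i (fun _ ↦ c) y = 0 := by simp [pd]

theorem pd_add (i : Fin n) (h : DifferentiableAt ℝ F y) (h' : DifferentiableAt ℝ F' y) :
    pd i (fun z ↦ F z + F' z) y = pd i F y + pd i F' y := by
  simp [pd, fderiv_fun_add h h']

theorem pd_sub (i : Fin n) (h : DifferentiableAt ℝ F y) (h' : DifferentiableAt ℝ F' y) :
    pd i (fun z ↦ F z - F' z) y = pd i F y - pd i F' y := by
  simp [pd, fderiv_fun_sub h h']

theorem pd_mul (i : Fin n) (h : DifferentiableAt ℝ F y) (h' : DifferentiableAt ℝ F' y) :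
    pd i (fun z ↦ F z * F' z) y = pd i F y * F' y + F y * pd i F' y := by
  simp only [pd, fderiv_fun_mul h h', add_apply, smul_apply, smul_eq_mul]
  ring

theorem pd_const_mul (i : Fin n) (c : ℝ) (h : DifferentiableAt ℝ F y) :
    pd i (fun z ↦ c * F z) y = c * pd i F y := by
  simp [pd, fderiv_const_mul h]

theorem pd_sum {ι : Type*} [Fintype ι] (i : Fin n) {H : ι → Rn n → ℝ}
    (h : ∀ a, DifferentiableAt ℝ (H a) y) :
    pd i (fun z ↦ ∑ a, H a z) y = ∑ a, pd i (H a) y := by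
  simp [pd, fderiv_fun_sum (fun a (_ : a ∈ Finset.univ) ↦ h a)]

theorem sum_smul_single (v : Rn n) : ∑ i, v i • (EuclideanSpace.single i (1 : ℝ) : Rn n) = v := by
  ext j
  simp [Pi.single_apply]

theorem fderiv_eq_sum_pd (v : Rn n) : fderiv ℝ F y v = ∑ i, v i * pd i F y := by
  conv_lhs => rw [← sum_smul_single v]
  simp [pd]

theorem contDiffAt_pd {k l : WithTop ℕ∞} (h : ContDiffAt ℝ l F y) (hk : k + 1 ≤ l) (i : Fin n) :
    ContDiffAt ℝ k (pd i F) y :=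
  (h.fderiv_right hk).clm_apply contDiffAt_const

theorem differentiableAt_pd (h : ContDiffAt ℝ 2 F y) (i : Fin n) :
    DifferentiableAt ℝ (pd i F) y :=
  (contDiffAt_pd (k := 1) h (by norm_num) i).differentiableAt one_ne_zero

theorem fderiv_fderiv_comm {E : Type*} [NormedAddCommGroup E] [NormedSpace ℝ E] {U : E → ℝ} {q : E}
    (h : ContDiffAt ℝ 2 U q) (v w : E) :
    fderiv ℝ (fun q ↦ fderiv ℝ U q v) q w = fderiv ℝ (fun q ↦ fderiv ℝ U q w) q v := by
  have hd : DifferentiableAt ℝ (fderiv ℝ U) q :=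
    (h.fderiv_right (m := 1) (by norm_num)).differentiableAt one_ne_zero
  have second_deriv (a b : E) :
      fderiv ℝ (fun q ↦ fderiv ℝ U q a) q b = fderiv ℝ (fderiv ℝ U) q b a := by
    rw [fderiv_clm_apply hd (by fun_prop)]
    simp
  rw [second_deriv, second_deriv]
  exact (h.isSymmSndFDerivAt (by simp)).eq _ _

theorem pd_comm (h : ContDiffAt ℝ 2 F y) (i j : Fin n) : pd i (pd j F) y = pd j (pd i F) y :=
  fderiv_fderiv_comm h _ _

end PartialDerivatives

section MatrixCalculus

variable {E ι : Type*} [NormedAddCommGroup E] [NormedSpace ℝ E] [Fintype ι] [DecidableEq ι]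

theorem contDiffAt_det {x : E} {A : E → Matrix ι ι ℝ} {k : WithTop ℕ∞}
    (h : ∀ i j, ContDiffAt ℝ k (fun z ↦ A z i j) x) : ContDiffAt ℝ k (fun z ↦ (A z).det) x := by
  simp only [Matrix.det_apply]
  exact ContDiffAt.sum fun σ _ ↦ (contDiffAt_prod fun i _ ↦ h _ _).const_smul _

theorem contDiffAt_inv {x : E} {A : E → Matrix ι ι ℝ} {k : WithTop ℕ∞}
    (h : ∀ i j, ContDiffAt ℝ k (fun z ↦ A z i j) x) (hd : (A x).det ≠ 0) (i j : ι) :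
    ContDiffAt ℝ k (fun z ↦ (A z)⁻¹ i j) x := by
  simp only [Matrix.inv_def, Ring.inverse_eq_inv', Matrix.smul_apply, smul_eq_mul,
    Matrix.adjugate_apply]
  refine ((contDiffAt_det h).inv hd).mul (contDiffAt_det fun a b ↦ ?_)
  by_cases hab : a = j
  · subst hab
    simpa only [Matrix.updateRow_self] using contDiffAt_const
  · simpa only [Matrix.updateRow_ne hab] using h a b

variable {n : ℕ} {y : Rn n} {A : Rn n → Matrix ι ι ℝ}

theorem sum_pd_mul_inv_eq_neg (h : ∀ i j, ContDiffAt ℝ 1 (fun z ↦ A z i j) y)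
    (hd : (A y).det ≠ 0) (l : Fin n) (i j : ι) :
    ∑ a, pd l (fun z ↦ A z i a) y * (A y)⁻¹ a j
      = -∑ a, A y i a * pd l (fun z ↦ (A z)⁻¹ a j) y := by
  have hA (a b : ι) : DifferentiableAt ℝ (fun z ↦ A z a b) y :=
    (h a b).differentiableAt one_ne_zero
  have hB (a b : ι) : DifferentiableAt ℝ (fun z ↦ (A z)⁻¹ a b) y :=
    (contDiffAt_inv h hd a b).differentiableAt one_ne_zero
  have mul_inv_eventually : (fun z ↦ ∑ a, A z i a * (A z)⁻¹ a j)
      =ᶠ[𝓝 y] fun _ ↦ (1 : Matrix ι ι ℝ) i j := by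
    filter_upwards [(contDiffAt_det h).continuousAt.eventually_ne hd] with z hz
    rw [← Matrix.mul_apply, Matrix.mul_nonsing_inv _ (isUnit_iff_ne_zero.2 hz)]
  rw [eq_neg_iff_add_eq_zero, ← Finset.sum_add_distrib, ← pd_const l ((1 : Matrix ι ι ℝ) i j),
    ← pd_congr mul_inv_eventually, pd_sum l fun a ↦ (hA i a).fun_mul (hB a j)]
  exact Finset.sum_congr rfl fun a _ ↦ (pd_mul l (hA i a) (hB a j)).symm

theorem pd_inv (h : ∀ i j, ContDiffAt ℝ 1 (fun z ↦ A z i j) y) (hd : (A y).det ≠ 0)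
    (l : Fin n) (i j : ι) :
    pd l (fun z ↦ (A z)⁻¹ i j) y
      = -∑ a, ∑ b, (A y)⁻¹ i a * pd l (fun z ↦ A z a b) y * (A y)⁻¹ b j := by
  set dA : Matrix ι ι ℝ := Matrix.of fun a b ↦ pd l (fun z ↦ A z a b) y
  set dB : Matrix ι ι ℝ := Matrix.of fun a b ↦ pd l (fun z ↦ (A z)⁻¹ a b) y
  have product_rule : dA * (A y)⁻¹ = -(A y * dB) := by
    ext a b
    simpa [Matrix.mul_apply, dA, dB] using sum_pd_mul_inv_eq_neg h hd l a b
  have hdB : dB = -((A y)⁻¹ * (dA * (A y)⁻¹)) := by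
    rw [product_rule, Matrix.mul_neg, neg_neg,
      Matrix.nonsing_inv_mul_cancel_left _ _ (isUnit_iff_ne_zero.2 hd)]
  simpa only [dB, dA, Matrix.of_apply, Matrix.neg_apply, Matrix.mul_apply, Finset.mul_sum,
    mul_assoc] using congrFun₂ hdB i j

theorem pd_det_eq_sum_updateRow (h : ∀ i j, DifferentiableAt ℝ (fun z ↦ A z i j) y) (l : Fin n) :
    pd l (fun z ↦ (A z).det) y
      = ∑ i, ((A y).updateRow i fun j ↦ pd l (fun z ↦ A z i j) y).det := by
  let detRow : ContinuousMultilinearMap ℝ (fun _ : ι ↦ ι → ℝ) ℝ :=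
    ⟨Matrix.detRowAlternating.toMultilinearMap, continuous_id.matrix_det⟩
  have hrow (i : ι) : HasFDerivAt (fun z ↦ A z i)
      (ContinuousLinearMap.pi fun j ↦ fderiv ℝ (fun z ↦ A z i j) y) y :=
    hasFDerivAt_pi.2 fun j ↦ (h i j).hasFDerivAt
  have hdet := HasFDerivAt.multilinear_comp detRow hrow
  change fderiv ℝ (fun z ↦ detRow fun i ↦ A z i) y _ = _
  rw [hdet.fderiv, sum_apply]
  rfl

theorem pd_det (h : ∀ i j, DifferentiableAt ℝ (fun z ↦ A z i j) y) (hd : (A y).det ≠ 0)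
    (l : Fin n) :
    pd l (fun z ↦ (A z).det) y
      = (A y).det * ∑ i, ∑ j, (A y)⁻¹ i j * pd l (fun z ↦ A z j i) y := by
  rw [pd_det_eq_sum_updateRow h, Finset.sum_comm, Finset.mul_sum]
  refine Finset.sum_congr rfl fun i _ ↦ ?_
  rw [← Matrix.cramer_transpose_apply, Matrix.cramer_eq_adjugate_mulVec,
    ← Matrix.adjugate_transpose, Matrix.mulVec, dotProduct, Finset.mul_sum]
  refine Finset.sum_congr rfl fun j _ ↦ ?_
  rw [Matrix.inv_def, Ring.inverse_eq_inv', Matrix.smul_apply, smul_eq_mul, Matrix.transpose_apply]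
  field_simp

end MatrixCalculus

section Contraction

variable {ι : Type*} [Fintype ι] {A B : Matrix ι ι ℝ}

/-- The contraction `Bⁱʲ Fᵢⱼ` of a family of reals with a matrix; for the inverse matrix `B` of a
metric this is the trace of `F` with respect to the metric. -/
def contract (B : Matrix ι ι ℝ) (F : ι → ι → ℝ) : ℝ :=
  ∑ i, ∑ j, B i j * F i j

theorem contract_add (F G : ι → ι → ℝ) :
    contract B (fun i j ↦ F i j + G i j) = contract B F + contract B G := by
  simp only [contract, mul_add, Finset.sum_add_distrib]

theorem contract_sub (F G : ι → ι → ℝ) :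
    contract B (fun i j ↦ F i j - G i j) = contract B F - contract B G := by
  simp only [contract, mul_sub, Finset.sum_sub_distrib]

theorem contract_const_mul (c : ℝ) (F : ι → ι → ℝ) :
    contract B (fun i j ↦ c * F i j) = c * contract B F := by
  simp only [contract, Finset.mul_sum, mul_left_comm]

theorem contract_sum {κ : Type*} [Fintype κ] (F : ι → ι → κ → ℝ) :
    contract B (fun i j ↦ ∑ k, F i j k) = ∑ k, contract B fun i j ↦ F i j k := by
  simp only [contract, Finset.mul_sum]
  rw [Finset.sum_comm_cycle]

theorem contract_comm (hB : B.IsSymm) (F : ι → ι → ℝ) :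
    contract B (fun i j ↦ F j i) = contract B F := by
  rw [contract, Finset.sum_comm]
  simp only [hB.apply, contract]

theorem contract_nonneg {F : Matrix ι ι ℝ} (hB : B.PosSemidef)
    (hF : F.PosSemidef) : 0 ≤ contract B F := by
  have schur_product := (hB.hadamard hF).dotProduct_mulVec_nonneg fun _ ↦ 1
  simpa [dotProduct, Matrix.mulVec, contract] using schur_product

variable [DecidableEq ι]

theorem contract_mul_eq (hBA : B * A = 1) (v : ι → ℝ) (l : ι) :
    contract B (fun i j ↦ v i * A j l) = v l := by
  have (i : ι) : ∑ j, B i j * (v i * A j l) = v i * (1 : Matrix ι ι ℝ) i l := by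
    simp only [← hBA, Matrix.mul_apply, Finset.mul_sum, mul_left_comm]
  simp [contract, this, Matrix.one_apply]

theorem contract_self (hBA : B * A = 1) (hA : A.IsSymm) : contract B A = Fintype.card ι := by
  rw [← Matrix.trace_one (R := ℝ), ← hBA, Matrix.trace]
  simp only [contract, Matrix.diag, Matrix.mul_apply, hA.apply]

end Contraction

section LeviCivita

variable {n : ℕ} {A H : Rn n → Matrix (Fin n) (Fin n) ℝ} {X : Rn n → Fin n → ℝ} {y : Rn n}

/-- The Christoffel symbols of the first kind
`Γₗ,ᵢⱼ = ½ (∂ᵢ Hⱼₗ + ∂ⱼ Hᵢₗ - ∂ₗ Hᵢⱼ)` of a matrix-valued function on `ℝⁿ`. -/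
def lowerChristoffel (H : Rn n → Matrix (Fin n) (Fin n) ℝ) (l i j : Fin n) (y : Rn n) : ℝ :=
  (1 / 2) * (pd i (fun z ↦ H z j l) y + pd j (fun z ↦ H z i l) y - pd l (fun z ↦ H z i j) y)

/-- The Christoffel symbols `Γᵏᵢⱼ` of a matrix-valued function on `ℝⁿ`, seen as a metric. -/
def metricChristoffel (A : Rn n → Matrix (Fin n) (Fin n) ℝ) (k i j : Fin n) (y : Rn n) : ℝ :=
  ∑ l, (A y)⁻¹ k l * lowerChristoffel A l i j y

/-- The components `gⁱʲ (Γₗ,ᵢⱼ(h) - Γᵏᵢⱼ hₖₗ)` of the divergence of the stress tensor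
`h - ½ (trace h) g` of a symmetric two-tensor `h`. -/
def stressDiv (A H : Rn n → Matrix (Fin n) (Fin n) ℝ) (l : Fin n) (y : Rn n) : ℝ :=
  contract (A y)⁻¹ fun i j ↦
    lowerChristoffel H l i j y - ∑ k, metricChristoffel A k i j y * H y k l

/-- The components of the Lie derivative of the metric `A` along `X`. -/
def lieMatrix (A : Rn n → Matrix (Fin n) (Fin n) ℝ) (X : Rn n → Fin n → ℝ) (y : Rn n) :
    Matrix (Fin n) (Fin n) ℝ :=
  Matrix.of fun i j ↦ ∑ k, (X y k * pd k (fun z ↦ A z i j) y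
    + A y k j * pd i (fun z ↦ X z k) y + A y i k * pd j (fun z ↦ X z k) y)

/-- The components `(L_X ∇)ᵏᵢⱼ` of the Lie derivative of the Levi-Civita connection of `A`. -/
def lieConnection (A : Rn n → Matrix (Fin n) (Fin n) ℝ) (X : Rn n → Fin n → ℝ) (k i j : Fin n)
    (y : Rn n) : ℝ :=
  pd i (pd j fun z ↦ X z k) y
    - ∑ m, metricChristoffel A m i j y * pd m (fun z ↦ X z k) y
    + ∑ c, X y c * pd c (metricChristoffel A k i j) y
    + ∑ a, metricChristoffel A k a j y * pd i (fun z ↦ X z a) y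
    + ∑ b, metricChristoffel A k i b y * pd j (fun z ↦ X z b) y

/-- The components of the vector field `trace_g (L_X ∇)`. -/
def lieTension (A : Rn n → Matrix (Fin n) (Fin n) ℝ) (X : Rn n → Fin n → ℝ) (k : Fin n)
    (y : Rn n) : ℝ :=
  contract (A y)⁻¹ fun i j ↦ lieConnection A X k i j y

theorem contract_lowerChristoffel {B : Matrix (Fin n) (Fin n) ℝ} (hB : B.IsSymm) (l : Fin n) :
    contract B (fun i j ↦ lowerChristoffel H l i j y)
      = contract B (fun i j ↦ pd i (fun z ↦ H z j l) y)
        - (1 / 2) * contract B fun i j ↦ pd l (fun z ↦ H z i j) y := by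
  simp only [lowerChristoffel, contract_const_mul, contract_sub, contract_add]
  rw [contract_comm hB fun i j ↦ pd i (fun z ↦ H z j l) y]
  ring

theorem stressDiv_congr {H' : Rn n → Matrix (Fin n) (Fin n) ℝ} (h : H =ᶠ[𝓝 y] H') (l : Fin n) :
    stressDiv A H l y = stressDiv A H' l y := by
  have hpd (c i j : Fin n) : pd c (fun z ↦ H z i j) y = pd c (fun z ↦ H' z i j) y :=
    pd_congr (h.mono fun z hz ↦ by simp only [hz])
  simp only [stressDiv, lowerChristoffel, hpd, h.self_of_nhds]

theorem stressDiv_add {H' : Rn n → Matrix (Fin n) (Fin n) ℝ}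
    (h : ∀ i j, DifferentiableAt ℝ (fun z ↦ H z i j) y)
    (h' : ∀ i j, DifferentiableAt ℝ (fun z ↦ H' z i j) y) (l : Fin n) :
    stressDiv A (fun z ↦ H z + H' z) l y = stressDiv A H l y + stressDiv A H' l y := by
  simp only [stressDiv, lowerChristoffel, Matrix.add_apply, pd_add _ (h _ _) (h' _ _),
    ← contract_add, mul_add (metricChristoffel _ _ _ _ _), Finset.sum_add_distrib]
  congr! 3
  ring

theorem stressDiv_const_smul (c : ℝ) (h : ∀ i j, DifferentiableAt ℝ (fun z ↦ H z i j) y)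
    (l : Fin n) : stressDiv A (fun z ↦ c • H z) l y = c * stressDiv A H l y := by
  simp only [stressDiv, lowerChristoffel, Matrix.smul_apply, smul_eq_mul, pd_const_mul _ c (h _ _),
    ← contract_const_mul, mul_left_comm (metricChristoffel _ _ _ _ _) c, ← Finset.mul_sum]
  congr! 3
  ring

/-- `A` is, near `y`, the matrix of components of a smooth metric. Positivity is only asked of the
determinant, which is what the volume density `√det A` needs. -/
structure IsMetricAt (A : Rn n → Matrix (Fin n) (Fin n) ℝ) (y : Rn n) : Prop where
  smooth : ∀ i j, ContDiffAt ℝ ∞ (fun z ↦ A z i j) y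
  symm : ∀ᶠ z in 𝓝 y, (A z).IsSymm
  pos : 0 < (A y).det

theorem sum_mul_metricChristoffel (hd : (A y).det ≠ 0) (l i j : Fin n) :
    ∑ k, A y l k * metricChristoffel A k i j y = lowerChristoffel A l i j y := by
  change (A y).mulVec ((A y)⁻¹.mulVec fun m ↦ lowerChristoffel A m i j y) l = _
  rw [Matrix.mulVec_mulVec, Matrix.mul_nonsing_inv _ (isUnit_iff_ne_zero.2 hd), Matrix.one_mulVec]

namespace IsMetricAt

theorem differentiableAt (hA : IsMetricAt A y) (i j : Fin n) :
    DifferentiableAt ℝ (fun z ↦ A z i j) y :=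
  (hA.smooth i j).differentiableAt (by simp)

theorem differentiableAt_pd (hA : IsMetricAt A y) (l i j : Fin n) :
    DifferentiableAt ℝ (pd l fun z ↦ A z i j) y :=
  RiemGeom.differentiableAt_pd ((hA.smooth i j).of_le ENat.LEInfty.out) l

theorem smooth_inv (hA : IsMetricAt A y) (i j : Fin n) :
    ContDiffAt ℝ ∞ (fun z ↦ (A z)⁻¹ i j) y :=
  contDiffAt_inv hA.smooth hA.pos.ne' i j

theorem differentiableAt_inv (hA : IsMetricAt A y) (i j : Fin n) :
    DifferentiableAt ℝ (fun z ↦ (A z)⁻¹ i j) y :=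
  (hA.smooth_inv i j).differentiableAt (by simp)

theorem isSymm_inv (hA : IsMetricAt A y) : ((A y)⁻¹).IsSymm := by
  rw [Matrix.IsSymm, Matrix.transpose_nonsing_inv, hA.symm.self_of_nhds.eq]

theorem mul_inv (hA : IsMetricAt A y) : A y * (A y)⁻¹ = 1 :=
  Matrix.mul_nonsing_inv _ (isUnit_iff_ne_zero.2 hA.pos.ne')

theorem inv_mul (hA : IsMetricAt A y) : (A y)⁻¹ * A y = 1 :=
  Matrix.nonsing_inv_mul _ (isUnit_iff_ne_zero.2 hA.pos.ne')

theorem pd_symm (hA : IsMetricAt A y) (l i j : Fin n) :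
    pd l (fun z ↦ A z i j) y = pd l (fun z ↦ A z j i) y :=
  pd_congr (hA.symm.mono fun _ hz ↦ hz.apply j i)

theorem pd_eq_lowerChristoffel (hA : IsMetricAt A y) (l i j : Fin n) :
    pd l (fun z ↦ A z i j) y = lowerChristoffel A j i l y + lowerChristoffel A i j l y := by
  rw [lowerChristoffel, lowerChristoffel, hA.pd_symm l i j, hA.pd_symm i l j, hA.pd_symm j l i]
  ring

theorem metricChristoffel_comm (hA : IsMetricAt A y) (k i j : Fin n) :
    metricChristoffel A k i j y = metricChristoffel A k j i y := by
  refine Finset.sum_congr rfl fun l _ ↦ ?_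
  rw [lowerChristoffel, lowerChristoffel, hA.pd_symm l i j]
  ring

theorem differentiableAt_lowerChristoffel (hA : IsMetricAt A y) (l i j : Fin n) :
    DifferentiableAt ℝ (lowerChristoffel A l i j) y :=
  (((hA.differentiableAt_pd i j l).add (hA.differentiableAt_pd j i l)).sub
    (hA.differentiableAt_pd l i j)).const_mul _

theorem differentiableAt_metricChristoffel (hA : IsMetricAt A y) (k i j : Fin n) :
    DifferentiableAt ℝ (metricChristoffel A k i j) y :=
  DifferentiableAt.fun_sum fun l _ ↦
    (hA.differentiableAt_inv k l).mul (hA.differentiableAt_lowerChristoffel l i j)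

/-- `∇ₗ gⁱʲ = 0`. -/
theorem pd_inv_eq_metricChristoffel (hA : IsMetricAt A y) (l i j : Fin n) :
    pd l (fun z ↦ (A z)⁻¹ i j) y
      = -(∑ a, (A y)⁻¹ i a * metricChristoffel A j a l y
        + ∑ a, (A y)⁻¹ j a * metricChristoffel A i a l y) := by
  rw [pd_inv (fun i j ↦ (hA.smooth i j).of_le (by simp)) hA.pos.ne']
  simp only [hA.pd_eq_lowerChristoffel, metricChristoffel, mul_add, add_mul,
    Finset.sum_add_distrib, Finset.mul_sum]
  congr 2
  · refine Finset.sum_congr rfl fun a _ ↦ Finset.sum_congr rfl fun b _ ↦ ?_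
    rw [hA.isSymm_inv.apply j b]
    ring
  · rw [Finset.sum_comm]
    refine Finset.sum_congr rfl fun a _ ↦ Finset.sum_congr rfl fun b _ ↦ ?_
    rw [hA.isSymm_inv.apply j a]
    ring

theorem pd_contract_inv (hA : IsMetricAt A y)
    (hH : ∀ i j, DifferentiableAt ℝ (fun z ↦ H z i j) y) (hs : (H y).IsSymm) (l : Fin n) :
    pd l (fun z ↦ contract (A z)⁻¹ (H z)) y
      = contract (A y)⁻¹ (fun i j ↦ pd l (fun z ↦ H z i j) y)
        - 2 * contract (A y)⁻¹ fun i j ↦ ∑ k, metricChristoffel A k i l y * H y j k := by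
  have hB := hA.differentiableAt_inv
  have product_rule : pd l (fun z ↦ contract (A z)⁻¹ (H z)) y
      = ∑ i, ∑ j, pd l (fun z ↦ (A z)⁻¹ i j) y * H y i j
        + contract (A y)⁻¹ fun i j ↦ pd l (fun z ↦ H z i j) y := by
    simp only [contract]
    rw [pd_sum l fun i ↦ DifferentiableAt.fun_sum fun j _ ↦ (hB i j).fun_mul (hH i j)]
    simp only [pd_sum l fun j ↦ (hB _ j).fun_mul (hH _ j), pd_mul l (hB _ _) (hH _ _),
      Finset.sum_add_distrib]
  have christoffel_term : ∑ i, ∑ j, ∑ a, (A y)⁻¹ i a * metricChristoffel A j a l y * H y i j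
      = contract (A y)⁻¹ fun i j ↦ ∑ k, metricChristoffel A k i l y * H y j k := by
    rw [← contract_comm hA.isSymm_inv, contract]
    simp only [Finset.mul_sum, mul_assoc]
    exact Finset.sum_congr rfl fun i _ ↦ Finset.sum_comm
  have christoffel_term' : ∑ i, ∑ j, ∑ a, (A y)⁻¹ j a * metricChristoffel A i a l y * H y i j
      = contract (A y)⁻¹ fun i j ↦ ∑ k, metricChristoffel A k i l y * H y j k := by
    rw [Finset.sum_comm, ← christoffel_term]
    simp only [hs.apply]
  simp only [product_rule, hA.pd_inv_eq_metricChristoffel, neg_mul, add_mul, Finset.sum_mul,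
    Finset.sum_neg_distrib, Finset.sum_add_distrib, christoffel_term, christoffel_term']
  ring

/-- The left-hand side is `gⁱʲ ∇ᵢ Hⱼₗ`. -/
theorem divergence_eq (hA : IsMetricAt A y)
    (hH : ∀ i j, DifferentiableAt ℝ (fun z ↦ H z i j) y) (hs : (H y).IsSymm) (l : Fin n) :
    contract (A y)⁻¹ (fun i j ↦ pd i (fun z ↦ H z j l) y
        - ∑ k, metricChristoffel A k i j y * H y k l - ∑ k, metricChristoffel A k i l y * H y j k)
      = stressDiv A H l y + (1 / 2) * pd l (fun z ↦ contract (A z)⁻¹ (H z)) y := by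
  rw [hA.pd_contract_inv hH hs, stressDiv]
  simp only [contract_sub, contract_lowerChristoffel hA.isSymm_inv]
  ring

theorem stressDiv_smul_metric (hA : IsMetricAt A y) {u : Rn n → ℝ} (hu : DifferentiableAt ℝ u y)
    (l : Fin n) :
    stressDiv A (fun z ↦ u z • A z) l y = (1 - (n : ℝ) / 2) * pd l u y := by
  have christoffel_smul (i j : Fin n) :
      ∑ k, metricChristoffel A k i j y * (u y * A y k l) = u y * lowerChristoffel A l i j y := by
    rw [← sum_mul_metricChristoffel hA.pos.ne', Finset.mul_sum]
    refine Finset.sum_congr rfl fun k _ ↦ ?_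
    rw [hA.symm.self_of_nhds.apply l k]
    ring
  have difference (i j : Fin n) : lowerChristoffel (fun z ↦ u z • A z) l i j y
        - ∑ k, metricChristoffel A k i j y * (u y * A y k l)
      = (1 / 2) * (pd i u y * A y j l + pd j u y * A y i l - pd l u y * A y i j) := by
    rw [christoffel_smul]
    simp only [lowerChristoffel, Matrix.smul_apply, smul_eq_mul,
      pd_mul _ hu (hA.differentiableAt _ _)]
    ring
  have trace_term : contract (A y)⁻¹ (fun i j ↦ pd l u y * A y i j) = pd l u y * n :=
    (contract_const_mul _ (A y)).trans <| congrArg _ <|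
      (contract_self hA.inv_mul hA.symm.self_of_nhds).trans (by rw [Fintype.card_fin])
  simp only [stressDiv, Matrix.smul_apply, smul_eq_mul, difference, contract_const_mul,
    contract_sub, contract_add, trace_term]
  rw [contract_comm hA.isSymm_inv fun i j ↦ pd i u y * A y j l, contract_mul_eq hA.inv_mul]
  ring

theorem contDiffAt_sqrt_det (hA : IsMetricAt A y) : ContDiffAt ℝ ∞ (fun z ↦ √(A z).det) y :=
  (contDiffAt_det hA.smooth).sqrt hA.pos.ne'

theorem differentiableAt_sqrt_det (hA : IsMetricAt A y) :
    DifferentiableAt ℝ (fun z ↦ √(A z).det) y :=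
  hA.contDiffAt_sqrt_det.differentiableAt (by simp)

theorem contract_inv_pd (hA : IsMetricAt A y) (l : Fin n) :
    contract (A y)⁻¹ (fun i j ↦ pd l (fun z ↦ A z i j) y)
      = 2 * ∑ a, metricChristoffel A a a l y := by
  simp only [hA.pd_eq_lowerChristoffel, contract_add]
  rw [contract_comm hA.isSymm_inv fun i j ↦ lowerChristoffel A j i l y, ← two_mul]
  rfl

theorem pd_sqrt_det (hA : IsMetricAt A y) (l : Fin n) :
    pd l (fun z ↦ √(A z).det) y = √(A y).det * ∑ a, metricChristoffel A a a l y := by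
  have hd : DifferentiableAt ℝ (fun z ↦ (A z).det) y :=
    (contDiffAt_det hA.smooth).differentiableAt (by simp)
  have pd_sqrt : pd l (fun z ↦ √(A z).det) y
      = 1 / (2 * √(A y).det) * pd l (fun z ↦ (A z).det) y := by
    simp [pd, (hd.hasFDerivAt.sqrt hA.pos.ne').fderiv]
  have trace_pd : ∑ i, ∑ j, (A y)⁻¹ i j * pd l (fun z ↦ A z j i) y
      = 2 * ∑ a, metricChristoffel A a a l y :=
    (contract_comm hA.isSymm_inv _).trans (hA.contract_inv_pd l)
  have hpos : 0 < √(A y).det := Real.sqrt_pos.2 hA.pos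
  rw [pd_sqrt, pd_det hA.differentiableAt hA.pos.ne', trace_pd]
  field_simp
  rw [Real.sq_sqrt hA.pos.le]

theorem sum_pd_sqrt_det_mul_inv (hA : IsMetricAt A y) (k : Fin n) :
    ∑ i, pd i (fun z ↦ √(A z).det * (A z)⁻¹ i k) y
      = -√(A y).det * contract (A y)⁻¹ fun i j ↦ metricChristoffel A k i j y := by
  have cancel : ∑ i, (∑ a, metricChristoffel A a a i y) * (A y)⁻¹ i k
      = ∑ i, ∑ a, (A y)⁻¹ k a * metricChristoffel A i a i y := by
    rw [Finset.sum_comm]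
    refine Finset.sum_congr rfl fun i _ ↦ ?_
    rw [Finset.sum_mul]
    refine Finset.sum_congr rfl fun a _ ↦ ?_
    rw [hA.metricChristoffel_comm, hA.isSymm_inv.apply k i, mul_comm]
  simp only [pd_mul _ hA.differentiableAt_sqrt_det (hA.differentiableAt_inv _ _), hA.pd_sqrt_det,
    hA.pd_inv_eq_metricChristoffel, mul_assoc, ← Finset.mul_sum, ← mul_add, Finset.sum_add_distrib,
    Finset.sum_neg_distrib, cancel]
  simp only [contract, hA.metricChristoffel_comm]
  ring

theorem sqrt_det_mul_stressDiv (hA : IsMetricAt A y)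
    (hH : ∀ i j, DifferentiableAt ℝ (fun z ↦ H z i j) y) (c : Fin n) :
    √(A y).det * stressDiv A H c y
      = ∑ j, ∑ i, pd i (fun z ↦ √(A z).det * (A z)⁻¹ i j * H z j c) y
        - (1 / 2) * (√(A y).det * contract (A y)⁻¹ fun i j ↦ pd c (fun z ↦ H z i j) y) := by
  have hW (i j : Fin n) : DifferentiableAt ℝ (fun z ↦ √(A z).det * (A z)⁻¹ i j) y :=
    hA.differentiableAt_sqrt_det.fun_mul (hA.differentiableAt_inv i j)
  have pd_density : ∑ j, (∑ i, pd i (fun z ↦ √(A z).det * (A z)⁻¹ i j) y) * H y j c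
      = -(√(A y).det
        * contract (A y)⁻¹ fun i j ↦ ∑ k, metricChristoffel A k i j y * H y k c) := by
    simp only [hA.sum_pd_sqrt_det_mul_inv, contract_sum, Finset.mul_sum, ← Finset.sum_neg_distrib]
    refine Finset.sum_congr rfl fun k _ ↦ ?_
    simp only [mul_comm _ (H y k c), contract_const_mul]
    ring
  have pd_tensor : ∑ j, ∑ i, √(A y).det * (A y)⁻¹ i j * pd i (fun z ↦ H z j c) y
      = √(A y).det * contract (A y)⁻¹ fun i j ↦ pd i (fun z ↦ H z j c) y := by
    rw [Finset.sum_comm]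
    simp only [contract, Finset.mul_sum, mul_assoc]
  simp only [pd_mul _ (hW _ _) (hH _ _), Finset.sum_add_distrib, ← Finset.sum_mul, pd_density,
    pd_tensor]
  rw [stressDiv, contract_sub, contract_lowerChristoffel hA.isSymm_inv]
  ring

end IsMetricAt

end LeviCivita

section LieDerivative

variable {n : ℕ} {A : Rn n → Matrix (Fin n) (Fin n) ℝ} {X : Rn n → Fin n → ℝ} {y : Rn n}

namespace IsMetricAt

theorem pd_lieMatrix (hA : IsMetricAt A y) (hX : ∀ k, ContDiffAt ℝ 2 (fun z ↦ X z k) y)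
    (l i j : Fin n) :
    pd l (fun z ↦ lieMatrix A X z i j) y
      = ∑ k, (pd l (fun z ↦ X z k) y * pd k (fun z ↦ A z i j) y
        + X y k * pd l (pd k fun z ↦ A z i j) y
        + pd l (fun z ↦ A z k j) y * pd i (fun z ↦ X z k) y
        + A y k j * pd l (pd i fun z ↦ X z k) y
        + pd l (fun z ↦ A z i k) y * pd j (fun z ↦ X z k) y
        + A y i k * pd l (pd j fun z ↦ X z k) y) := by
  have dX (k : Fin n) : DifferentiableAt ℝ (fun z ↦ X z k) y := (hX k).differentiableAt (by simp)
  have dpdX (i k : Fin n) : DifferentiableAt ℝ (pd i fun z ↦ X z k) y :=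
    RiemGeom.differentiableAt_pd (hX k) i
  have d₁ (k : Fin n) := (dX k).fun_mul (hA.differentiableAt_pd k i j)
  have d₂ (k : Fin n) := (hA.differentiableAt k j).fun_mul (dpdX i k)
  have d₃ (k : Fin n) := (hA.differentiableAt i k).fun_mul (dpdX j k)
  simp only [lieMatrix, Matrix.of_apply]
  rw [pd_sum l fun k ↦ ((d₁ k).fun_add (d₂ k)).fun_add (d₃ k)]
  refine Finset.sum_congr rfl fun k _ ↦ ?_
  rw [pd_add l ((d₁ k).fun_add (d₂ k)) (d₃ k), pd_add l (d₁ k) (d₂ k),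
    pd_mul l (dX k) (hA.differentiableAt_pd k i j), pd_mul l (hA.differentiableAt k j) (dpdX i k),
    pd_mul l (hA.differentiableAt i k) (dpdX j k)]
  ring

theorem pd_lowerChristoffel (hA : IsMetricAt A y) (c l i j : Fin n) :
    pd c (lowerChristoffel A l i j) y
      = (1 / 2) * (pd i (pd c fun z ↦ A z j l) y + pd j (pd c fun z ↦ A z i l) y
        - pd l (pd c fun z ↦ A z i j) y) := by
  have hd := hA.differentiableAt_pd
  have hcomm (a b d : Fin n) : pd c (pd a fun z ↦ A z b d) y = pd a (pd c fun z ↦ A z b d) y :=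
    pd_comm ((hA.smooth b d).of_le ENat.LEInfty.out) c a
  unfold lowerChristoffel
  rw [pd_const_mul c _ (((hd i j l).fun_add (hd j i l)).fun_sub (hd l i j)),
    pd_sub c ((hd i j l).fun_add (hd j i l)) (hd l i j), pd_add c (hd i j l) (hd j i l)]
  simp only [hcomm]

/-- Second derivatives of `X` survive only in `Aₗₖ ∂ᵢ∂ⱼXᵏ`: by symmetry the others cancel. -/
theorem lowerChristoffel_lieMatrix (hA : IsMetricAt A y)
    (hX : ∀ k, ContDiffAt ℝ 2 (fun z ↦ X z k) y) (l i j : Fin n) :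
    lowerChristoffel (lieMatrix A X) l i j y
      = ∑ k, (X y k * pd k (lowerChristoffel A l i j) y
        + lowerChristoffel A l k j y * pd i (fun z ↦ X z k) y
        + lowerChristoffel A l i k y * pd j (fun z ↦ X z k) y
        + lowerChristoffel A k i j y * pd l (fun z ↦ X z k) y
        + A y l k * pd i (pd j fun z ↦ X z k) y) := by
  rw [lowerChristoffel, hA.pd_lieMatrix hX, hA.pd_lieMatrix hX, hA.pd_lieMatrix hX,
    ← Finset.sum_add_distrib, ← Finset.sum_sub_distrib, Finset.mul_sum]
  refine Finset.sum_congr rfl fun k _ ↦ ?_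
  have hAcomm (a b c d : Fin n) : pd a (pd b fun z ↦ A z c d) y = pd b (pd a fun z ↦ A z c d) y :=
    pd_comm ((hA.smooth c d).of_le ENat.LEInfty.out) a b
  have hXcomm (a b : Fin n) : pd a (pd b fun z ↦ X z k) y = pd b (pd a fun z ↦ X z k) y :=
    pd_comm (hX k) a b
  rw [hA.pd_lowerChristoffel, hAcomm i k, hAcomm j k, hAcomm l k, hXcomm j i, hXcomm l i,
    hXcomm l j]
  simp only [lowerChristoffel, hA.symm.self_of_nhds.apply l k, hA.symm.self_of_nhds.apply k j,
    hA.symm.self_of_nhds.apply k i, hA.pd_symm _ k j, hA.pd_symm _ k l]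
  ring

/-- Differentiating `Aₗₖ Γᵏᵢⱼ = Γₗ,ᵢⱼ`. -/
theorem sum_mul_pd_metricChristoffel (hA : IsMetricAt A y) (c l i j : Fin n) :
    ∑ k, A y l k * pd c (metricChristoffel A k i j) y
      = pd c (lowerChristoffel A l i j) y
        - ∑ k, pd c (fun z ↦ A z l k) y * metricChristoffel A k i j y := by
  have hdet : ∀ᶠ z in 𝓝 y, (A z).det ≠ 0 :=
    (contDiffAt_det hA.smooth).continuousAt.eventually_ne hA.pos.ne'
  rw [← pd_congr (hdet.mono fun z hz ↦ sum_mul_metricChristoffel hz l i j),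
    pd_sum c fun k ↦
      (hA.differentiableAt l k).fun_mul (hA.differentiableAt_metricChristoffel k i j)]
  simp only [pd_mul c (hA.differentiableAt l _) (hA.differentiableAt_metricChristoffel _ i j),
    Finset.sum_add_distrib, add_sub_cancel_left]

/-- The Koszul formula for the variation of the Levi-Civita connection, along the flow of `X`. -/
theorem sum_mul_lieConnection (hA : IsMetricAt A y)
    (hX : ∀ k, ContDiffAt ℝ 2 (fun z ↦ X z k) y) (l i j : Fin n) :
    ∑ k, A y l k * lieConnection A X k i j y
      = lowerChristoffel (lieMatrix A X) l i j y
        - ∑ k, metricChristoffel A k i j y * lieMatrix A X y k l := by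
  have lower (F : Fin n → Fin n → ℝ) (w : Fin n → ℝ) :
      ∑ k, A y l k * ∑ a, F k a * w a = ∑ a, (∑ k, A y l k * F k a) * w a := by
    simp only [Finset.mul_sum, Finset.sum_mul, mul_assoc]
    exact Finset.sum_comm
  have transport : ∑ k, A y l k * ∑ c, X y c * pd c (metricChristoffel A k i j) y
      = ∑ c, X y c * pd c (lowerChristoffel A l i j) y
        - ∑ k, metricChristoffel A k i j y * ∑ c, X y c * pd c (fun z ↦ A z k l) y := by
    simp only [mul_comm (X y _), lower]
    simp only [hA.sum_mul_pd_metricChristoffel, sub_mul, Finset.sum_sub_distrib, Finset.mul_sum,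
      Finset.sum_mul]
    rw [Finset.sum_comm (γ := Fin n)]
    simp only [hA.pd_symm _ l, mul_left_comm, mul_comm]
  have dual : ∑ k, metricChristoffel A k i j y * ∑ m, A y k m * pd l (fun z ↦ X z m) y
      = ∑ m, lowerChristoffel A m i j y * pd l (fun z ↦ X z m) y := by
    simp only [← sum_mul_metricChristoffel hA.pos.ne', Finset.mul_sum, Finset.sum_mul]
    rw [Finset.sum_comm]
    simp only [hA.symm.self_of_nhds.apply _ _, mul_left_comm, mul_assoc]
  have gradient : ∑ k, A y l k * ∑ m, metricChristoffel A m i j y * pd m (fun z ↦ X z k) y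
      = ∑ k, metricChristoffel A k i j y * ∑ m, A y m l * pd k (fun z ↦ X z m) y := by
    simp only [Finset.mul_sum]
    rw [Finset.sum_comm]
    simp only [hA.symm.self_of_nhds.apply l _, mul_left_comm]
  simp only [lieConnection, lieMatrix, Matrix.of_apply, hA.lowerChristoffel_lieMatrix hX, mul_add,
    mul_sub, Finset.sum_add_distrib, Finset.sum_sub_distrib, transport, dual, gradient, lower,
    sum_mul_metricChristoffel hA.pos.ne']
  ring

theorem stressDiv_lieMatrix (hA : IsMetricAt A y)
    (hX : ∀ k, ContDiffAt ℝ 2 (fun z ↦ X z k) y) (l : Fin n) :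
    stressDiv A (lieMatrix A X) l y = ∑ k, A y l k * lieTension A X k y := by
  simp only [stressDiv, lieTension, ← hA.sum_mul_lieConnection hX, contract_sum,
    contract_const_mul]

theorem sqrt_det_mul_contract_lieMatrix (hA : IsMetricAt A y)
    (hX : ∀ k, DifferentiableAt ℝ (fun z ↦ X z k) y) :
    √(A y).det * contract (A y)⁻¹ (lieMatrix A X y)
      = 2 * ∑ k, pd k (fun z ↦ √(A z).det * X z k) y := by
  have stretch : contract (A y)⁻¹ (fun i j ↦ ∑ k, A y k j * pd i (fun z ↦ X z k) y)
      = ∑ k, pd k (fun z ↦ X z k) y := by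
    rw [contract_sum]
    refine Finset.sum_congr rfl fun k _ ↦ ?_
    rw [← contract_mul_eq hA.inv_mul (fun i ↦ pd i (fun z ↦ X z k) y) k]
    simp only [hA.symm.self_of_nhds.apply, mul_comm]
  have stretch' : contract (A y)⁻¹ (fun i j ↦ ∑ k, A y i k * pd j (fun z ↦ X z k) y)
      = ∑ k, pd k (fun z ↦ X z k) y := by
    rw [← stretch, ← contract_comm hA.isSymm_inv]
    simp only [hA.symm.self_of_nhds.apply]
  have transport : contract (A y)⁻¹ (fun i j ↦ ∑ k, X y k * pd k (fun z ↦ A z i j) y)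
      = 2 * ∑ k, (∑ a, metricChristoffel A a a k y) * X y k := by
    simp only [contract_sum, contract_const_mul, hA.contract_inv_pd]
    rw [Finset.mul_sum]
    exact Finset.sum_congr rfl fun k _ ↦ by ring
  have trace_eq : contract (A y)⁻¹ (lieMatrix A X y)
      = 2 * ∑ k, ((∑ a, metricChristoffel A a a k y) * X y k + pd k (fun z ↦ X z k) y) := by
    rw [Finset.sum_add_distrib, mul_add, ← transport, two_mul, ← add_assoc]
    nth_rw 1 [← stretch]
    rw [← stretch', ← contract_add, ← contract_add]
    simp only [← Finset.sum_add_distrib]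
    rfl
  simp only [trace_eq, pd_mul _ hA.differentiableAt_sqrt_det (hX _), hA.pd_sqrt_det, mul_assoc,
    ← mul_add, ← Finset.mul_sum]
  ring

end IsMetricAt

end LieDerivative

section ChangeOfVariables

variable {n m : ℕ} {ι κ μ : Type*} {y : Rn n}

theorem fderiv_apply_coord {ψ : Rn n → Rn m} (hψ : DifferentiableAt ℝ ψ y) (v : Rn n)
    (a : Fin m) : fderiv ℝ (fun z ↦ ψ z a) y v = fderiv ℝ ψ y v a :=
  congrArg (fun L : Rn n →L[ℝ] ℝ ↦ L v)
    ((EuclideanSpace.proj a : Rn m →L[ℝ] ℝ).hasFDerivAt.comp y hψ.hasFDerivAt).fderiv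

theorem pd_comp {ψ : Rn n → Rn m} {F : Rn m → ℝ} (hψ : DifferentiableAt ℝ ψ y)
    (hF : DifferentiableAt ℝ F (ψ y)) (i : Fin n) :
    pd i (fun z ↦ F (ψ z)) y = ∑ c, pd c F (ψ y) * pd i (fun z ↦ ψ z c) y := by
  have chain : pd i (fun z ↦ F (ψ z)) y
      = fderiv ℝ F (ψ y) (fderiv ℝ ψ y (EuclideanSpace.single i 1)) :=
    congrArg (fun L : Rn n →L[ℝ] ℝ ↦ L (EuclideanSpace.single i 1))
      (hF.hasFDerivAt.comp y hψ.hasFDerivAt).fderiv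
  rw [chain, fderiv_eq_sum_pd]
  simp only [pd, fderiv_apply_coord hψ, mul_comm]

/-- The Jacobian matrix of a map, given by its components. -/
def jacobianMatrix (F : Rn n → κ → ℝ) (y : Rn n) : Matrix κ (Fin n) ℝ :=
  Matrix.of fun a i ↦ pd i (fun z ↦ F z a) y

/-- The derivative of a matrix-valued function in the direction of the vector `v`. -/
def pdAlong (v : Fin n → ℝ) (F : Rn n → Matrix ι κ ℝ) (y : Rn n) : Matrix ι κ ℝ :=
  Matrix.of fun i j ↦ ∑ k, v k * pd k (fun z ↦ F z i j) y

theorem pdAlong_transpose (v : Fin n → ℝ) (F : Rn n → Matrix ι κ ℝ) :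
    pdAlong v (fun z ↦ (F z).transpose) y = (pdAlong v F y).transpose :=
  rfl

theorem pdAlong_mul [Fintype κ] (v : Fin n → ℝ) {F : Rn n → Matrix ι κ ℝ} {G : Rn n → Matrix κ μ ℝ}
    (hF : ∀ i j, DifferentiableAt ℝ (fun z ↦ F z i j) y)
    (hG : ∀ i j, DifferentiableAt ℝ (fun z ↦ G z i j) y) :
    pdAlong v (fun z ↦ F z * G z) y = pdAlong v F y * G y + F y * pdAlong v G y := by
  ext i j
  simp only [pdAlong, Matrix.of_apply, Matrix.add_apply, Matrix.mul_apply,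
    pd_sum _ fun c ↦ (hF i c).fun_mul (hG c j), pd_mul _ (hF i _) (hG _ j), Finset.mul_sum,
    Finset.sum_mul, ← Finset.sum_add_distrib]
  rw [Finset.sum_comm]
  exact Finset.sum_congr rfl fun c _ ↦ Finset.sum_congr rfl fun k _ ↦ by ring

theorem pdAlong_comp (v : Fin n → ℝ) {ψ : Rn n → Rn m} {F : Rn m → Matrix ι κ ℝ}
    (hψ : DifferentiableAt ℝ ψ y) (hF : ∀ i j, DifferentiableAt ℝ (fun z ↦ F z i j) (ψ y)) :
    pdAlong v (fun z ↦ F (ψ z)) y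
      = pdAlong ((jacobianMatrix (fun z a ↦ ψ z a) y).mulVec v) F (ψ y) := by
  ext i j
  simp only [pdAlong, Matrix.of_apply, pd_comp (F := fun z ↦ F z i j) hψ (hF i j), Matrix.mulVec,
    dotProduct, jacobianMatrix, Finset.mul_sum, Finset.sum_mul]
  rw [Finset.sum_comm]
  exact Finset.sum_congr rfl fun c _ ↦ Finset.sum_congr rfl fun k _ ↦ by ring

theorem pdAlong_congr {v : Fin n → ℝ} {F G : Rn n → Matrix ι κ ℝ} (h : F =ᶠ[𝓝 y] G) :
    pdAlong v F y = pdAlong v G y := by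
  ext i j
  have (k : Fin n) : pd k (fun z ↦ F z i j) y = pd k (fun z ↦ G z i j) y :=
    pd_congr (h.mono fun z hz ↦ congrFun (congrFun hz i) j)
  simp only [pdAlong, Matrix.of_apply, this]

theorem lieMatrix_eq (A : Rn n → Matrix (Fin n) (Fin n) ℝ) (X : Rn n → Fin n → ℝ) :
    lieMatrix A X y
      = pdAlong (X y) A y + (jacobianMatrix X y).transpose * A y + A y * jacobianMatrix X y := by
  ext i j
  simp only [lieMatrix, pdAlong, jacobianMatrix, Matrix.of_apply, Matrix.add_apply,
    Matrix.mul_apply, Matrix.transpose_apply, Finset.sum_add_distrib, mul_comm (A y _ j)]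

theorem jacobianMatrix_mul_jacobianMatrix {ψ : Rn n → Rn m} {X : Rn n → Fin n → ℝ}
    {X' : Rn m → Fin m → ℝ} (hψ : ContDiffAt ℝ 2 ψ y)
    (hX : ∀ k, DifferentiableAt ℝ (fun z ↦ X z k) y)
    (hX' : ∀ k, DifferentiableAt ℝ (fun z ↦ X' z k) (ψ y))
    (hXX' : ∀ᶠ z in 𝓝 y, X' (ψ z) = (jacobianMatrix (fun z a ↦ ψ z a) z).mulVec (X z)) :
    jacobianMatrix (fun z a ↦ ψ z a) y * jacobianMatrix X y
      = jacobianMatrix X' (ψ y) * jacobianMatrix (fun z a ↦ ψ z a) y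
        - pdAlong (X y) (jacobianMatrix fun z a ↦ ψ z a) y := by
  have hψc (a : Fin m) : ContDiffAt ℝ 2 (fun z ↦ ψ z a) y :=
    (EuclideanSpace.proj a : Rn m →L[ℝ] ℝ).contDiff.contDiffAt.comp y hψ
  have hJ (a : Fin m) (i : Fin n) : DifferentiableAt ℝ (pd i fun z ↦ ψ z a) y :=
    differentiableAt_pd (hψc a) i
  ext a k
  have derivative : ∑ c, pd c (fun z ↦ X' z a) (ψ y) * pd k (fun z ↦ ψ z c) y
      = ∑ i, (X y i * pd i (pd k fun z ↦ ψ z a) y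
        + pd i (fun z ↦ ψ z a) y * pd k (fun z ↦ X z i) y) := by
    rw [← pd_comp (F := fun z ↦ X' z a) (hψ.differentiableAt (by simp)) (hX' a),
      pd_congr (hXX'.mono fun z hz ↦ congrFun hz a)]
    simp only [Matrix.mulVec, dotProduct, jacobianMatrix, Matrix.of_apply,
      pd_sum k fun i ↦ (hJ a i).fun_mul (hX i), pd_mul k (hJ a _) (hX _), pd_comm (hψc a) k,
      mul_comm (X y _)]
  simp only [Matrix.sub_apply, Matrix.mul_apply, pdAlong, jacobianMatrix, Matrix.of_apply,
    derivative, Finset.sum_add_distrib, add_sub_cancel_left]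

theorem lieMatrix_pullback {ψ : Rn n → Rn m} {A : Rn n → Matrix (Fin n) (Fin n) ℝ}
    {A' : Rn m → Matrix (Fin m) (Fin m) ℝ} {X : Rn n → Fin n → ℝ} {X' : Rn m → Fin m → ℝ}
    (hψ : ContDiffAt ℝ 2 ψ y)
    (hA' : ∀ a b, DifferentiableAt ℝ (fun z ↦ A' z a b) (ψ y))
    (hX : ∀ k, DifferentiableAt ℝ (fun z ↦ X z k) y)
    (hX' : ∀ k, DifferentiableAt ℝ (fun z ↦ X' z k) (ψ y))
    (hA : ∀ᶠ z in 𝓝 y, A z = (jacobianMatrix (fun z a ↦ ψ z a) z).transpose * A' (ψ z)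
      * jacobianMatrix (fun z a ↦ ψ z a) z)
    (hXX' : ∀ᶠ z in 𝓝 y, X' (ψ z) = (jacobianMatrix (fun z a ↦ ψ z a) z).mulVec (X z)) :
    lieMatrix A X y = (jacobianMatrix (fun z a ↦ ψ z a) y).transpose * lieMatrix A' X' (ψ y)
      * jacobianMatrix (fun z a ↦ ψ z a) y := by
  have hψ₁ : DifferentiableAt ℝ ψ y := hψ.differentiableAt (by simp)
  have hJ (a : Fin m) (i : Fin n) :
      DifferentiableAt ℝ (fun z ↦ jacobianMatrix (fun z a ↦ ψ z a) z a i) y :=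
    differentiableAt_pd ((EuclideanSpace.proj a : Rn m →L[ℝ] ℝ).contDiff.contDiffAt.comp y hψ) i
  have hJT (i : Fin n) (a : Fin m) :
      DifferentiableAt ℝ (fun z ↦ (jacobianMatrix (fun z a ↦ ψ z a) z).transpose i a) y := hJ a i
  have hA'ψ (a b : Fin m) : DifferentiableAt ℝ (fun z ↦ A' (ψ z) a b) y := (hA' a b).comp y hψ₁
  have hJA (i : Fin n) (b : Fin m) : DifferentiableAt ℝ
      (fun z ↦ ((jacobianMatrix (fun z a ↦ ψ z a) z).transpose * A' (ψ z)) i b) y := by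
    simp only [Matrix.mul_apply]
    exact DifferentiableAt.fun_sum fun a _ ↦ (hJT i a).fun_mul (hA'ψ a b)
  have commute := jacobianMatrix_mul_jacobianMatrix hψ hX hX' hXX'
  have commute_transpose := congrArg Matrix.transpose commute
  rw [Matrix.transpose_mul, Matrix.transpose_sub, Matrix.transpose_mul] at commute_transpose
  rw [lieMatrix_eq, lieMatrix_eq, pdAlong_congr hA, pdAlong_mul _ hJA hJ,
    pdAlong_mul _ hJT hA'ψ, pdAlong_transpose, pdAlong_comp _ hψ₁ hA',
    hA.self_of_nhds, hXX'.self_of_nhds, Matrix.mul_assoc _ _ (jacobianMatrix X y), commute,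
    ← Matrix.mul_assoc, ← Matrix.mul_assoc, commute_transpose]
  simp only [Matrix.add_mul, Matrix.mul_add, Matrix.sub_mul, Matrix.mul_sub, Matrix.mul_assoc]
  abel

end ChangeOfVariables

section Transition

variable {n m : ℕ} {M : Type*} [TopologicalSpace M] [ChartedSpace (Rn n) M]

/-- The derivative of the inverse of the chart at `p`, as an endomorphism of `ℝⁿ`. -/
def symmDeriv (p : M) (y : Rn n) : Rn n →L[ℝ] Rn n :=
  mfderiv (𝓡 n) (𝓡 n) (extChartAt (𝓡 n) p).symm y

/-- The derivative of the chart at `p`, as an endomorphism of `ℝⁿ`. -/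
def chartDeriv (p x : M) : Rn n →L[ℝ] Rn n :=
  mfderiv (𝓡 n) (𝓡 n) (extChartAt (𝓡 n) p) x

/-- The change of coordinates from the chart at `p` to the chart at `q`. -/
def transition (p q : M) (y : Rn n) : Rn n :=
  extChartAt (𝓡 n) q ((extChartAt (𝓡 n) p).symm y)

/-- The coordinates, in the chart at `p`, of the overlap with the domain of the chart at `q`. -/
def overlap (p q : M) : Set (Rn n) :=
  (extChartAt (𝓡 n) p).target ∩ (extChartAt (𝓡 n) p).symm ⁻¹' (extChartAt (𝓡 n) q).source

/-- The Jacobian matrix of the change of coordinates from the chart at `p` to the chart at `q`. -/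
def jacobian (p q : M) (y : Rn n) : Matrix (Fin n) (Fin n) ℝ :=
  jacobianMatrix (fun z a ↦ transition p q z a) y

/-- The tensor field `h` is bilinear at `x`. -/
def IsBilinAt (h : ∀ x : M, TangentSpace (𝓡 n) x → TangentSpace (𝓡 n) x → ℝ) (x : M) : Prop :=
  ∃ B : Rn n →ₗ[ℝ] Rn n →ₗ[ℝ] ℝ, ∀ v w : Rn n, h x v w = B v w

theorem isOpen_overlap (p q : M) : IsOpen (overlap (n := n) p q) :=
  (continuousOn_extChartAt_symm p).isOpen_inter_preimage (isOpen_extChartAt_target p)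
    (isOpen_extChartAt_source q)

theorem mem_overlap_center {p : M} {y : Rn n} (hy : y ∈ (extChartAt (𝓡 n) p).target) :
    y ∈ overlap p ((extChartAt (𝓡 n) p).symm y) :=
  ⟨hy, mem_extChartAt_source _⟩

theorem transition_mem_overlap {p q : M} {y : Rn n} (hy : y ∈ overlap (n := n) p q) :
    transition p q y ∈ overlap (n := n) q p := by
  refine ⟨(extChartAt (𝓡 n) q).map_source hy.2, ?_⟩
  rw [mem_preimage, transition, (extChartAt (𝓡 n) q).left_inv hy.2]
  exact (extChartAt (𝓡 n) p).map_target hy.1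

theorem transition_transition {p q : M} {y : Rn n} (hy : y ∈ overlap (n := n) p q) :
    transition q p (transition p q y) = y := by
  rw [transition, transition, (extChartAt (𝓡 n) q).left_inv hy.2,
    (extChartAt (𝓡 n) p).right_inv hy.1]

theorem continuousOn_source_of_symm {E : Type*} [TopologicalSpace E] {p : M} {F : M → E}
    (hF : ContinuousOn (fun y ↦ F ((extChartAt (𝓡 n) p).symm y)) (extChartAt (𝓡 n) p).target) :
    ContinuousOn F (extChartAt (𝓡 n) p).source :=
  (hF.comp (continuousOn_extChartAt p) fun _ hx ↦ (extChartAt (𝓡 n) p).map_source hx).congr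
    fun _ hx ↦ congrArg F ((extChartAt (𝓡 n) p).left_inv hx).symm

theorem continuous_of_symm {E : Type*} [TopologicalSpace E] {F : M → E}
    (hF : ∀ p : M, ContinuousOn (fun y : Rn n ↦ F ((extChartAt (𝓡 n) p).symm y))
      (extChartAt (𝓡 n) p).target) : Continuous F :=
  continuous_iff_continuousAt.2 fun p ↦ (continuousOn_source_of_symm (hF p)).continuousAt
    ((isOpen_extChartAt_source p).mem_nhds (mem_extChartAt_source p))

theorem bilin_eq_sum (B : Rn m →ₗ[ℝ] Rn m →ₗ[ℝ] ℝ) (L : Rn n →L[ℝ] Rn m) (v w : Rn n) :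
    B (L v) (L w) = ∑ a, ∑ b, B (L (EuclideanSpace.single a 1)) (L (EuclideanSpace.single b 1))
      * v a * w b := by
  conv_lhs => rw [← sum_smul_single v, ← sum_smul_single w]
  simp only [map_sum, map_smul, LinearMap.sum_apply, LinearMap.smul_apply, smul_eq_mul,
    Finset.mul_sum]
  rw [Finset.sum_comm]
  exact Finset.sum_congr rfl fun i _ ↦ Finset.sum_congr rfl fun j _ ↦ by ring

theorem dotProduct_coordTensor_mulVec
    {h : ∀ x : M, TangentSpace (𝓡 n) x → TangentSpace (𝓡 n) x → ℝ}
    (hh : IsBilinAt h ((extChartAt (𝓡 n) p).symm y)) (v : Fin n → ℝ) :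
    v ⬝ᵥ (coordTensor h p y).mulVec v
      = h ((extChartAt (𝓡 n) p).symm y) (symmDeriv p y (WithLp.toLp 2 v))
        (symmDeriv p y (WithLp.toLp 2 v)) := by
  obtain ⟨B, hB⟩ := hh
  have component (i j : Fin n) : coordTensor h p y i j
      = B (symmDeriv p y (EuclideanSpace.single i 1)) (symmDeriv p y (EuclideanSpace.single j 1)) :=
    hB _ _
  refine Eq.trans ?_ (hB _ _).symm
  rw [bilin_eq_sum]
  simp only [dotProduct, Matrix.mulVec, Finset.mul_sum, component]
  exact Finset.sum_congr rfl fun i _ ↦ Finset.sum_congr rfl fun j _ ↦ by ring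

theorem isBilinAt_clm (B : ∀ x : M, TangentSpace (𝓡 n) x →L[ℝ] TangentSpace (𝓡 n) x →L[ℝ] ℝ)
    (x : M) : IsBilinAt (fun x v w ↦ B x v w) x :=
  ⟨LinearMap.mk₂ ℝ (fun v w : Rn n ↦ B x v w)
    (fun _ _ _ ↦ congrArg (fun L : Rn n →L[ℝ] ℝ ↦ L _) ((B x).map_add _ _))
    (fun _ _ _ ↦ congrArg (fun L : Rn n →L[ℝ] ℝ ↦ L _) ((B x).map_smul _ _))
    (fun _ _ _ ↦ (B x _).map_add _ _) (fun _ _ _ ↦ (B x _).map_smul _ _), fun _ _ ↦ rfl⟩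

end Transition

section Charts

variable {n m : ℕ} {M N : Type*}
  [TopologicalSpace M] [ChartedSpace (Rn n) M] [IsManifold (𝓡 n) ∞ M]
  [TopologicalSpace N] [ChartedSpace (Rn m) N] [IsManifold (𝓡 m) ∞ N]
  {p q : M} {y : Rn n}

theorem contMDiffAt_chart_symm (hy : y ∈ (extChartAt (𝓡 n) p).target) :
    ContMDiffAt (𝓡 n) (𝓡 n) ∞ (extChartAt (𝓡 n) p).symm y :=
  (contMDiffOn_extChartAt_symm p).contMDiffAt ((isOpen_extChartAt_target p).mem_nhds hy)

theorem contMDiffAt_chart {x : M} (hx : x ∈ (extChartAt (𝓡 n) p).source) :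
    ContMDiffAt (𝓡 n) (𝓡 n) ∞ (extChartAt (𝓡 n) p) x :=
  contMDiffAt_extChartAt' (by simpa using hx)

theorem chartDeriv_symmDeriv (hy : y ∈ (extChartAt (𝓡 n) p).target)
    (v : Rn n) : chartDeriv p ((extChartAt (𝓡 n) p).symm y) (symmDeriv p y v) = v := by
  have := mfderiv_extChartAt_comp_mfderivWithin_extChartAt_symm (I := 𝓡 n) (x := p) hy
  rw [ModelWithCorners.range_eq_univ, mfderivWithin_univ] at this
  exact congrArg (fun L : Rn n →L[ℝ] Rn n ↦ L v) this

theorem symmDeriv_chartDeriv (hy : y ∈ (extChartAt (𝓡 n) p).target)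
    (v : Rn n) : symmDeriv p y (chartDeriv p ((extChartAt (𝓡 n) p).symm y) v) = v := by
  have := mfderivWithin_extChartAt_symm_comp_mfderiv_extChartAt (I := 𝓡 n) (x := p) hy
  rw [ModelWithCorners.range_eq_univ, mfderivWithin_univ] at this
  exact congrArg (fun L : Rn n →L[ℝ] Rn n ↦ L v) this

theorem symmDeriv_chartDeriv_of_mem {x : M} (hx : x ∈ (extChartAt (𝓡 n) p).source)
    (v : Rn n) : symmDeriv p (extChartAt (𝓡 n) p x) (chartDeriv p x v) = v := by
  have := symmDeriv_chartDeriv ((extChartAt (𝓡 n) p).map_source hx) v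
  rwa [(extChartAt (𝓡 n) p).left_inv hx] at this

theorem contDiffAt_transition (hy : y ∈ overlap (n := n) p q) :
    ContDiffAt ℝ ∞ (transition (n := n) p q) y :=
  ((contMDiffAt_chart hy.2).comp y (contMDiffAt_chart_symm hy.1)).contDiffAt

theorem fderiv_transition (hy : y ∈ overlap (n := n) p q) (v : Rn n) :
    fderiv ℝ (transition (n := n) p q) y v
      = chartDeriv q ((extChartAt (𝓡 n) p).symm y) (symmDeriv p y v) := by
  have chain := mfderiv_comp y ((contMDiffAt_chart hy.2).mdifferentiableAt (by simp))
    ((contMDiffAt_chart_symm hy.1).mdifferentiableAt (by simp))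
  exact congrArg (fun L : Rn n →L[ℝ] Rn n ↦ L v) (mfderiv_eq_fderiv.symm.trans chain)

theorem symmDeriv_fderiv_transition (hy : y ∈ overlap (n := n) p q)
    (v : Rn n) :
    symmDeriv q (transition p q y) (fderiv ℝ (transition (n := n) p q) y v) = symmDeriv p y v := by
  rw [fderiv_transition hy, transition, symmDeriv_chartDeriv_of_mem hy.2]

theorem fderiv_transition_fderiv_transition (hy : y ∈ overlap (n := n) p q) (v : Rn n) :
    fderiv ℝ (transition (n := n) q p) (transition p q y)
      (fderiv ℝ (transition (n := n) p q) y v) = v := by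
  rw [fderiv_transition (transition_mem_overlap hy), symmDeriv_fderiv_transition hy, transition,
    (extChartAt (𝓡 n) q).left_inv hy.2, chartDeriv_symmDeriv hy.1]

theorem jacobian_apply (hy : y ∈ overlap (n := n) p q) (a i : Fin n) :
    jacobian p q y a i = fderiv ℝ (transition (n := n) p q) y (EuclideanSpace.single i 1) a :=
  fderiv_apply_coord ((contDiffAt_transition hy).differentiableAt (by simp)) _ a

theorem det_jacobian (hy : y ∈ overlap (n := n) p q) :
    (jacobian p q y).det = (fderiv ℝ (transition (n := n) p q) y).det := by
  rw [ContinuousLinearMap.det,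
    ← LinearMap.det_toMatrix (EuclideanSpace.basisFun (Fin n) ℝ).toBasis]
  congr 1
  ext a i
  rw [jacobian_apply hy, LinearMap.toMatrix_apply]
  simp

theorem det_jacobian_ne_zero (hy : y ∈ overlap (n := n) p q) :
    (jacobian p q y).det ≠ 0 := by
  have left_inverse : (fderiv ℝ (transition (n := n) q p) (transition p q y)) ∘L
      (fderiv ℝ (transition (n := n) p q) y) = ContinuousLinearMap.id ℝ _ :=
    ContinuousLinearMap.ext (fderiv_transition_fderiv_transition hy)
  intro singular
  rw [det_jacobian hy, ContinuousLinearMap.det] at singular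
  have := congrArg (fun L : Rn n →L[ℝ] Rn n ↦ LinearMap.det (L : Rn n →ₗ[ℝ] Rn n)) left_inverse
  simp [singular] at this

theorem coordTensor_eq_sum {h : ∀ x : M, TangentSpace (𝓡 n) x → TangentSpace (𝓡 n) x → ℝ}
    (hy : y ∈ overlap (n := n) p q)
    (hh : IsBilinAt h ((extChartAt (𝓡 n) p).symm y)) (i j : Fin n) :
    coordTensor h p y i j = ∑ a, ∑ b, coordTensor h q (transition p q y) a b
      * jacobian p q y a i * jacobian p q y b j := by
  obtain ⟨B, hB⟩ := hh
  have hq (a b : Fin n) : coordTensor h q (transition p q y) a b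
      = B (symmDeriv q (transition p q y) (EuclideanSpace.single a 1))
        (symmDeriv q (transition p q y) (EuclideanSpace.single b 1)) := by
    rw [← hB]
    exact congrArg (fun x ↦ (h : M → Rn n → Rn n → ℝ) x _ _) ((extChartAt (𝓡 n) q).left_inv hy.2)
  have hp : coordTensor h p y i j
      = B (symmDeriv p y (EuclideanSpace.single i 1)) (symmDeriv p y (EuclideanSpace.single j 1)) :=
    hB _ _
  rw [hp, ← symmDeriv_fderiv_transition hy, ← symmDeriv_fderiv_transition hy, bilin_eq_sum]
  simp only [hq, jacobian_apply hy]

theorem coordTensor_eq_mul {h : ∀ x : M, TangentSpace (𝓡 n) x → TangentSpace (𝓡 n) x → ℝ}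
    (hy : y ∈ overlap (n := n) p q)
    (hh : IsBilinAt h ((extChartAt (𝓡 n) p).symm y)) :
    coordTensor h p y
      = (jacobian p q y).transpose * coordTensor h q (transition p q y) * jacobian p q y := by
  ext i j
  rw [coordTensor_eq_sum hy hh, Matrix.mul_apply, Finset.sum_comm]
  simp only [Matrix.mul_apply, Matrix.transpose_apply, Finset.sum_mul]
  exact Finset.sum_congr rfl fun i _ ↦ Finset.sum_congr rfl fun j _ ↦ by ring

theorem contMDiffAt_mfderiv_apply_const {F : Rn n → N}
    (hF : ContMDiffAt (𝓡 n) (𝓡 m) ∞ F y) (u : Rn n) :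
    ContMDiffAt (𝓡 n) ((𝓡 m).prod (𝓡 m)) ∞
      (fun z ↦ (Bundle.TotalSpace.mk' (Rn m) (F z) (mfderiv (𝓡 n) (𝓡 m) F z u) :
        TangentBundle (𝓡 m) N)) y := by
  have const : ContMDiffAt (𝓡 n) ((𝓡 n).prod (𝓡 n)) ∞
      (fun z ↦ (Bundle.TotalSpace.mk' (Rn n) z u : TangentBundle (𝓡 n) (Rn n))) y :=
    contMDiffAt_vectorSpace_iff_contDiffAt.2 contDiffAt_const
  exact ContMDiffAt.clm_apply_of_inCoordinates (hF.mfderiv_const (m := ∞) (by simp)) const hF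

theorem contDiffAt_tensor_pullback
    {B : ∀ x : N, TangentSpace (𝓡 m) x →L[ℝ] TangentSpace (𝓡 m) x →L[ℝ] ℝ}
    (hB : ContMDiff (𝓡 m) ((𝓡 m).prod 𝓘(ℝ, Rn m →L[ℝ] Rn m →L[ℝ] ℝ)) ∞
      (fun x ↦ Bundle.TotalSpace.mk' (Rn m →L[ℝ] Rn m →L[ℝ] ℝ) x (B x)))
    {F : Rn n → N} (hF : ContMDiffAt (𝓡 n) (𝓡 m) ∞ F y) (v w : Rn n) :
    ContDiffAt ℝ ∞
      (fun z ↦ B (F z) (mfderiv (𝓡 n) (𝓡 m) F z v) (mfderiv (𝓡 n) (𝓡 m) F z w)) y :=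
  (Bundle.contMDiffAt_totalSpace.1 <|
    ContMDiffAt.clm_bundle_apply₂ (F₁ := Rn m) (F₂ := Rn m) (F₃ := ℝ) (b := F)
      (E₃ := fun _ : N ↦ ℝ) (hB.contMDiffAt.comp y hF) (contMDiffAt_mfderiv_apply_const hF v)
      (contMDiffAt_mfderiv_apply_const hF w)).2.contDiffAt

theorem contDiffAt_form_pullback
    {B : ∀ x : N, TangentSpace (𝓡 m) x →L[ℝ] ℝ}
    (hB : ContMDiff (𝓡 m) ((𝓡 m).prod 𝓘(ℝ, Rn m →L[ℝ] ℝ)) ∞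
      (fun x ↦ Bundle.TotalSpace.mk' (Rn m →L[ℝ] ℝ) x (B x)))
    {F : Rn n → N} (hF : ContMDiffAt (𝓡 n) (𝓡 m) ∞ F y) (v : Rn n) :
    ContDiffAt ℝ ∞ (fun z ↦ B (F z) (mfderiv (𝓡 n) (𝓡 m) F z v)) y :=
  (Bundle.contMDiffAt_totalSpace.1 <|
    ContMDiffAt.clm_bundle_apply (F₁ := Rn m) (F₂ := ℝ) (b := F) (E₂ := fun _ : N ↦ ℝ)
      (hB.contMDiffAt.comp y hF) (contMDiffAt_mfderiv_apply_const hF v)).2.contDiffAt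

theorem contDiffAt_coordTensor (φ : TwoTensor n M) (hy : y ∈ (extChartAt (𝓡 n) p).target)
    (i j : Fin n) : ContDiffAt ℝ ∞ (fun z ↦ coordTensor (fun x v w ↦ φ x v w) p z i j) y :=
  contDiffAt_tensor_pullback φ.contMDiff (contMDiffAt_chart_symm hy) _ _

theorem contDiffAt_coordForm (θ : OneForm n M) (hy : y ∈ (extChartAt (𝓡 n) p).target)
    (i : Fin n) : ContDiffAt ℝ ∞ (fun z ↦ coordForm (fun x v ↦ θ x v) p z i) y :=
  contDiffAt_form_pullback θ.contMDiff (contMDiffAt_chart_symm hy) _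

end Charts

section Pullback

variable {n m : ℕ} {M N : Type*}
  [TopologicalSpace M] [ChartedSpace (Rn n) M]
  [TopologicalSpace N] [ChartedSpace (Rn m) N] [IsManifold (𝓡 m) ∞ N]
  (gbar : RiemMetric m N) {p : M} {y : Rn n}

theorem isBilinAt_pullbackMetric (f : M → N) (x : M) :
    IsBilinAt (pullbackMetric (n := n) gbar f) x := by
  obtain ⟨B, hB⟩ := isBilinAt_clm (fun x ↦ gbar.inner x) (f x)
  let L : Rn n →L[ℝ] Rn m := mfderiv (𝓡 n) (𝓡 m) f x
  exact ⟨B.compl₁₂ (L : Rn n →ₗ[ℝ] Rn m) (L : Rn n →ₗ[ℝ] Rn m), fun v w ↦ hB (L v) (L w)⟩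

variable [IsManifold (𝓡 n) ∞ M]

theorem coordTensor_pullbackMetric {f : M → N}
    (hf : MDifferentiableAt (𝓡 n) (𝓡 m) f ((extChartAt (𝓡 n) p).symm y))
    (hy : y ∈ (extChartAt (𝓡 n) p).target) (i j : Fin n) :
    coordTensor (pullbackMetric gbar f) p y i j
      = gbar.inner (f ((extChartAt (𝓡 n) p).symm y))
        (mfderiv (𝓡 n) (𝓡 m) (f ∘ (extChartAt (𝓡 n) p).symm) y (EuclideanSpace.single i 1 : Rn n))
        (mfderiv (𝓡 n) (𝓡 m) (f ∘ (extChartAt (𝓡 n) p).symm) y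
          (EuclideanSpace.single j 1 : Rn n)) := by
  rw [mfderiv_comp y hf ((contMDiffAt_chart_symm hy).mdifferentiableAt (by simp))]
  rfl

theorem contDiffAt_coordTensor_pullbackMetric {f : M → N}
    (hf : ContMDiff (𝓡 n) (𝓡 m) ∞ f) (hy : y ∈ (extChartAt (𝓡 n) p).target) (i j : Fin n) :
    ContDiffAt ℝ ∞ (fun z ↦ coordTensor (pullbackMetric gbar f) p z i j) y := by
  refine (contDiffAt_tensor_pullback gbar.contMDiff
    (hf.contMDiffAt.comp y (contMDiffAt_chart_symm hy)) (EuclideanSpace.single i 1)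
    (EuclideanSpace.single j 1)).congr_of_eventuallyEq ?_
  filter_upwards [(isOpen_extChartAt_target p).mem_nhds hy] with z hz
  exact coordTensor_pullbackMetric gbar (hf.mdifferentiableAt (by simp)) hz i j

end Pullback

section Metric

variable {n : ℕ}

theorem contract_eq_trace {ι : Type*} [Fintype ι] (B F : Matrix ι ι ℝ) :
    contract B F = (B * F.transpose).trace := by
  simp [contract, Matrix.trace, Matrix.mul_apply]

theorem contract_inv_congruence {T : Matrix (Fin n) (Fin n) ℝ} (hT : T.det ≠ 0)
    (G H : Matrix (Fin n) (Fin n) ℝ) :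
    contract (T.transpose * G * T)⁻¹ (T.transpose * H * T) = contract G⁻¹ H := by
  have hdet : IsUnit T.det := isUnit_iff_ne_zero.2 hT
  have hdet_transpose : IsUnit T.transpose.det := by rwa [Matrix.det_transpose]
  have cancel : T⁻¹ * (G⁻¹ * T.transpose⁻¹) * (T.transpose * (H.transpose * T))
      = T⁻¹ * (G⁻¹ * H.transpose * T) := by
    simp only [Matrix.mul_assoc]
    rw [← Matrix.mul_assoc T.transpose⁻¹, Matrix.nonsing_inv_mul _ hdet_transpose, Matrix.one_mul]
  rw [contract_eq_trace, contract_eq_trace, Matrix.mul_inv_rev, Matrix.mul_inv_rev,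
    Matrix.transpose_mul, Matrix.transpose_mul, Matrix.transpose_transpose, cancel,
    Matrix.trace_mul_comm, Matrix.mul_assoc, Matrix.mul_nonsing_inv _ hdet, Matrix.mul_one]

variable {M : Type*} [TopologicalSpace M] [ChartedSpace (Rn n) M] [IsManifold (𝓡 n) ∞ M]
  (g : RiemMetric n M) {p q : M} {y : Rn n}

theorem isSymm_coordMetric (p : M) (y : Rn n) : (coordMetric g p y).IsSymm := by
  ext i j
  exact g.symm _ _ _

theorem posDef_coordMetric (hy : y ∈ (extChartAt (𝓡 n) p).target) :
    (coordMetric g p y).PosDef := by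
  refine Matrix.posDef_iff_dotProduct_mulVec.2
    ⟨(Matrix.conjTranspose_eq_transpose_of_trivial _).trans (isSymm_coordMetric g p y),
      fun v hv ↦ ?_⟩
  have tangent_ne_zero : symmDeriv p y (WithLp.toLp 2 v) ≠ 0 := fun hzero ↦ hv <| by
    simpa [hzero] using (chartDeriv_symmDeriv hy (WithLp.toLp 2 v)).symm
  rw [star_trivial, coordMetric, dotProduct_coordTensor_mulVec (isBilinAt_clm _ _)]
  exact g.pos _ _ tangent_ne_zero

theorem isMetricAt_coordMetric (hy : y ∈ (extChartAt (𝓡 n) p).target) :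
    IsMetricAt (coordMetric g p) y where
  smooth _ _ := contDiffAt_tensor_pullback g.contMDiff (contMDiffAt_chart_symm hy) _ _
  symm := Eventually.of_forall fun z ↦ isSymm_coordMetric g p z
  pos := (posDef_coordMetric g hy).det_pos

theorem coordMetric_eq_mul (hy : y ∈ overlap p q) :
    coordMetric g p y
      = (jacobian p q y).transpose * coordMetric g q (transition p q y) * jacobian p q y :=
  coordTensor_eq_mul hy (isBilinAt_clm (fun x ↦ g.inner x) _)

theorem christoffel_eq (p : M) (k i j : Fin n) (y : Rn n) :
    christoffel g p k i j y = metricChristoffel (coordMetric g p) k i j y := by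
  simp only [christoffel, metricChristoffel, lowerChristoffel, coordInv, Finset.mul_sum]
  exact Finset.sum_congr rfl fun l _ ↦ by ring

theorem metricTrace_eq {h : ∀ x : M, TangentSpace (𝓡 n) x → TangentSpace (𝓡 n) x → ℝ}
    (hy : y ∈ (extChartAt (𝓡 n) p).target) (hh : IsBilinAt h ((extChartAt (𝓡 n) p).symm y)) :
    metricTrace g h ((extChartAt (𝓡 n) p).symm y)
      = contract (coordMetric g p y)⁻¹ (coordTensor h p y) := by
  have center := mem_overlap_center hy
  rw [coordMetric_eq_mul g center, coordTensor_eq_mul center hh,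
    contract_inv_congruence (det_jacobian_ne_zero center)]
  rfl

theorem sqrt_det_coordMetric (hy : y ∈ overlap p q) :
    √(coordMetric g p y).det = |(fderiv ℝ (transition (n := n) p q) y).det|
      * √(coordMetric g q (transition p q y)).det := by
  rw [coordMetric_eq_mul g hy, Matrix.det_mul, Matrix.det_mul, Matrix.det_transpose,
    ← det_jacobian hy, mul_right_comm, Real.sqrt_mul (mul_self_nonneg _),
    Real.sqrt_mul_self_eq_abs]

end Metric

section LieMetric

variable {n : ℕ} {M : Type*} [TopologicalSpace M] [ChartedSpace (Rn n) M] [IsManifold (𝓡 n) ∞ M]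
  (g : RiemMetric n M) {p q : M} {y : Rn n}

theorem coordField_transition (ξ : ∀ x : M, TangentSpace (𝓡 n) x) (hy : y ∈ overlap p q) :
    coordField ξ q (transition p q y) = (jacobian p q y).mulVec (coordField ξ p y) := by
  ext a
  set x := (extChartAt (𝓡 n) p).symm y
  have hx : (extChartAt (𝓡 n) q).symm (transition p q y) = x := (extChartAt (𝓡 n) q).left_inv hy.2
  have chain (u : Rn n) : chartDeriv q x u = fderiv ℝ (transition p q) y (chartDeriv p x u) := by
    rw [fderiv_transition hy, symmDeriv_chartDeriv hy.1]
  have expand (u : Rn n) :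
      chartDeriv q x u a = ∑ i, jacobian p q y a i * chartDeriv p x u i := by
    rw [chain, ← fderiv_apply_coord ((contDiffAt_transition hy).differentiableAt (by simp)),
      fderiv_eq_sum_pd]
    exact Finset.sum_congr rfl fun i _ ↦ mul_comm _ _
  exact (congrArg (fun x ↦ chartDeriv q x ((ξ : M → Rn n) x) a) hx).trans (expand _)

theorem coordForm_eq_vecMul (θ : OneForm n M) (hy : y ∈ (extChartAt (𝓡 n) p).target) :
    coordForm (fun x v ↦ θ x v) p y
      = Matrix.vecMul (coordField (sharp g θ) p y) (coordMetric g p y) := by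
  ext j
  set x := (extChartAt (𝓡 n) p).symm y
  obtain ⟨B, hB⟩ := isBilinAt_clm (fun x ↦ g.inner x) x
  have expand (u : Rn n) : B u (symmDeriv p y (EuclideanSpace.single j 1))
      = ∑ k, chartDeriv p x u k * B (symmDeriv p y (EuclideanSpace.single k 1))
        (symmDeriv p y (EuclideanSpace.single j 1)) := by
    conv_lhs => rw [← symmDeriv_chartDeriv hy u, ← sum_smul_single (chartDeriv p _ u)]
    simp only [map_sum, map_smul, LinearMap.sum_apply, LinearMap.smul_apply, smul_eq_mul]
    rfl
  refine ((inner_sharp g θ x _).symm.trans (hB _ _)).trans ((expand _).trans ?_)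
  simp only [← hB]
  rfl

theorem coordField_sharp_eq_vecMul (θ : OneForm n M) (hy : y ∈ (extChartAt (𝓡 n) p).target) :
    coordField (sharp g θ) p y
      = Matrix.vecMul (coordForm (fun x v ↦ θ x v) p y) (coordMetric g p y)⁻¹ := by
  rw [coordForm_eq_vecMul g θ hy, Matrix.vecMul_vecMul, (isMetricAt_coordMetric g hy).mul_inv,
    Matrix.vecMul_one]

theorem contDiffAt_coordField_sharp (θ : OneForm n M) (hy : y ∈ (extChartAt (𝓡 n) p).target)
    (k : Fin n) : ContDiffAt ℝ ∞ (fun z ↦ coordField (sharp g θ) p z k) y := by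
  have smooth : ContDiffAt ℝ ∞ (fun z ↦ ∑ j, coordForm (fun x v ↦ θ x v) p z j
      * (coordMetric g p z)⁻¹ j k) y :=
    ContDiffAt.sum fun j _ ↦ (contDiffAt_coordForm θ hy j).mul
      ((isMetricAt_coordMetric g hy).smooth_inv j k)
  refine smooth.congr_of_eventuallyEq ?_
  filter_upwards [(isOpen_extChartAt_target p).mem_nhds hy] with z hz
  exact congrFun (coordField_sharp_eq_vecMul g θ hz) k

theorem differentiableAt_coordField_sharp (θ : OneForm n M)
    (hy : y ∈ (extChartAt (𝓡 n) p).target) (k : Fin n) :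
    DifferentiableAt ℝ (fun z ↦ coordField (sharp g θ) p z k) y :=
  (contDiffAt_coordField_sharp g θ hy k).differentiableAt (by simp)

theorem isBilinAt_lieMetric (ξ : ∀ x : M, TangentSpace (𝓡 n) x) (x : M) :
    IsBilinAt (lieMetric g ξ) x := by
  refine ⟨LinearMap.mk₂ ℝ (fun v w : Rn n ↦ ∑ i, ∑ j, lieMatrix (coordMetric g x) (coordField ξ x)
      (extChartAt (𝓡 n) x x) i j * chartDeriv x x v i * chartDeriv x x w j) ?_ ?_ ?_ ?_,
    fun v w ↦ rfl⟩ <;> intros <;>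
    simp only [map_add, map_smul, PiLp.add_apply, PiLp.smul_apply, smul_eq_mul,
      ← Finset.sum_add_distrib, Finset.mul_sum] <;>
    exact Finset.sum_congr rfl fun _ _ ↦ Finset.sum_congr rfl fun _ _ ↦ by ring

/- The definition of `lieMetric` at `x` uses the chart at `x`; naturality of the Lie derivative
carries the formula to every other chart. -/
theorem coordTensor_lieMetric_sharp (θ : OneForm n M) (hy : y ∈ (extChartAt (𝓡 n) p).target) :
    coordTensor (lieMetric g (sharp g θ)) p y
      = lieMatrix (coordMetric g p) (coordField (sharp g θ) p) y := by
  set x := (extChartAt (𝓡 n) p).symm y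
  have center : y ∈ overlap p x := mem_overlap_center hy
  have target : transition p x y ∈ (extChartAt (𝓡 n) x).target := mem_extChartAt_target x
  have near : ∀ᶠ z in 𝓝 y, z ∈ overlap p x := (isOpen_overlap p x).mem_nhds center
  rw [lieMatrix_pullback ((contDiffAt_transition center).of_le ENat.LEInfty.out)
    (isMetricAt_coordMetric g target).differentiableAt (differentiableAt_coordField_sharp g θ hy)
    (differentiableAt_coordField_sharp g θ target)
    (near.mono fun z hz ↦ coordMetric_eq_mul g hz)
    (near.mono fun z hz ↦ coordField_transition _ hz)]
  ext i j
  have column (i a : Fin n) : chartDeriv x x (symmDeriv p y (EuclideanSpace.single i 1)) a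
      = jacobian p x y a i := by
    rw [jacobian_apply center, fderiv_transition center]
  change ∑ a, ∑ b, lieMatrix (coordMetric g x) (coordField (sharp g θ) x) (transition p x y) a b
    * chartDeriv x x (symmDeriv p y (EuclideanSpace.single i 1)) a
    * chartDeriv x x (symmDeriv p y (EuclideanSpace.single j 1)) b = _
  simp only [column, Matrix.mul_apply, Matrix.transpose_apply, Finset.sum_mul]
  rw [Finset.sum_comm]
  exact Finset.sum_congr rfl fun b _ ↦ Finset.sum_congr rfl fun a _ ↦ by rw [jacobian]; ring

theorem covForm_eq (θ : OneForm n M) (hy : y ∈ (extChartAt (𝓡 n) p).target) (i j : Fin n) :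
    covForm g (fun x v ↦ θ x v) p i j y
      = ∑ k, (pd i (fun z ↦ coordField (sharp g θ) p z k) y * coordMetric g p y k j
        + coordField (sharp g θ) p y k * lowerChristoffel (coordMetric g p) j i k y) := by
  have hA := isMetricAt_coordMetric g hy
  have hX := differentiableAt_coordField_sharp g θ hy
  have derivative : pd i (fun z ↦ coordForm (fun x v ↦ θ x v) p z j) y
      = ∑ k, (pd i (fun z ↦ coordField (sharp g θ) p z k) y * coordMetric g p y k j
        + coordField (sharp g θ) p y k * pd i (fun z ↦ coordMetric g p z k j) y) := by
    rw [pd_congr (((isOpen_extChartAt_target p).eventually_mem hy).mono fun z hz ↦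
      congrFun (coordForm_eq_vecMul g θ hz) j)]
    simp only [Matrix.vecMul, dotProduct]
    rw [pd_sum i fun k ↦ (hX k).fun_mul (hA.differentiableAt k j)]
    exact Finset.sum_congr rfl fun k _ ↦ pd_mul i (hX k) (hA.differentiableAt k j)
  have correction : ∑ l, christoffel g p l i j y * coordForm (fun x v ↦ θ x v) p y l
      = ∑ k, coordField (sharp g θ) p y k * lowerChristoffel (coordMetric g p) k i j y := by
    simp only [← sum_mul_metricChristoffel hA.pos.ne', christoffel_eq, coordForm_eq_vecMul g θ hy,
      Matrix.vecMul, dotProduct, Finset.mul_sum]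
    rw [Finset.sum_comm]
    exact Finset.sum_congr rfl fun k _ ↦ Finset.sum_congr rfl fun l _ ↦ by ring
  rw [covForm, derivative, correction, ← Finset.sum_sub_distrib]
  refine Finset.sum_congr rfl fun k _ ↦ ?_
  rw [lowerChristoffel, lowerChristoffel, hA.pd_symm i j k]
  ring

theorem covForm_add_covForm (θ : OneForm n M) (hy : y ∈ (extChartAt (𝓡 n) p).target)
    (i j : Fin n) :
    covForm g (fun x v ↦ θ x v) p i j y + covForm g (fun x v ↦ θ x v) p j i y
      = lieMatrix (coordMetric g p) (coordField (sharp g θ) p) y i j := by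
  have hA := isMetricAt_coordMetric g hy
  rw [covForm_eq g θ hy, covForm_eq g θ hy, ← Finset.sum_add_distrib]
  refine Finset.sum_congr rfl fun k _ ↦ ?_
  rw [hA.pd_eq_lowerChristoffel k i j, hA.symm.self_of_nhds.apply k i]
  ring

theorem divForm_eq (θ : OneForm n M) (x : M) :
    divForm g (fun x v ↦ θ x v) x = -(1 / 2) * metricTrace g (lieMetric g (sharp g θ)) x := by
  set y := extChartAt (𝓡 n) x x
  have target : y ∈ (extChartAt (𝓡 n) x).target := mem_extChartAt_target x
  have trace : metricTrace g (lieMetric g (sharp g θ)) x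
      = contract (coordMetric g x y)⁻¹
        (lieMatrix (coordMetric g x) (coordField (sharp g θ) x) y) := by
    rw [← coordTensor_lieMetric_sharp g θ target]
    rfl
  have symmetrized : contract (coordMetric g x y)⁻¹
        (lieMatrix (coordMetric g x) (coordField (sharp g θ) x) y)
      = contract (coordMetric g x y)⁻¹ fun i j ↦ covForm g (fun x v ↦ θ x v) x i j y
        + covForm g (fun x v ↦ θ x v) x j i y := by
    simp only [contract, covForm_add_covForm g θ target]
  rw [trace, symmetrized, contract_add,
    contract_comm (isMetricAt_coordMetric g target).isSymm_inv fun i j ↦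
      covForm g (fun x v ↦ θ x v) x i j y, ← two_mul, neg_mul, one_div,
    inv_mul_cancel_left₀ two_ne_zero]
  rfl

end LieMetric

section ChartMeasurability

variable {n : ℕ} {M : Type*} [TopologicalSpace M] [ChartedSpace (Rn n) M]

theorem measurableSet_preimage_inter_target [MeasurableSpace M] [BorelSpace M] (p : M) {s : Set M}
    (hs : MeasurableSet s) :
    MeasurableSet ((extChartAt (𝓡 n) p).symm ⁻¹' s ∩ (extChartAt (𝓡 n) p).target) := by
  have restricted :
      Measurable ((extChartAt (𝓡 n) p).target.domRestrict (extChartAt (𝓡 n) p).symm) :=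
    (continuousOn_iff_continuous_domRestrict.1 (continuousOn_extChartAt_symm p)).measurable
  rw [inter_comm, ← Subtype.image_preimage_coe]
  exact (isOpen_extChartAt_target p).measurableSet.subtype_image (restricted hs)

theorem aemeasurable_chart_symm [MeasurableSpace M] [BorelSpace M] (p : M) (s : Set (Rn n))
    (d : Rn n → ENNReal) :
    AEMeasurable (extChartAt (𝓡 n) p).symm
      (((volume : Measure (Rn n)).restrict (s ∩ (extChartAt (𝓡 n) p).target)).withDensity d) :=
  (((continuousOn_extChartAt_symm p).aemeasurable
    (isOpen_extChartAt_target p).measurableSet).mono_measure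
    (Measure.restrict_mono_set _ inter_subset_right)).mono_ac (withDensity_absolutelyContinuous _ _)

theorem injOn_transition (p q : M) : InjOn (transition (n := n) p q) (overlap p q) :=
  fun a ha b hb hab ↦ by rw [← transition_transition ha, hab, transition_transition hb]

theorem image_transition_preimage {p q : M} {s : Set M} (hp : s ⊆ (extChartAt (𝓡 n) p).source)
    (hq : s ⊆ (extChartAt (𝓡 n) q).source) :
    transition p q '' ((extChartAt (𝓡 n) p).symm ⁻¹' s ∩ (extChartAt (𝓡 n) p).target)
      = (extChartAt (𝓡 n) q).symm ⁻¹' s ∩ (extChartAt (𝓡 n) q).target := by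
  ext z
  constructor
  · rintro ⟨y, hy, rfl⟩
    refine ⟨?_, (transition_mem_overlap ⟨hy.2, hq hy.1⟩).1⟩
    rw [mem_preimage, transition, (extChartAt (𝓡 n) q).left_inv (hq hy.1)]
    exact hy.1
  · intro hz
    have hmem : z ∈ overlap q p := ⟨hz.2, hp hz.1⟩
    refine ⟨transition q p z, ⟨?_, (transition_mem_overlap hmem).1⟩, transition_transition hmem⟩
    rw [mem_preimage, transition, (extChartAt (𝓡 n) p).left_inv hmem.2]
    exact hz.1

end ChartMeasurability

section Volume

variable {n : ℕ} {M : Type*} [TopologicalSpace M] [ChartedSpace (Rn n) M] [IsManifold (𝓡 n) ∞ M]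
  (g : RiemMetric n M) {p q : M}

theorem continuousOn_sqrt_det (p : M) :
    ContinuousOn (fun y ↦ √(coordMetric g p y).det) (extChartAt (𝓡 n) p).target :=
  fun _ hy ↦ (isMetricAt_coordMetric g hy).contDiffAt_sqrt_det.continuousAt.continuousWithinAt

variable [MeasurableSpace M] [BorelSpace M]

theorem aemeasurable_chart_symm_density (p : M) :
    AEMeasurable (extChartAt (𝓡 n) p).symm
      (((volume : Measure (Rn n)).restrict (extChartAt (𝓡 n) p).target).withDensity
        fun y ↦ ENNReal.ofReal √(coordMetric g p y).det) := by
  simpa only [univ_inter] using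
    aemeasurable_chart_symm p univ fun y ↦ ENNReal.ofReal √(coordMetric g p y).det

theorem chartVolume_apply {s : Set M} (hs : MeasurableSet s) :
    chartVolume g p s = ∫⁻ y in (extChartAt (𝓡 n) p).symm ⁻¹' s ∩ (extChartAt (𝓡 n) p).target,
      ENNReal.ofReal √(coordMetric g p y).det := by
  rw [chartVolume, Measure.map_apply_of_aemeasurable (aemeasurable_chart_symm_density g p) hs,
    withDensity_apply', Measure.restrict_restrict' (isOpen_extChartAt_target p).measurableSet]

theorem chartVolume_inter_source {s : Set M} (hs : MeasurableSet s) :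
    chartVolume g p (s ∩ (extChartAt (𝓡 n) p).source) = chartVolume g p s := by
  rw [chartVolume_apply g hs,
    chartVolume_apply g (hs.inter (isOpen_extChartAt_source (I := 𝓡 n) p).measurableSet)]
  congr 2
  ext z
  exact ⟨fun h ↦ ⟨h.1.1, h.2⟩, fun h ↦ ⟨⟨h.1, (extChartAt (𝓡 n) p).map_target h.2⟩, h.2⟩⟩

theorem chartVolume_eq_chartVolume {s : Set M} (hs : MeasurableSet s)
    (hp : s ⊆ (extChartAt (𝓡 n) p).source) (hq : s ⊆ (extChartAt (𝓡 n) q).source) :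
    chartVolume g q s = chartVolume g p s := by
  have hoverlap : (extChartAt (𝓡 n) p).symm ⁻¹' s ∩ (extChartAt (𝓡 n) p).target
      ⊆ overlap p q := fun y hy ↦ ⟨hy.2, hq hy.1⟩
  have hmeas := measurableSet_preimage_inter_target (n := n) p hs
  rw [chartVolume_apply g hs, chartVolume_apply g hs, ← image_transition_preimage hp hq,
    lintegral_image_eq_lintegral_abs_det_fderiv_mul volume hmeas
    (fun y hy ↦ ((contDiffAt_transition (hoverlap hy)).differentiableAt
      (by simp)).hasFDerivAt.hasFDerivWithinAt) ((injOn_transition p q).mono hoverlap)]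
  refine setLIntegral_congr_fun hmeas fun y hy ↦ ?_
  rw [← ENNReal.ofReal_mul (abs_nonneg _), ← sqrt_det_coordMetric g (hoverlap hy)]

theorem riemVol_apply {s : Set M} (hs : MeasurableSet s) (hp : s ⊆ (extChartAt (𝓡 n) p).source) :
    riemVol g s = chartVolume g p s := by
  set S := (extChartAt (𝓡 n) p).source
  have hS : MeasurableSet S := (isOpen_extChartAt_source (I := 𝓡 n) p).measurableSet
  refine le_antisymm ?_ (le_iSup (fun q ↦ chartVolume g q) p s)
  have hle : riemVol g ≤ (chartVolume g p).restrict S + (riemVol g).restrict Sᶜ := by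
    refine iSup_le fun q ↦ Measure.le_iff.2 fun B hB ↦ ?_
    rw [Measure.add_apply, Measure.restrict_apply hB, Measure.restrict_apply hB,
      ← measure_inter_add_sdiff B hS, ← chartVolume_inter_source g (hB.inter hS),
      chartVolume_eq_chartVolume g
        ((hB.inter hS).inter (isOpen_extChartAt_source (I := 𝓡 n) q).measurableSet)
        (inter_subset_left.trans inter_subset_right) inter_subset_right]
    exact add_le_add (measure_mono inter_subset_left) (le_iSup (fun q ↦ chartVolume g q) q _)
  refine (hle s).trans ?_
  rw [Measure.add_apply, Measure.restrict_apply hs, Measure.restrict_apply hs,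
    inter_eq_left.2 hp, ← sdiff_eq, sdiff_eq_empty.2 hp, measure_empty, add_zero]

theorem riemVol_restrict {s : Set M} (hs : MeasurableSet s)
    (hp : s ⊆ (extChartAt (𝓡 n) p).source) :
    (riemVol g).restrict s = (chartVolume g p).restrict s := by
  ext B hB
  rw [Measure.restrict_apply hB, Measure.restrict_apply hB,
    riemVol_apply g (hB.inter hs) (inter_subset_right.trans hp)]

theorem setIntegral_riemVol {s : Set M} (hs : MeasurableSet s)
    (hp : s ⊆ (extChartAt (𝓡 n) p).source) {F : M → ℝ}
    (hF : ContinuousOn (fun y ↦ F ((extChartAt (𝓡 n) p).symm y)) (extChartAt (𝓡 n) p).target) :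
    ∫ x in s, F x ∂(riemVol g)
      = ∫ y in (extChartAt (𝓡 n) p).symm ⁻¹' s ∩ (extChartAt (𝓡 n) p).target,
        √(coordMetric g p y).det * F ((extChartAt (𝓡 n) p).symm y) := by
  have target_measurable := (isOpen_extChartAt_target (I := 𝓡 n) p).measurableSet
  have hmeas : AEStronglyMeasurable F ((riemVol g).restrict s) :=
    ((continuousOn_source_of_symm hF).aestronglyMeasurable
      (isOpen_extChartAt_source p).measurableSet).mono_measure (Measure.restrict_mono_set _ hp)
  rw [riemVol_restrict g hs hp] at hmeas ⊢
  rw [chartVolume, Measure.restrict_map_of_aemeasurable (aemeasurable_chart_symm_density g p) hs,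
    restrict_withDensity', Measure.restrict_restrict' target_measurable] at hmeas ⊢
  rw [integral_map (aemeasurable_chart_symm p _ _) hmeas,
    integral_withDensity_eq_integral_toReal_smul₀]
  · refine integral_congr_ae (Eventually.of_forall fun _ ↦ ?_)
    simp only [ENNReal.toReal_ofReal (Real.sqrt_nonneg _), smul_eq_mul]
  · exact (((continuousOn_sqrt_det g p).aemeasurable target_measurable).mono_measure
      (Measure.restrict_mono_set _ inter_subset_right)).ennreal_ofReal
  · exact Eventually.of_forall fun _ ↦ ENNReal.ofReal_lt_top

instance isLocallyFiniteMeasure_riemVol : IsLocallyFiniteMeasure (riemVol g) := by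
  refine ⟨fun x ↦ ?_⟩
  set e := extChartAt (𝓡 n) x
  obtain ⟨r, hr, hball⟩ := Metric.nhds_basis_closedBall.mem_iff.1
    ((isOpen_extChartAt_target (I := 𝓡 n) x).mem_nhds (mem_extChartAt_target x))
  have hU : IsOpen (e.source ∩ e ⁻¹' Metric.ball (e x) r) :=
    (continuousOn_extChartAt x).isOpen_inter_preimage (isOpen_extChartAt_source x)
      Metric.isOpen_ball
  refine ⟨_, hU.mem_nhds ⟨mem_extChartAt_source x, Metric.mem_ball_self hr⟩, ?_⟩
  rw [riemVol_apply g hU.measurableSet inter_subset_left, chartVolume_apply g hU.measurableSet]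
  obtain ⟨C, hC⟩ := (isCompact_closedBall (e x) r).bddAbove_image
    ((continuousOn_sqrt_det g x).mono hball)
  have hsub : e.symm ⁻¹' (e.source ∩ e ⁻¹' Metric.ball (e x) r) ∩ e.target
      ⊆ Metric.ball (e x) r := fun y hy ↦ by
    have := hy.1.2
    rwa [mem_preimage, e.right_inv hy.2] at this
  calc _ ≤ ∫⁻ y in Metric.ball (e x) r, ENNReal.ofReal √(coordMetric g x y).det :=
        lintegral_mono_set hsub
    _ ≤ ∫⁻ _ in Metric.ball (e x) r, ENNReal.ofReal C :=
        setLIntegral_mono' Metric.isOpen_ball.measurableSet fun _ hy ↦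
          ENNReal.ofReal_le_ofReal (hC (mem_image_of_mem _ (Metric.ball_subset_closedBall hy)))
    _ < ⊤ := by
        rw [setLIntegral_const]
        exact ENNReal.mul_lt_top ENNReal.ofReal_lt_top measure_ball_lt_top

theorem riemVol_univ_pos [Nonempty M] : 0 < riemVol g univ := by
  obtain ⟨p⟩ := ‹Nonempty M›
  have hmeas := (isOpen_extChartAt_target (I := 𝓡 n) p).measurableSet
  refine lt_of_lt_of_le ?_ (le_iSup (fun q ↦ chartVolume g q) p univ)
  rw [chartVolume_apply g MeasurableSet.univ, preimage_univ, univ_inter, pos_iff_ne_zero, Ne,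
    setLIntegral_eq_zero_iff' hmeas ((continuousOn_sqrt_det g p).aemeasurable hmeas).ennreal_ofReal]
  intro hzero
  have hnull : volume (extChartAt (𝓡 n) p).target = 0 := by
    refine measure_mono_null (fun y hy ↦ ?_) (ae_iff.1 hzero)
    intro hvanish
    exact (Real.sqrt_pos.2 (isMetricAt_coordMetric g hy).pos).not_ge
      (ENNReal.ofReal_eq_zero.1 (hvanish hy))
  exact ((isOpen_extChartAt_target p).measure_pos volume ⟨_, mem_extChartAt_target p⟩).ne' hnull

end Volume

section ParametricIntegral

variable {E : Type*} [NormedAddCommGroup E] [NormedSpace ℝ E] {J : ℝ → E → ℝ}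

theorem hasDerivAt_uncurry {t : ℝ} {y : E}
    (hJ : DifferentiableAt ℝ (Function.uncurry J) (t, y)) :
    HasDerivAt (fun s ↦ J s y) (fderiv ℝ (Function.uncurry J) (t, y) (1, 0)) t :=
  HasFDerivAt.comp_hasDerivAt (l := Function.uncurry J) (f := fun s ↦ (s, y)) t hJ.hasFDerivAt
    ((hasDerivAt_id t).prodMk (hasDerivAt_const t y))

variable [MeasurableSpace E] [BorelSpace E] {μ : Measure E} [IsLocallyFiniteMeasure μ]

theorem hasDerivAt_setIntegral {J' : E → ℝ} {K s : Set E} {ε : ℝ} (hε : 0 < ε)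
    (hK : IsCompact K) (hs : MeasurableSet s) (hsK : s ⊆ K)
    (hJ : ∀ t ∈ Icc (-ε) ε, ∀ y ∈ K, ContDiffAt ℝ 1 (Function.uncurry J) (t, y))
    (hJ' : ∀ y ∈ s, HasDerivAt (fun t ↦ J t y) (J' y) 0) :
    HasDerivAt (fun t ↦ ∫ y in s, J t y ∂μ) (∫ y in s, J' y ∂μ) 0 := by
  set D : ℝ → E → ℝ := fun t y ↦ fderiv ℝ (Function.uncurry J) (t, y) (1, 0)
  have zero_mem : (0 : ℝ) ∈ Icc (-ε) ε := ⟨neg_nonpos.2 hε.le, hε.le⟩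
  have Ioo_nhds : Ioo (-ε) ε ∈ 𝓝 (0 : ℝ) := Ioo_mem_nhds (neg_lt_zero.2 hε) hε
  have continuousOn_J {t : ℝ} (ht : t ∈ Icc (-ε) ε) : ContinuousOn (J t) K := fun y hy ↦
    ((hJ t ht y hy).continuousAt.comp (f := fun z ↦ (t, z)) (by fun_prop)).continuousWithinAt
  have continuousOn_D : ContinuousOn (Function.uncurry D) (Icc (-ε) ε ×ˢ K) := fun q hq ↦
    (((hJ q.1 hq.1 q.2 hq.2).fderiv_right (m := 0) (by norm_num)).continuousAt.clm_apply
      continuousAt_const).continuousWithinAt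
  have aestronglyMeasurable_of_continuousOn {F : E → ℝ} (hF : ContinuousOn F K) :
      AEStronglyMeasurable F (μ.restrict s) :=
    (hF.aestronglyMeasurable_of_isCompact hK hK.measurableSet).mono_measure
      (Measure.restrict_mono_set μ hsK)
  have hasDerivAt_J {t : ℝ} (ht : t ∈ Icc (-ε) ε) {y : E} (hy : y ∈ K) :
      HasDerivAt (fun t ↦ J t y) (D t y) t :=
    hasDerivAt_uncurry ((hJ t ht y hy).differentiableAt one_ne_zero)
  obtain ⟨C, hC⟩ := (isCompact_Icc.prod hK).exists_bound_of_continuousOn continuousOn_D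
  refine (hasDerivAt_integral_of_dominated_loc_of_deriv_le (μ := μ.restrict s) (F := J) (F' := D)
    (bound := fun _ ↦ C) Ioo_nhds ?_ (((continuousOn_J zero_mem).integrableOn_compact hK).mono_set
    hsK) ?_ ?_ ?_ ?_).2.congr_deriv ?_
  · filter_upwards [Ioo_nhds] with t ht
    exact aestronglyMeasurable_of_continuousOn (continuousOn_J (Ioo_subset_Icc_self ht))
  · exact aestronglyMeasurable_of_continuousOn
      (continuousOn_D.comp (f := fun y ↦ ((0 : ℝ), y)) (by fun_prop) fun y hy ↦ ⟨zero_mem, hy⟩)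
  · exact (ae_restrict_iff' hs).2 (Eventually.of_forall fun y hy t ht ↦
      hC (t, y) ⟨Ioo_subset_Icc_self ht, hsK hy⟩)
  · exact integrableOn_const ((measure_mono hsK).trans_lt hK.measure_lt_top).ne
  · exact (ae_restrict_iff' hs).2 (Eventually.of_forall fun y hy t ht ↦
      hasDerivAt_J (Ioo_subset_Icc_self ht) (hsK hy))
  · exact setIntegral_congr_fun hs fun y hy ↦
      (hasDerivAt_J zero_mem (hsK hy)).unique (hJ' y hy)

end ParametricIntegral

section WeakDerivative

variable {n : ℕ} {V η : Rn n → ℝ} {U : Set (Rn n)}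

theorem integrable_mul_of_tsupport_subset (hU : IsOpen U) (hV : ContinuousOn V U)
    (hη : Continuous η) (hc : HasCompactSupport η) (hs : tsupport η ⊆ U) :
    Integrable fun y ↦ V y * η y := by
  refine Continuous.integrable_of_hasCompactSupport
    (continuous_of_tsupport fun y hy ↦ ?_) hc.mul_left
  have hmem : y ∈ tsupport η := closure_mono (Function.support_mul_subset_right V η) hy
  exact (hV.continuousAt (hU.mem_nhds (hs hmem))).mul hη.continuousAt

theorem tsupport_pd_subset (i : Fin n) (η : Rn n → ℝ) : tsupport (pd i η) ⊆ tsupport η := by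
  refine closure_minimal (fun y hy ↦ ?_) (isClosed_tsupport η)
  by_contra h
  exact hy (by rw [pd, fderiv_of_notMem_tsupport ℝ h]; rfl)

theorem hasCompactSupport_pd (hc : HasCompactSupport η) (i : Fin n) :
    HasCompactSupport (pd i η) :=
  hc.mono' (subset_closure.trans (tsupport_pd_subset i η))

theorem continuousOn_pd (hV : ∀ y ∈ U, ContDiffAt ℝ 1 V y) (i : Fin n) :
    ContinuousOn (pd i V) U :=
  fun y hy ↦ (contDiffAt_pd (k := 0) (hV y hy) (by simp) i).continuousAt.continuousWithinAt

theorem integrable_mul_pd_of_tsupport_subset (hU : IsOpen U) (hV : ContinuousOn V U)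
    (hη : ContDiff ℝ 1 η) (hc : HasCompactSupport η) (hs : tsupport η ⊆ U) (i : Fin n) :
    Integrable fun y ↦ V y * pd i η y :=
  integrable_mul_of_tsupport_subset hU hV
    (continuousOn_univ.1 (continuousOn_pd (fun _ _ ↦ hη.contDiffAt) i)) (hasCompactSupport_pd hc i)
    ((tsupport_pd_subset i η).trans hs)

theorem integral_mul_pd_eq_neg (hU : IsOpen U) (hV : ∀ y ∈ U, ContDiffAt ℝ 1 V y)
    (hη : ContDiff ℝ 1 η) (hc : HasCompactSupport η) (hs : tsupport η ⊆ U) (i : Fin n) :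
    ∫ y, V y * pd i η y = -∫ y, pd i V y * η y := by
  have continuousOn_V : ContinuousOn V U := fun y hy ↦ (hV y hy).continuousAt.continuousWithinAt
  exact integral_mul_fderiv_eq_neg_fderiv_mul_of_integrable
    (integrable_mul_of_tsupport_subset hU (continuousOn_pd hV i) hη.continuous hc hs)
    (integrable_mul_pd_of_tsupport_subset hU continuousOn_V hη hc hs i)
    (integrable_mul_of_tsupport_subset hU continuousOn_V hη.continuous hc hs)
    (fun y hy ↦ (hV y (hs hy)).differentiableAt one_ne_zero)
    (fun _ _ ↦ (hη.differentiable one_ne_zero).differentiableAt)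

theorem eqOn_zero_of_forall_integral_mul_eq_zero (hU : IsOpen U) (hV : ContinuousOn V U)
    (h : ∀ η : Rn n → ℝ, ContDiff ℝ ∞ η → HasCompactSupport η → tsupport η ⊆ U →
      ∫ y, η y * V y = 0) :
    EqOn V 0 U := by
  have hae := hU.ae_eq_zero_of_integral_contDiff_smul_eq_zero (μ := (volume : Measure (Rn n)))
    (hV.locallyIntegrableOn hU.measurableSet) h
  exact Measure.eqOn_open_of_ae_eq ((ae_restrict_iff' hU.measurableSet).2 hae) hU hV
    continuousOn_const

theorem eq_sum_pd_of_forall_integral_eq_zero {P : Rn n → ℝ} {Z : Fin n → Rn n → ℝ}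
    (hU : IsOpen U) (hP : ContinuousOn P U) (hZ : ∀ i, ∀ y ∈ U, ContDiffAt ℝ 1 (Z i) y)
    (h : ∀ η : Rn n → ℝ, ContDiff ℝ ∞ η → HasCompactSupport η → tsupport η ⊆ U →
      ∫ y, (P y * η y + ∑ i, Z i y * pd i η y) = 0)
    {y : Rn n} (hy : y ∈ U) :
    P y = ∑ i, pd i (Z i) y := by
  have continuousOn_div : ContinuousOn (fun y ↦ ∑ i, pd i (Z i) y) U :=
    continuousOn_finsetSum _ fun i _ ↦ continuousOn_pd (hZ i) i
  refine sub_eq_zero.1 (eqOn_zero_of_forall_integral_mul_eq_zero hU (hP.sub continuousOn_div)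
    (fun η hη hc hs ↦ ?_) hy)
  have hη₁ : ContDiff ℝ 1 η := hη.of_le (by simp)
  have integrable_mul {V : Rn n → ℝ} (hV : ContinuousOn V U) : Integrable fun y ↦ V y * η y :=
    integrable_mul_of_tsupport_subset hU hV hη.continuous hc hs
  have integrable_mul_pd (i : Fin n) : Integrable fun y ↦ Z i y * pd i η y :=
    integrable_mul_pd_of_tsupport_subset hU
      (fun y hy ↦ (hZ i y hy).continuousAt.continuousWithinAt) hη₁ hc hs i
  have integral_sum (i : Fin n) : ∫ y, pd i (Z i) y * η y = -∫ y, Z i y * pd i η y := by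
    rw [integral_mul_pd_eq_neg hU (hZ i) hη₁ hc hs, neg_neg]
  calc ∫ y, η y * (P y - ∑ i, pd i (Z i) y)
      = ∫ y, (P y * η y - ∑ i, pd i (Z i) y * η y) := by
        simp only [mul_comm (η _), sub_mul, Finset.sum_mul]
    _ = (∫ y, P y * η y) + ∑ i, ∫ y, Z i y * pd i η y := by
        rw [integral_sub (integrable_mul hP) (integrable_finsetSum _ fun i _ ↦
          integrable_mul (continuousOn_pd (hZ i) i)), integral_finsetSum _ fun i _ ↦
          integrable_mul (continuousOn_pd (hZ i) i)]
        simp only [integral_sum, Finset.sum_neg_distrib, sub_neg_eq_add]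
    _ = ∫ y, (P y * η y + ∑ i, Z i y * pd i η y) := by
        rw [integral_add (integrable_mul hP) (integrable_finsetSum _ fun i _ ↦
          integrable_mul_pd i), integral_finsetSum _ fun i _ ↦ integrable_mul_pd i]
    _ = 0 := h η hη hc hs

end WeakDerivative

section DomainVariation

variable {n : ℕ}

/-- The deformation `y ↦ y + t η(y) e_c` of `ℝⁿ`. -/
def domainShift (η : Rn n → ℝ) (c : Fin n) (t : ℝ) (y : Rn n) : Rn n :=
  y + (t * η y) • EuclideanSpace.single c 1

/-- The Jacobian matrix `∂ᵢ ψᵃ` of the deformation `ψ(y) = y + t η(y) e_c`; the first index is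
that of the component. -/
def shiftJacobian (η : Rn n → ℝ) (c : Fin n) (t : ℝ) (y : Rn n) (a i : Fin n) : ℝ :=
  (if a = i then 1 else 0) + t * pd i η y * (if a = c then 1 else 0)

/-- The density `Wⁱʲ (ψₜ^* H)ᵢⱼ` for the deformation `ψₜ(y) = y + t η(y) e_c`. With the weight
`W = √g g⁻¹` it is the energy density of a map whose domain is deformed by `ψₜ`. -/
def variationDensity (W H : Rn n → Matrix (Fin n) (Fin n) ℝ) (η : Rn n → ℝ) (c : Fin n)
    (t : ℝ) (y : Rn n) : ℝ :=
  contract (W y) fun i j ↦ ∑ a, ∑ b, H (domainShift η c t y) a b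
    * shiftJacobian η c t y a i * shiftJacobian η c t y b j

variable {η : Rn n → ℝ} {c : Fin n}

theorem domainShift_zero (y : Rn n) : domainShift η c 0 y = y := by simp [domainShift]

theorem domainShift_of_notMem {t : ℝ} {y : Rn n} (hy : y ∉ tsupport η) :
    domainShift η c t y = y := by
  simp [domainShift, image_eq_zero_of_notMem_tsupport hy]

theorem contDiff_domainShift (hη : ContDiff ℝ ∞ η) (c : Fin n) :
    ContDiff ℝ ∞ (fun q : ℝ × Rn n ↦ domainShift η c q.1 q.2) :=
  contDiff_snd.add ((contDiff_fst.mul (hη.comp contDiff_snd)).smul contDiff_const)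

theorem differentiable_domainShift (hη : ContDiff ℝ ∞ η) (c : Fin n) (t : ℝ) :
    Differentiable ℝ (domainShift η c t) :=
  ((contDiff_domainShift hη c).comp (contDiff_const.prodMk contDiff_id)).differentiable (by simp)

theorem contDiff_shiftJacobian (hη : ContDiff ℝ ∞ η) (c a i : Fin n) :
    ContDiff ℝ ∞ (fun q : ℝ × Rn n ↦ shiftJacobian η c q.1 q.2 a i) := by
  have hpd : ContDiff ℝ ∞ (pd i η) :=
    contDiff_iff_contDiffAt.2 fun _ ↦ contDiffAt_pd hη.contDiffAt (by simp) i
  exact contDiff_const.add ((contDiff_fst.mul (hpd.comp contDiff_snd)).mul contDiff_const)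

theorem pd_domainShift {y : Rn n} (hη : DifferentiableAt ℝ η y) (t : ℝ) (a i : Fin n) :
    pd i (fun z ↦ domainShift η c t z a) y = shiftJacobian η c t y a i := by
  have differentiableAt_coord : DifferentiableAt ℝ (fun z : Rn n ↦ z a) y :=
    (EuclideanSpace.proj a : Rn n →L[ℝ] ℝ).differentiableAt
  have pd_coord : pd i (fun z : Rn n ↦ z a) y = if a = i then 1 else 0 := by
    have hfderiv : fderiv ℝ (fun z : Rn n ↦ z a) y = EuclideanSpace.proj a :=
      (EuclideanSpace.proj a : Rn n →L[ℝ] ℝ).hasFDerivAt.fderiv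
    rw [pd, hfderiv]
    simp
  have shift_coord : (fun z ↦ domainShift η c t z a)
      = fun z : Rn n ↦ z a + (t * if a = c then 1 else 0) * η z := by
    funext z
    simp [domainShift]
  rw [shift_coord, pd_add i differentiableAt_coord (hη.const_mul _), pd_const_mul i _ hη,
    pd_coord, shiftJacobian]
  ring

theorem exists_domainShift_mem {T : Set (Rn n)} (hT : IsOpen T) (hη : Continuous η)
    (hc : HasCompactSupport η) (hs : tsupport η ⊆ T) (c : Fin n) :
    ∃ ε > 0, ∀ t ∈ Icc (-ε) ε, ∀ y ∈ T, domainShift η c t y ∈ T := by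
  obtain ⟨δ, hδ, hδT⟩ := IsCompact.exists_cthickening_subset_open hc hT hs
  obtain ⟨C, hC⟩ := hη.bounded_above_of_compact_support hc
  have hC0 : 0 ≤ C := (norm_nonneg _).trans (hC 0)
  refine ⟨δ / (C + 1), by positivity, fun t ht y hy ↦ ?_⟩
  by_cases hys : y ∈ tsupport η
  · refine hδT (Metric.mem_cthickening_of_dist_le _ y δ _ hys ?_)
    calc dist (domainShift η c t y) y = |t| * |η y| := by simp [domainShift, norm_smul]
      _ ≤ δ / (C + 1) * (C + 1) :=
          mul_le_mul (abs_le.2 ht) ((hC y).trans (by linarith)) (abs_nonneg _) (by positivity)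
      _ = δ := by field_simp
  · rwa [domainShift_of_notMem hys]

variable {W H : Rn n → Matrix (Fin n) (Fin n) ℝ} {T : Set (Rn n)}

theorem contDiffAt_variationDensity {t : ℝ} {y : Rn n}
    (hW : ∀ i j, ContDiffAt ℝ ∞ (fun z ↦ W z i j) y)
    (hH : ∀ i j, ContDiffAt ℝ ∞ (fun z ↦ H z i j) (domainShift η c t y)) (hη : ContDiff ℝ ∞ η) :
    ContDiffAt ℝ ∞ (Function.uncurry (variationDensity W H η c)) (t, y) := by
  have smooth_H (a b : Fin n) :
      ContDiffAt ℝ ∞ (fun q : ℝ × Rn n ↦ H (domainShift η c q.1 q.2) a b) (t, y) :=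
    ContDiffAt.comp (g := fun z ↦ H z a b) (t, y) (hH a b) (contDiff_domainShift hη c).contDiffAt
  have smooth_W (i j : Fin n) : ContDiffAt ℝ ∞ (fun q : ℝ × Rn n ↦ W q.2 i j) (t, y) :=
    (hW i j).comp (t, y) contDiffAt_snd
  have smooth_jacobian (a i : Fin n) := (contDiff_shiftJacobian hη c a i).contDiffAt (x := (t, y))
  simp only [Function.uncurry_def, variationDensity, contract]
  exact ContDiffAt.sum fun i _ ↦ ContDiffAt.sum fun j _ ↦ (smooth_W i j).mul
    (ContDiffAt.sum fun a _ ↦ ContDiffAt.sum fun b _ ↦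
      ((smooth_H a b).mul (smooth_jacobian a i)).mul (smooth_jacobian b j))

theorem hasDerivAt_variationDensity {y : Rn n}
    (hH : ∀ i j, DifferentiableAt ℝ (fun z ↦ H z i j) y) :
    HasDerivAt (fun t ↦ variationDensity W H η c t y)
      (contract (W y) fun i j ↦ η y * pd c (fun z ↦ H z i j) y + H y c j * pd i η y
        + H y i c * pd j η y) 0 := by
  have hasDerivAt_shift : HasDerivAt (fun t ↦ domainShift η c t y)
      ((1 * η y) • (EuclideanSpace.single c 1 : Rn n)) 0 :=
    (((hasDerivAt_id (0 : ℝ)).mul_const (η y)).smul_const _).const_add y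
  have hasDerivAt_H (a b : Fin n) : HasDerivAt (fun t ↦ H (domainShift η c t y) a b)
      (η y * pd c (fun z ↦ H z a b) y) 0 := by
    have hfderiv : HasFDerivAt (fun z ↦ H z a b) (fderiv ℝ (fun z ↦ H z a b) y)
        (domainShift η c 0 y) := by
      rw [domainShift_zero]
      exact (hH a b).hasFDerivAt
    refine (HasFDerivAt.comp_hasDerivAt (l := fun z ↦ H z a b) (0 : ℝ) hfderiv
      hasDerivAt_shift).congr_deriv ?_
    rw [map_smul, one_mul, smul_eq_mul, pd]
  have hasDerivAt_jacobian (a i : Fin n) : HasDerivAt (fun t : ℝ ↦ shiftJacobian η c t y a i)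
      (pd i η y * if a = c then 1 else 0) 0 := by
    simpa only [shiftJacobian, id, one_mul] using
      (((hasDerivAt_id (0 : ℝ)).mul_const (pd i η y)).mul_const
        (if a = c then (1 : ℝ) else 0)).const_add (if a = i then (1 : ℝ) else 0)
  simp only [variationDensity, contract]
  refine (HasDerivAt.fun_sum fun i _ ↦ HasDerivAt.fun_sum fun j _ ↦ HasDerivAt.const_mul (W y i j)
    (HasDerivAt.fun_sum fun a _ ↦ HasDerivAt.fun_sum fun b _ ↦ ((hasDerivAt_H a b).fun_mul
      (hasDerivAt_jacobian a i)).fun_mul (hasDerivAt_jacobian b j))).congr_deriv ?_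
  refine Finset.sum_congr rfl fun i _ ↦ Finset.sum_congr rfl fun j _ ↦ congrArg _ ?_
  simp only [domainShift_zero, shiftJacobian, zero_mul, add_zero, add_mul, Finset.sum_add_distrib]
  simp [mul_ite, ite_mul]

theorem hasDerivAt_integral_variationDensity {U K : Set (Rn n)} (hT : IsOpen T)
    (hK : IsCompact K) (hKT : K ⊆ T) (hU : IsOpen U) (hUK : U ⊆ K)
    (hW : ∀ y ∈ T, ∀ i j, ContDiffAt ℝ ∞ (fun z ↦ W z i j) y)
    (hH : ∀ y ∈ T, ∀ i j, ContDiffAt ℝ ∞ (fun z ↦ H z i j) y)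
    (hη : ContDiff ℝ ∞ η) (hc : HasCompactSupport η) (hs : tsupport η ⊆ T) :
    HasDerivAt (fun t ↦ ∫ y in U, variationDensity W H η c t y)
      (∫ y in U, contract (W y) fun i j ↦ η y * pd c (fun z ↦ H z i j) y + H y c j * pd i η y
        + H y i c * pd j η y) 0 := by
  obtain ⟨ε, hε, hshift⟩ := exists_domainShift_mem hT hη.continuous hc hs c
  exact hasDerivAt_setIntegral hε hK hU.measurableSet hUK
    (fun t ht y hy ↦ (contDiffAt_variationDensity (hW y (hKT hy))
      (hH _ (hshift t ht y (hKT hy))) hη).of_le (by simp))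
    (fun y hy ↦ hasDerivAt_variationDensity
      fun i j ↦ (hH y (hKT (hUK hy)) i j).differentiableAt (by simp))

theorem contract_variation_eq {B : Matrix (Fin n) (Fin n) ℝ} (hB : B.IsSymm) {y : Rn n}
    (hH : (H y).IsSymm) :
    (contract B fun i j ↦ η y * pd c (fun z ↦ H z i j) y + H y c j * pd i η y + H y i c * pd j η y)
      = (contract B fun i j ↦ pd c (fun z ↦ H z i j) y) * η y
        + ∑ i, (2 * ∑ j, B i j * H y j c) * pd i η y := by
  have transport : (contract B fun i j ↦ H y j c * pd i η y)
      = ∑ i, (∑ j, B i j * H y j c) * pd i η y := by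
    simp only [contract, Finset.sum_mul, mul_assoc]
  have hcomm : (contract B fun i j ↦ H y i c * pd j η y)
      = contract B fun i j ↦ H y j c * pd i η y := contract_comm hB _
  simp only [hH.apply _ c, contract_add, contract_const_mul, hcomm, transport, mul_assoc,
    ← Finset.mul_sum]
  ring

theorem contract_pd_eq_of_stationary {U K : Set (Rn n)} (hT : IsOpen T)
    (hK : IsCompact K) (hKT : K ⊆ T) (hU : IsOpen U) (hUK : U ⊆ K)
    (hW : ∀ y ∈ T, ∀ i j, ContDiffAt ℝ ∞ (fun z ↦ W z i j) y)
    (hH : ∀ y ∈ T, ∀ i j, ContDiffAt ℝ ∞ (fun z ↦ H z i j) y)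
    (hWs : ∀ y ∈ T, (W y).IsSymm) (hHs : ∀ y ∈ T, (H y).IsSymm)
    (hstat : ∀ η : Rn n → ℝ, ContDiff ℝ ∞ η → HasCompactSupport η → tsupport η ⊆ U →
      HasDerivAt (fun t ↦ ∫ y in U, variationDensity W H η c t y) 0 0) {y : Rn n} (hy : y ∈ U) :
    (contract (W y) fun i j ↦ pd c (fun z ↦ H z i j) y)
      = 2 * ∑ j, ∑ i, pd i (fun z ↦ W z i j * H z j c) y := by
  have hUT : U ⊆ T := hUK.trans hKT
  have smooth_flux (i j : Fin n) {z : Rn n} (hz : z ∈ U) :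
      ContDiffAt ℝ ∞ (fun z ↦ W z i j * H z j c) z := (hW z (hUT hz) i j).mul (hH z (hUT hz) j c)
  have smooth_total_flux (i : Fin n) {z : Rn n} (hz : z ∈ U) :
      ContDiffAt ℝ 1 (fun z ↦ 2 * ∑ j, W z i j * H z j c) z :=
    (contDiffAt_const.mul (ContDiffAt.sum fun j _ ↦ smooth_flux i j hz)).of_le (by simp)
  have continuousOn_force :
      ContinuousOn (fun z ↦ contract (W z) fun i j ↦ pd c (fun z ↦ H z i j) z) U := fun z hz ↦
    (ContDiffAt.sum fun i _ ↦ ContDiffAt.sum fun j _ ↦ (hW z (hUT hz) i j).mul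
      (contDiffAt_pd (hH z (hUT hz) i j) (k := ∞) (by simp) c)).continuousAt.continuousWithinAt
  have weak := eq_sum_pd_of_forall_integral_eq_zero hU continuousOn_force
    (fun i z hz ↦ smooth_total_flux i hz) (fun η hη hc hs ↦ ?_) hy
  · rw [weak, Finset.sum_comm, Finset.mul_sum]
    refine Finset.sum_congr rfl fun i _ ↦ ?_
    rw [pd_const_mul i _ (.fun_sum fun j _ ↦ (smooth_flux i j hy).differentiableAt (by simp)),
      pd_sum i fun j ↦ (smooth_flux i j hy).differentiableAt (by simp)]
  · rw [← setIntegral_eq_integral_of_forall_compl_eq_zero (s := U) fun z hz ↦ ?_,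
      ← (hasDerivAt_integral_variationDensity hT hK hKT hU hUK hW hH hη hc
        (hs.trans hUT)).unique (hstat η hη hc hs)]
    · exact setIntegral_congr_fun hU.measurableSet fun z hz ↦
        (contract_variation_eq (hWs z (hUT hz)) (hHs z (hUT hz))).symm
    · have hη_zero : η z = 0 := image_eq_zero_of_notMem_tsupport fun h ↦ hz (hs h)
      have hpd_zero (i : Fin n) : pd i η z = 0 :=
        image_eq_zero_of_notMem_tsupport fun h ↦ hz (hs (tsupport_pd_subset i η h))
      simp only [hη_zero, hpd_zero, mul_zero, Finset.sum_const_zero, add_zero]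

end DomainVariation

section FirstVariation

variable {n m : ℕ} {M N : Type*} [TopologicalSpace M] [ChartedSpace (Rn n) M]

open Classical in
/-- The variation of `f` obtained by moving the domain by `y ↦ y + t η(y) e_c` in the chart at
`p`. -/
def domainVariation (f : M → N) (p : M) (η : Rn n → ℝ) (c : Fin n) (t : ℝ) (x : M) : N :=
  if x ∈ (extChartAt (𝓡 n) p).source then
    f ((extChartAt (𝓡 n) p).symm (domainShift η c t (extChartAt (𝓡 n) p x))) else f x

variable {f : M → N} {p : M} {η : Rn n → ℝ} {c : Fin n}

theorem domainVariation_symm {t : ℝ} {y : Rn n} (hy : y ∈ (extChartAt (𝓡 n) p).target) :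
    domainVariation f p η c t ((extChartAt (𝓡 n) p).symm y)
      = f ((extChartAt (𝓡 n) p).symm (domainShift η c t y)) := by
  rw [domainVariation, if_pos ((extChartAt (𝓡 n) p).map_target hy),
    (extChartAt (𝓡 n) p).right_inv hy]

theorem domainVariation_eq_self {t : ℝ} {x : M} (h : x ∈ (extChartAt (𝓡 n) p).source →
    domainShift η c t (extChartAt (𝓡 n) p x) = extChartAt (𝓡 n) p x) :
    domainVariation f p η c t x = f x := by
  rw [domainVariation]
  split_ifs with hx
  · rw [h hx, (extChartAt (𝓡 n) p).left_inv hx]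
  · rfl

theorem domainVariation_zero : domainVariation f p η c 0 = f :=
  funext fun _ ↦ domainVariation_eq_self fun _ ↦ domainShift_zero _

theorem domainVariation_of_notMem {t : ℝ} {x : M}
    (hx : x ∉ (extChartAt (𝓡 n) p).symm '' tsupport η) :
    domainVariation f p η c t x = f x :=
  domainVariation_eq_self fun hs ↦
    domainShift_of_notMem fun h ↦ hx ⟨_, h, (extChartAt (𝓡 n) p).left_inv hs⟩

theorem isCompact_image_chart_symm {K : Set (Rn n)} (hK : IsCompact K)
    (hs : K ⊆ (extChartAt (𝓡 n) p).target) : IsCompact ((extChartAt (𝓡 n) p).symm '' K) :=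
  hK.image_of_continuousOn ((continuousOn_extChartAt_symm p).mono hs)

theorem isOpen_image_chart_symm {b : Set (Rn n)} (hb : IsOpen b)
    (hs : b ⊆ (extChartAt (𝓡 n) p).target) : IsOpen ((extChartAt (𝓡 n) p).symm '' b) := by
  rw [(extChartAt (𝓡 n) p).symm_image_eq_source_inter_preimage hs]
  exact (continuousOn_extChartAt p).isOpen_inter_preimage (isOpen_extChartAt_source p) hb

variable [IsManifold (𝓡 n) ∞ M] [TopologicalSpace N] [ChartedSpace (Rn m) N]

theorem setIntegral_riemVol_image_symm [MeasurableSpace M] [BorelSpace M] (g : RiemMetric n M)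
    {b : Set (Rn n)} (hb : IsOpen b) (hs : b ⊆ (extChartAt (𝓡 n) p).target) {F : M → ℝ}
    (hF : ContinuousOn (fun y ↦ F ((extChartAt (𝓡 n) p).symm y)) (extChartAt (𝓡 n) p).target) :
    ∫ x in (extChartAt (𝓡 n) p).symm '' b, F x ∂(riemVol g)
      = ∫ y in b, √(coordMetric g p y).det * F ((extChartAt (𝓡 n) p).symm y) := by
  have image_subset : (extChartAt (𝓡 n) p).symm '' b ⊆ (extChartAt (𝓡 n) p).source :=
    (image_mono hs).trans (extChartAt (𝓡 n) p).symm.image_source_subset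
  have preimage_eq : (extChartAt (𝓡 n) p).symm ⁻¹' ((extChartAt (𝓡 n) p).symm '' b)
      ∩ (extChartAt (𝓡 n) p).target = b :=
    (extChartAt (𝓡 n) p).symm.injOn.preimage_image_inter hs
  rw [setIntegral_riemVol g (isOpen_image_chart_symm hb hs).measurableSet image_subset hF,
    preimage_eq]

theorem contMDiffAt_domainVariation [T2Space M] (hf : ContMDiff (𝓡 n) (𝓡 m) ∞ f)
    (hη : ContDiff ℝ ∞ η) (hc : HasCompactSupport η)
    (hs : tsupport η ⊆ (extChartAt (𝓡 n) p).target) {t : ℝ}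
    (ht : ∀ y ∈ (extChartAt (𝓡 n) p).target, domainShift η c t y ∈ (extChartAt (𝓡 n) p).target)
    (x : M) :
    ContMDiffAt (𝓘(ℝ, ℝ).prod (𝓡 n)) (𝓡 m) ∞
      (fun q : ℝ × M ↦ domainVariation f p η c q.1 q.2) (t, x) := by
  set e := extChartAt (𝓡 n) p
  by_cases hx : x ∈ e.source
  · have smooth_coord : ContMDiffAt (𝓘(ℝ, ℝ).prod (𝓡 n)) 𝓘(ℝ, ℝ × Rn n) ∞
        (fun q : ℝ × M ↦ (q.1, e q.2)) (t, x) :=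
      contMDiffAt_fst.prodMk_space ((contMDiffAt_chart hx).comp (t, x) contMDiffAt_snd)
    have smooth_shift := (contDiff_domainShift hη c).contMDiff.contMDiffAt.comp (t, x) smooth_coord
    refine (hf.contMDiffAt.comp (t, x) ((contMDiffAt_chart_symm
      (ht _ (e.map_source hx))).comp (t, x) smooth_shift)).congr_of_eventuallyEq ?_
    filter_upwards [continuousAt_snd.preimage_mem_nhds
      ((isOpen_extChartAt_source p).mem_nhds hx)] with q hq
    exact if_pos hq
  · have hxK : x ∉ e.symm '' tsupport η := by
      rintro ⟨y, hy, rfl⟩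
      exact hx (e.map_target (hs hy))
    refine (hf.contMDiffAt.comp (t, x) contMDiffAt_snd).congr_of_eventuallyEq ?_
    filter_upwards [continuousAt_snd.preimage_mem_nhds
      ((isCompact_image_chart_symm hc hs).isClosed.isOpen_compl.mem_nhds hxK)] with q hq
    exact domainVariation_of_notMem hq

variable [IsManifold (𝓡 m) ∞ N] (g : RiemMetric n M) (gbar : RiemMetric m N)

theorem coordTensor_pullbackMetric_comp {f' : M → N} {ψ : Rn n → Rn n} {y : Rn n}
    (hy : y ∈ (extChartAt (𝓡 n) p).target) (hψy : ψ y ∈ (extChartAt (𝓡 n) p).target)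
    (hf : MDifferentiableAt (𝓡 n) (𝓡 m) f ((extChartAt (𝓡 n) p).symm (ψ y)))
    (hf' : MDifferentiableAt (𝓡 n) (𝓡 m) f' ((extChartAt (𝓡 n) p).symm y))
    (hψ : DifferentiableAt ℝ ψ y)
    (heq : ∀ᶠ z in 𝓝 y,
      f' ((extChartAt (𝓡 n) p).symm z) = f ((extChartAt (𝓡 n) p).symm (ψ z))) (i j : Fin n) :
    coordTensor (pullbackMetric gbar f') p y i j
      = ∑ a, ∑ b, coordTensor (pullbackMetric gbar f) p (ψ y) a b
        * pd i (fun z ↦ ψ z a) y * pd j (fun z ↦ ψ z b) y := by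
  set e := extChartAt (𝓡 n) p
  let L : Rn n →L[ℝ] Rn m := mfderiv (𝓡 n) (𝓡 m) (f ∘ e.symm) (ψ y)
  have chain : HasMFDerivAt (𝓡 n) (𝓡 m) ((f ∘ e.symm) ∘ ψ) y (L ∘L fderiv ℝ ψ y) :=
    (hf.comp _ ((contMDiffAt_chart_symm hψy).mdifferentiableAt (by simp))).hasMFDerivAt.comp y
      hψ.hasFDerivAt.hasMFDerivAt
  let L' : Rn n →L[ℝ] Rn m := mfderiv (𝓡 n) (𝓡 m) (f' ∘ e.symm) y
  have hderiv : L' = L ∘L fderiv ℝ ψ y := (chain.congr_of_eventuallyEq heq).mfderiv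
  obtain ⟨B, hB⟩ := isBilinAt_clm (fun x ↦ gbar.inner x) (f (e.symm (ψ y)))
  have tensor_f (a b : Fin n) : coordTensor (pullbackMetric gbar f) p (ψ y) a b
      = B (L (EuclideanSpace.single a 1)) (L (EuclideanSpace.single b 1)) :=
    (coordTensor_pullbackMetric gbar hf hψy a b).trans (hB _ _)
  have tensor_f' : coordTensor (pullbackMetric gbar f') p y i j
      = B (L (fderiv ℝ ψ y (EuclideanSpace.single i 1)))
        (L (fderiv ℝ ψ y (EuclideanSpace.single j 1))) := by
    rw [coordTensor_pullbackMetric gbar hf' hy, ← hB]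
    simp only [← ContinuousLinearMap.comp_apply, ← hderiv]
    exact congrArg (fun x ↦ (gbar.inner : N → Rn m →L[ℝ] Rn m →L[ℝ] ℝ) x _ _) heq.self_of_nhds
  rw [tensor_f', bilin_eq_sum]
  refine Finset.sum_congr rfl fun a _ ↦ Finset.sum_congr rfl fun b _ ↦ ?_
  rw [tensor_f, pd, pd, fderiv_apply_coord hψ, fderiv_apply_coord hψ]

theorem energyDensity_symm (f : M → N) {y : Rn n} (hy : y ∈ (extChartAt (𝓡 n) p).target) :
    energyDensity g gbar f ((extChartAt (𝓡 n) p).symm y)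
      = contract (coordMetric g p y)⁻¹ (coordTensor (pullbackMetric gbar f) p y) :=
  metricTrace_eq g hy (isBilinAt_pullbackMetric gbar f _)

theorem continuousOn_energyDensity_symm (hf : ContMDiff (𝓡 n) (𝓡 m) ∞ f) (p : M) :
    ContinuousOn (fun y ↦ energyDensity g gbar f ((extChartAt (𝓡 n) p).symm y))
      (extChartAt (𝓡 n) p).target := by
  refine ContinuousOn.congr (fun y hy ↦ ?_) fun y hy ↦ energyDensity_symm g gbar f hy
  exact (ContDiffAt.sum fun i _ ↦ ContDiffAt.sum fun j _ ↦
    ((isMetricAt_coordMetric g hy).smooth_inv i j).mul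
      (contDiffAt_coordTensor_pullbackMetric gbar hf hy i j)).continuousAt.continuousWithinAt

/-- The weight `√det(gᵢⱼ) gⁱʲ` in the chart at `p`, the coefficient of `∂ᵢ f ∂ⱼ f` in the energy. -/
def energyWeight (p : M) (y : Rn n) : Matrix (Fin n) (Fin n) ℝ :=
  √(coordMetric g p y).det • (coordMetric g p y)⁻¹

theorem contract_energyWeight (p : M) (y : Rn n) (F : Fin n → Fin n → ℝ) :
    contract (energyWeight g p y) F
      = √(coordMetric g p y).det * contract (coordMetric g p y)⁻¹ F := by
  simp only [contract, energyWeight, Matrix.smul_apply, smul_eq_mul, Finset.mul_sum, mul_assoc]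

theorem energyOn_domainVariation [MeasurableSpace M] [BorelSpace M] [T2Space M]
    (hf : ContMDiff (𝓡 n) (𝓡 m) ∞ f) (hη : ContDiff ℝ ∞ η) (hc : HasCompactSupport η)
    (hs : tsupport η ⊆ (extChartAt (𝓡 n) p).target) {t : ℝ}
    (ht : ∀ y ∈ (extChartAt (𝓡 n) p).target, domainShift η c t y ∈ (extChartAt (𝓡 n) p).target)
    {b : Set (Rn n)} (hb : IsOpen b) (hbT : b ⊆ (extChartAt (𝓡 n) p).target) :
    energyOn g gbar ((extChartAt (𝓡 n) p).symm '' b) (domainVariation f p η c t)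
      = (1 / 2) * ∫ y in b,
        variationDensity (energyWeight g p) (coordTensor (pullbackMetric gbar f) p) η c t y := by
  have smooth_variation : ContMDiff (𝓡 n) (𝓡 m) ∞ (domainVariation f p η c t) := fun x ↦
    (contMDiffAt_domainVariation hf hη hc hs ht x).comp x
      (contMDiffAt_const.prodMk contMDiffAt_id)
  rw [energyOn, setIntegral_riemVol_image_symm g hb hbT
    (continuousOn_energyDensity_symm g gbar smooth_variation p)]
  refine congrArg _ (setIntegral_congr_fun hb.measurableSet fun y hy ↦ ?_)
  have eventually_comp : ∀ᶠ z in 𝓝 y,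
      domainVariation f p η c t ((extChartAt (𝓡 n) p).symm z)
        = f ((extChartAt (𝓡 n) p).symm (domainShift η c t z)) := by
    filter_upwards [(isOpen_extChartAt_target p).mem_nhds (hbT hy)] with z hz
    exact domainVariation_symm hz
  simp only [variationDensity, contract_energyWeight,
    energyDensity_symm g gbar _ (hbT hy)]
  refine congrArg _ (Finset.sum_congr rfl fun i _ ↦ Finset.sum_congr rfl fun j _ ↦ ?_)
  rw [coordTensor_pullbackMetric_comp gbar (hbT hy) (ht y (hbT hy))
    (hf.mdifferentiableAt (by simp)) (smooth_variation.mdifferentiableAt (by simp))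
    (differentiable_domainShift hη c t y) eventually_comp]
  simp only [pd_domainShift (hη.differentiable (by simp) y)]

variable {g gbar} [MeasurableSpace M] [BorelSpace M] [T2Space M]

theorem hasDerivAt_integral_variationDensity_of_isHarmonicMap (hf : IsHarmonicMap g gbar f)
    (hη : ContDiff ℝ ∞ η) (hc : HasCompactSupport η) {b K : Set (Rn n)} (hb : IsOpen b)
    (hs : tsupport η ⊆ b) (hbK : b ⊆ K) (hK : IsCompact K)
    (hKT : K ⊆ (extChartAt (𝓡 n) p).target) (c : Fin n) :
    HasDerivAt (fun t ↦ ∫ y in b, variationDensity (energyWeight g p)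
      (coordTensor (pullbackMetric gbar f) p) η c t y) 0 0 := by
  have hbT := hbK.trans hKT
  obtain ⟨ε, hε, hshift⟩ := exists_domainShift_mem (isOpen_extChartAt_target p) hη.continuous hc
    (hs.trans hbT) c
  have hmem (t : ℝ) (ht : t ∈ Ioo (-ε) ε) := hshift t (Ioo_subset_Icc_self ht)
  have energy_stationary := hf.2 _ _ (domainVariation f p η c) ε (isOpen_image_chart_symm hb hbT)
    ((isCompact_image_chart_symm hK hKT).closure_of_subset (image_mono hbK))
    (isCompact_image_chart_symm hc (hs.trans hbT)) (image_mono hs) hε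
    (fun q hq ↦ (contMDiffAt_domainVariation hf.1 hη hc (hs.trans hbT)
      (hmem _ hq.1) q.2).contMDiffWithinAt)
    domainVariation_zero (fun t _ x hx ↦ domainVariation_of_notMem hx)
  refine (energy_stationary.const_mul 2).congr_deriv (mul_zero 2) |>.congr_of_eventuallyEq ?_
  filter_upwards [Ioo_mem_nhds (neg_lt_zero.2 hε) hε] with t ht
  rw [energyOn_domainVariation g gbar hf.1 hη hc (hs.trans hbT) (hmem t ht) hb hbT]
  ring

theorem stressDiv_pullbackMetric_eq_zero (hf : IsHarmonicMap g gbar f)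
    {y : Rn n} (hy : y ∈ (extChartAt (𝓡 n) p).target) (c : Fin n) :
    stressDiv (coordMetric g p) (coordTensor (pullbackMetric gbar f) p) c y = 0 := by
  set T := (extChartAt (𝓡 n) p).target
  have hT : IsOpen T := isOpen_extChartAt_target p
  obtain ⟨r, hr, hball⟩ := Metric.nhds_basis_closedBall.mem_iff.1 (hT.mem_nhds hy)
  have smooth_pullback (z : Rn n) (hz : z ∈ T) (i j : Fin n) :=
    contDiffAt_coordTensor_pullbackMetric gbar hf.1 hz i j
  have euler_lagrange := contract_pd_eq_of_stationary (W := energyWeight g p)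
    (H := coordTensor (pullbackMetric gbar f) p) (c := c) hT (isCompact_closedBall y r) hball
    Metric.isOpen_ball Metric.ball_subset_closedBall
    (fun z hz i j ↦ (isMetricAt_coordMetric g hz).contDiffAt_sqrt_det.mul
      ((isMetricAt_coordMetric g hz).smooth_inv i j)) smooth_pullback
    (fun z hz ↦ (isMetricAt_coordMetric g hz).isSymm_inv.smul _)
    (fun z _ ↦ Matrix.IsSymm.ext fun i j ↦ gbar.symm _ _ _)
    (fun η hη hc hs ↦ hasDerivAt_integral_variationDensity_of_isHarmonicMap hf hη hc
      Metric.isOpen_ball hs Metric.ball_subset_closedBall (isCompact_closedBall y r) hball c)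
    (Metric.mem_ball_self hr)
  have hpos : 0 < √(coordMetric g p y).det := Real.sqrt_pos.2 (isMetricAt_coordMetric g hy).pos
  have hdiv := (isMetricAt_coordMetric g hy).sqrt_det_mul_stressDiv
    (fun i j ↦ (smooth_pullback y hy i j).differentiableAt (by simp)) c
  rw [← contract_energyWeight, euler_lagrange] at hdiv
  simp only [energyWeight, Matrix.smul_apply, smul_eq_mul] at hdiv
  refine (mul_eq_zero.1 (hdiv.trans ?_)).resolve_left hpos.ne'
  ring

end FirstVariation

section TensionDerivative

variable {n : ℕ} {J : ℝ → Rn n → ℝ} {t : ℝ} {y : Rn n}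

theorem pd_eq_fderiv_uncurry (h : DifferentiableAt ℝ (Function.uncurry J) (t, y)) (i : Fin n) :
    pd i (J t) y = fderiv ℝ (Function.uncurry J) (t, y) (0, EuclideanSpace.single i 1) := by
  have slice : HasFDerivAt (J t)
      (fderiv ℝ (Function.uncurry J) (t, y) ∘L ContinuousLinearMap.inr ℝ ℝ (Rn n)) y :=
    h.hasFDerivAt.comp y (hasFDerivAt_prodMk_right t y)
  rw [pd, slice.fderiv]
  rfl

theorem contDiffAt_uncurry_pd {k l : WithTop ℕ∞} (h : ContDiffAt ℝ l (Function.uncurry J) (t, y))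
    (hk : k + 1 ≤ l) (i : Fin n) : ContDiffAt ℝ k (Function.uncurry fun s ↦ pd i (J s)) (t, y) := by
  refine ((h.fderiv_right hk).clm_apply (contDiffAt_const
    (c := ((0 : ℝ), EuclideanSpace.single i (1 : ℝ))))).congr_of_eventuallyEq ?_
  filter_upwards [(h.of_le (le_add_self.trans hk)).eventually (by simp)] with q hq
  exact pd_eq_fderiv_uncurry (hq.differentiableAt one_ne_zero) i

variable {X : Rn n → ℝ}

theorem hasDerivAt_pd (h : ContDiffAt ℝ 2 (Function.uncurry J) (t, y))
    (hX : ∀ᶠ z in 𝓝 y, HasDerivAt (fun s ↦ J s z) (X z) t) (i : Fin n) :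
    HasDerivAt (fun s ↦ pd i (J s) y) (pd i X y) t := by
  have velocity : X =ᶠ[𝓝 y] fun z ↦ fderiv ℝ (Function.uncurry J) (t, z) (1, 0) := by
    filter_upwards [hX, (Continuous.prodMk_right t).continuousAt.eventually
      (h.eventually (by simp))] with z hz smooth
    exact hz.unique (hasDerivAt_uncurry (smooth.differentiableAt two_ne_zero))
  have smooth_fderiv (v : ℝ × Rn n) :
      DifferentiableAt ℝ (fun q ↦ fderiv ℝ (Function.uncurry J) q v) (t, y) :=
    ((h.fderiv_right (m := 1) (by norm_num)).clm_apply contDiffAt_const).differentiableAt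
      one_ne_zero
  have deriv_slice := hasDerivAt_uncurry
    ((contDiffAt_uncurry_pd (k := 1) h (by norm_num) i).differentiableAt one_ne_zero)
  have pd_eventually_eq : (Function.uncurry fun s ↦ pd i (J s)) =ᶠ[𝓝 (t, y)]
      fun q ↦ fderiv ℝ (Function.uncurry J) q (0, EuclideanSpace.single i 1) := by
    filter_upwards [h.eventually (by simp)] with q hq
    exact pd_eq_fderiv_uncurry (hq.differentiableAt two_ne_zero) i
  refine deriv_slice.congr_deriv ?_
  rw [pd_eventually_eq.fderiv_eq, fderiv_fderiv_comm h, pd_congr velocity]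
  exact (pd_eq_fderiv_uncurry
    (J := fun s z ↦ fderiv ℝ (Function.uncurry J) (s, z) (1, 0)) (smooth_fderiv _) i).symm

theorem hasDerivAt_pd_pd (h : ContDiffAt ℝ 3 (Function.uncurry J) (t, y))
    (hX : ∀ᶠ z in 𝓝 y, HasDerivAt (fun s ↦ J s z) (X z) t) (i j : Fin n) :
    HasDerivAt (fun s ↦ pd i (pd j (J s)) y) (pd i (pd j X) y) t := by
  refine hasDerivAt_pd (J := fun s ↦ pd j (J s)) (contDiffAt_uncurry_pd h (by norm_num) j) ?_ i
  filter_upwards [hX.eventually_nhds, (Continuous.prodMk_right t).continuousAt.eventually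
    (h.eventually (by simp))] with z hz smooth
  exact hasDerivAt_pd (smooth.of_le (by norm_num)) hz j

variable {A : Rn n → Matrix (Fin n) (Fin n) ℝ} {u : ℝ → Rn n → Rn n} {V : Rn n → Rn n}

theorem hasDerivAt_metricChristoffel_comp (hA : IsMetricAt A y) (hu0 : u 0 y = y)
    (hV : HasDerivAt (fun t ↦ u t y) (V y) 0) (k i j : Fin n) :
    HasDerivAt (fun t ↦ metricChristoffel A k i j (u t y))
      (∑ c, V y c * pd c (metricChristoffel A k i j) y) 0 := by
  have hd := (hA.differentiableAt_metricChristoffel k i j).hasFDerivAt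
  rw [← hu0] at hd
  rw [← fderiv_eq_sum_pd]
  exact (hd.comp_hasDerivAt 0 hV).congr_deriv (by rw [hu0])

theorem pd_apply_of_eventuallyEq_id {v : Rn n → Rn n} (hv : ∀ᶠ z in 𝓝 y, v z = z) (i a : Fin n) :
    pd i (fun z ↦ v z a) y = if a = i then 1 else 0 := by
  have coord : fderiv ℝ (fun z : Rn n ↦ z a) y = EuclideanSpace.proj a :=
    (EuclideanSpace.proj a : Rn n →L[ℝ] ℝ).hasFDerivAt.fderiv
  rw [pd_congr (hv.mono fun z hz ↦ congrArg (· a) hz), pd, coord]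
  simp

theorem hasDerivAt_hessian (hA : IsMetricAt A y)
    (hu : ContDiffAt ℝ 3 (Function.uncurry u) (0, y)) (hu0 : ∀ᶠ z in 𝓝 y, u 0 z = z)
    (hV : ∀ᶠ z in 𝓝 y, HasDerivAt (fun t ↦ u t z) (V z) 0) (k i j : Fin n) :
    HasDerivAt (fun t ↦ pd i (pd j (fun z ↦ u t z k)) y
        - ∑ l, metricChristoffel A l i j y * pd l (fun z ↦ u t z k) y
        + ∑ a, ∑ b, metricChristoffel A k a b (u t y) * pd i (fun z ↦ u t z a) y
          * pd j (fun z ↦ u t z b) y) (lieConnection A (fun z a ↦ V z a) k i j y) 0 := by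
  have smooth_coord (a : Fin n) : ContDiffAt ℝ 3 (Function.uncurry fun t z ↦ u t z a) (0, y) :=
    (EuclideanSpace.proj a : Rn n →L[ℝ] ℝ).contDiff.contDiffAt.comp (0, y) hu
  have hV_coord (a : Fin n) : ∀ᶠ z in 𝓝 y, HasDerivAt (fun t ↦ u t z a) (V z a) 0 :=
    hV.mono fun z hz ↦ (EuclideanSpace.proj a : Rn n →L[ℝ] ℝ).hasFDerivAt.comp_hasDerivAt 0 hz
  have deriv_pd (i a : Fin n) :=
    hasDerivAt_pd ((smooth_coord a).of_le (by norm_num)) (hV_coord a) i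
  have deriv_second := hasDerivAt_pd_pd (smooth_coord k) (hV_coord k) i j
  have deriv_christoffel :=
    hasDerivAt_metricChristoffel_comp hA hu0.self_of_nhds hV.self_of_nhds k
  have deriv_linear := HasDerivAt.fun_sum (u := Finset.univ) fun (l : Fin n) _ ↦
    (deriv_pd l k).const_mul (metricChristoffel A l i j y)
  have deriv_quadratic := HasDerivAt.fun_sum (u := Finset.univ) fun (a : Fin n) _ ↦
    HasDerivAt.fun_sum (u := Finset.univ) fun (b : Fin n) _ ↦
      ((deriv_christoffel a b).fun_mul (deriv_pd i a)).fun_mul (deriv_pd j b)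
  refine ((deriv_second.fun_sub deriv_linear).fun_add deriv_quadratic).congr_deriv ?_
  simp only [lieConnection, hu0.self_of_nhds, pd_apply_of_eventuallyEq_id hu0,
    Finset.sum_add_distrib, mul_ite, ite_mul, mul_one, mul_zero, zero_mul, Finset.sum_ite_eq',
    Finset.mem_univ, if_true, Finset.sum_ite_irrel, Finset.sum_const_zero]
  ring

end TensionDerivative

section InfinitesimalHarmonic

variable {n : ℕ} {M : Type*} [TopologicalSpace M] [ChartedSpace (Rn n) M]
  {ξ : ∀ x : M, TangentSpace (𝓡 n) x} {p : M}

/-- The local transformations generated by `ξ`, moving along straight lines in the chart at `p`. -/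
def chartFamily (ξ : ∀ x : M, TangentSpace (𝓡 n) x) (p : M) (t : ℝ) (x : M) : M :=
  (extChartAt (𝓡 n) p).symm (extChartAt (𝓡 n) p x
    + t • WithLp.toLp 2 (coordField ξ p (extChartAt (𝓡 n) p x)))

theorem chartFamily_zero {x : M} (hx : x ∈ (extChartAt (𝓡 n) p).source) :
    chartFamily ξ p 0 x = x := by
  rw [chartFamily, zero_smul, add_zero, (extChartAt (𝓡 n) p).left_inv hx]

variable [IsManifold (𝓡 n) ∞ M]

theorem contDiffAt_chart_expression {Φ : ℝ → M → M} (hp : Φ 0 p = p)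
    (hΦ : ContMDiffAt (𝓘(ℝ, ℝ).prod (𝓡 n)) (𝓡 n) ∞ (fun q : ℝ × M ↦ Φ q.1 q.2) (0, p)) :
    ContDiffAt ℝ ∞ (Function.uncurry fun t z ↦
        extChartAt (𝓡 n) p (Φ t ((extChartAt (𝓡 n) p).symm z))) (0, extChartAt (𝓡 n) p p) := by
  set e := extChartAt (𝓡 n) p
  have hep : e.symm (e p) = p := e.left_inv (mem_extChartAt_source p)
  have smooth_symm : ContMDiffAt 𝓘(ℝ, ℝ × Rn n) (𝓘(ℝ, ℝ).prod (𝓡 n)) ∞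
      (fun q : ℝ × Rn n ↦ (q.1, e.symm q.2)) (0, e p) :=
    contDiff_fst.contMDiff.contMDiffAt.prodMk ((contMDiffAt_chart_symm
      (mem_extChartAt_target p)).comp ((0 : ℝ), e p) contDiff_snd.contMDiff.contMDiffAt)
  have smooth_comp : ContMDiffAt 𝓘(ℝ, ℝ × Rn n) (𝓡 n) ∞
      (fun q : ℝ × Rn n ↦ Φ q.1 (e.symm q.2)) (0, e p) :=
    ContMDiffAt.comp (g := fun q : ℝ × M ↦ Φ q.1 q.2) ((0 : ℝ), e p)
      (by simpa only [hep] using hΦ) smooth_symm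
  have mem_source : Φ 0 (e.symm (e p)) ∈ e.source := by
    rw [hep, hp]
    exact mem_extChartAt_source p
  exact ((contMDiffAt_chart mem_source).comp ((0 : ℝ), e p) smooth_comp).contDiffAt

theorem hasDerivAt_chart_comp {γ : ℝ → M} {x : M} (h0 : γ 0 = x)
    (hx : x ∈ (extChartAt (𝓡 n) p).source)
    (hγ : HasMFDerivAt 𝓘(ℝ, ℝ) (𝓡 n) γ 0 ((1 : ℝ →L[ℝ] ℝ).smulRight (ξ (γ 0)))) :
    HasDerivAt (fun t ↦ extChartAt (𝓡 n) p (γ t)) (chartDeriv p x (ξ x)) 0 := by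
  subst h0
  have chain : HasFDerivAt (fun t ↦ extChartAt (𝓡 n) p (γ t)) (chartDeriv p (γ 0)
      ∘L (1 : ℝ →L[ℝ] ℝ).smulRight ((ξ : M → Rn n) (γ 0))) 0 :=
    (((contMDiffAt_chart hx).mdifferentiableAt (by simp)).hasMFDerivAt.comp 0 hγ).hasFDerivAt
  refine chain.hasDerivAt.congr_deriv ?_
  exact congrArg (chartDeriv p (γ 0)) (one_smul ℝ ((ξ : M → Rn n) (γ 0)))

theorem hasDerivAt_coordTension (g : RiemMetric n M) {Φ : ℝ → M → M}
    (hΦ : ContMDiffAt (𝓘(ℝ, ℝ).prod (𝓡 n)) (𝓡 n) ∞ (fun q : ℝ × M ↦ Φ q.1 q.2) (0, p))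
    (hev : ∀ᶠ x in 𝓝 p, Φ 0 x = x ∧
      HasMFDerivAt 𝓘(ℝ, ℝ) (𝓡 n) (fun t ↦ Φ t x) 0
        ((1 : ℝ →L[ℝ] ℝ).smulRight (ξ (Φ 0 x)))) (k : Fin n) :
    HasDerivAt (fun t ↦ coordTension g p (Φ t) k)
      (lieTension (coordMetric g p) (coordField ξ p) k (extChartAt (𝓡 n) p p)) 0 := by
  set e := extChartAt (𝓡 n) p
  have ht : e p ∈ e.target := mem_extChartAt_target p
  have hep : e.symm (e p) = p := e.left_inv (mem_extChartAt_source p)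
  have chart_ev := Eventually.and ((isOpen_extChartAt_target p).mem_nhds ht)
    ((contMDiffAt_chart_symm ht).continuousAt.eventually (by rwa [hep]))
  have hessian := hasDerivAt_hessian (isMetricAt_coordMetric g ht)
    (u := fun t z ↦ e (Φ t (e.symm z)))
    (V := fun z ↦ chartDeriv p (e.symm z) (ξ (e.symm z)))
    ((contDiffAt_chart_expression hev.self_of_nhds.1 hΦ).of_le (by norm_cast))
    (chart_ev.mono fun z hz ↦ by rw [hz.2.1, e.right_inv hz.1])
    (chart_ev.mono fun z hz ↦ hasDerivAt_chart_comp hz.2.1 (e.map_target hz.1) hz.2.2) k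
  refine (HasDerivAt.fun_sum (u := Finset.univ) fun (i : Fin n) _ ↦
    HasDerivAt.fun_sum (u := Finset.univ) fun (j : Fin n) _ ↦
      (hessian i j).const_mul ((coordMetric g p (e p))⁻¹ i j)).congr_of_eventuallyEq ?_
  refine Eventually.of_forall fun t ↦ ?_
  simp only [coordTension, christoffel_eq]
  rfl

theorem contMDiffAt_chartFamily (hξ : ∀ k, ContDiffAt ℝ ∞ (fun z ↦ coordField ξ p z k)
      (extChartAt (𝓡 n) p p)) :
    ContMDiffAt (𝓘(ℝ, ℝ).prod (𝓡 n)) (𝓡 n) ∞ (fun q : ℝ × M ↦ chartFamily ξ p q.1 q.2)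
      (0, p) := by
  set e := extChartAt (𝓡 n) p
  let V : Rn n → Rn n := fun z ↦ WithLp.toLp 2 (coordField ξ p z)
  have smooth_field : ContDiffAt ℝ ∞ V (e p) := contDiffAt_euclidean.2 hξ
  have smooth_chart : ContMDiffAt (𝓘(ℝ, ℝ).prod (𝓡 n)) 𝓘(ℝ, ℝ × Rn n) ∞
      (fun q : ℝ × M ↦ (q.1, e q.2)) (0, p) :=
    contMDiffAt_fst.prodMk_space
      ((contMDiffAt_chart (mem_extChartAt_source p)).comp (0, p) contMDiffAt_snd)
  have smooth_line : ContDiffAt ℝ ∞ (fun q : ℝ × Rn n ↦ q.2 + q.1 • V q.2) ((0 : ℝ), e p) :=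
    contDiffAt_snd.add (contDiffAt_fst.smul
      (ContDiffAt.comp (g := V) ((0 : ℝ), e p) smooth_field contDiffAt_snd))
  have mem_target : e p + (0 : ℝ) • V (e p) ∈ e.target := by
    rw [zero_smul, add_zero]
    exact mem_extChartAt_target p
  exact (contMDiffAt_chart_symm mem_target).comp ((0 : ℝ), p)
    (ContMDiffAt.comp (g := fun q : ℝ × Rn n ↦ q.2 + q.1 • V q.2) ((0 : ℝ), p)
      smooth_line.contMDiffAt smooth_chart)

theorem hasMFDerivAt_chartFamily {x : M} (hx : x ∈ (extChartAt (𝓡 n) p).source) :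
    HasMFDerivAt 𝓘(ℝ, ℝ) (𝓡 n) (fun t ↦ chartFamily ξ p t x) 0
      ((1 : ℝ →L[ℝ] ℝ).smulRight (ξ (chartFamily ξ p 0 x))) := by
  set e := extChartAt (𝓡 n) p
  let v : Rn n := WithLp.toLp 2 (coordField ξ p (e x))
  have hv : v = chartDeriv p x (ξ x) := by
    ext k
    exact congrArg (fun x ↦ chartDeriv p x ((ξ : M → Rn n) x) k) (e.left_inv hx)
  have base : e x + (0 : ℝ) • v = e x := by rw [zero_smul, add_zero]
  have line : HasDerivAt (fun t : ℝ ↦ e x + t • v) ((1 : ℝ) • v) 0 :=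
    ((hasDerivAt_id (0 : ℝ)).smul_const v).const_add (e x)
  have mem_target : e x + (0 : ℝ) • v ∈ e.target := by
    rw [base]
    exact e.map_source hx
  have chain := ((contMDiffAt_chart_symm mem_target).mdifferentiableAt
    (by simp)).hasMFDerivAt.comp (0 : ℝ) line.hasFDerivAt.hasMFDerivAt
  have derivative : symmDeriv p (e x + (0 : ℝ) • v)
        ∘L ContinuousLinearMap.toSpanSingleton ℝ ((1 : ℝ) • v)
      = (1 : ℝ →L[ℝ] ℝ).smulRight ((ξ : M → Rn n) (chartFamily ξ p 0 x)) := by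
    have velocity : (ξ : M → Rn n) (chartFamily ξ p 0 x) = ξ x :=
      congrArg (ξ : M → Rn n) (chartFamily_zero hx)
    rw [velocity, base, one_smul, hv]
    refine ContinuousLinearMap.ext_ring ?_
    rw [ContinuousLinearMap.comp_apply, ContinuousLinearMap.toSpanSingleton_apply_one]
    exact (symmDeriv_chartDeriv_of_mem hx (ξ x)).trans (one_smul ℝ (ξ x : Rn n)).symm
  exact derivative ▸ chain

theorem isInfinitesimalHarmonic_iff (g : RiemMetric n M)
    (hξ : ∀ (p : M) k, ContDiffAt ℝ ∞ (fun z ↦ coordField ξ p z k) (extChartAt (𝓡 n) p p)) :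
    IsInfinitesimalHarmonic g ξ ↔ ∀ p k,
      lieTension (coordMetric g p) (coordField ξ p) k (extChartAt (𝓡 n) p p) = 0 := by
  refine ⟨fun h p k ↦ ?_, fun h p Φ hΦ hev k ↦ ?_⟩
  · have generated : ∀ᶠ x in 𝓝 p, chartFamily ξ p 0 x = x ∧
        HasMFDerivAt 𝓘(ℝ, ℝ) (𝓡 n) (fun t ↦ chartFamily ξ p t x) 0
          ((1 : ℝ →L[ℝ] ℝ).smulRight (ξ (chartFamily ξ p 0 x))) := by
      filter_upwards [extChartAt_source_mem_nhds (I := 𝓡 n) p] with x hx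
      exact ⟨chartFamily_zero hx, hasMFDerivAt_chartFamily hx⟩
    have smooth := contMDiffAt_chartFamily (hξ p)
    exact (hasDerivAt_coordTension g smooth generated k).unique (h p _ smooth generated k)
  · exact (hasDerivAt_coordTension g hΦ hev k).congr_deriv (h p k)

end InfinitesimalHarmonic

section Differential

variable {n : ℕ} {M : Type*} [TopologicalSpace M] [ChartedSpace (Rn n) M] {p : M} {y : Rn n}
  {u : M → ℝ}

theorem differential_eq_zero_of_notMem_tsupport {x : M} (hx : x ∉ tsupport u)
    (w : TangentSpace (𝓡 n) x) : differential u x w = 0 := by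
  have h : HasMFDerivAt (𝓡 n) 𝓘(ℝ, ℝ) u x (0 : Rn n →L[ℝ] ℝ) :=
    (hasMFDerivAt_const (0 : ℝ) x).congr_of_eventuallyEq (notMem_tsupport_iff_eventuallyEq.1 hx)
  exact congrArg (fun L : Rn n →L[ℝ] ℝ ↦ L w) h.mfderiv

variable [IsManifold (𝓡 n) ∞ M]

theorem contDiffAt_comp_symm (hu : ContMDiff (𝓡 n) 𝓘(ℝ, ℝ) ∞ u)
    (hy : y ∈ (extChartAt (𝓡 n) p).target) :
    ContDiffAt ℝ ∞ (fun z ↦ u ((extChartAt (𝓡 n) p).symm z)) y :=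
  (hu.contMDiffAt.comp y (contMDiffAt_chart_symm hy)).contDiffAt

theorem differential_symm
    (hu : MDifferentiableAt (𝓡 n) 𝓘(ℝ, ℝ) u ((extChartAt (𝓡 n) p).symm y))
    (hy : y ∈ (extChartAt (𝓡 n) p).target)
    (w : TangentSpace (𝓡 n) ((extChartAt (𝓡 n) p).symm y)) :
    differential u ((extChartAt (𝓡 n) p).symm y) w
      = ∑ k, chartDeriv p ((extChartAt (𝓡 n) p).symm y) w k
        * pd k (fun z ↦ u ((extChartAt (𝓡 n) p).symm z)) y := by
  let L : Rn n →L[ℝ] ℝ := mfderiv (𝓡 n) 𝓘(ℝ, ℝ) u ((extChartAt (𝓡 n) p).symm y)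
  have chain : HasMFDerivAt (𝓡 n) 𝓘(ℝ, ℝ) (u ∘ (extChartAt (𝓡 n) p).symm) y
      (L ∘L symmDeriv p y) :=
    hu.hasMFDerivAt.comp y ((contMDiffAt_chart_symm hy).mdifferentiableAt (by simp)).hasMFDerivAt
  have derivative : HasFDerivAt (fun z ↦ u ((extChartAt (𝓡 n) p).symm z)) (L ∘L symmDeriv p y) y :=
    chain.hasFDerivAt
  have expand (v : Rn n) : L v = ∑ k, chartDeriv p ((extChartAt (𝓡 n) p).symm y) v k
      * pd k (fun z ↦ u ((extChartAt (𝓡 n) p).symm z)) y := by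
    rw [← fderiv_eq_sum_pd, derivative.fderiv, ContinuousLinearMap.comp_apply,
      symmDeriv_chartDeriv hy]
  exact expand w

theorem differential_eq {x : M} (hu : MDifferentiableAt (𝓡 n) 𝓘(ℝ, ℝ) u x)
    (w : TangentSpace (𝓡 n) x) :
    differential u x w = ∑ k, vecComp x w k
      * pd k (fun z ↦ u ((extChartAt (𝓡 n) x).symm z)) (extChartAt (𝓡 n) x x) := by
  have key (p : M) (hx : x ∈ (extChartAt (𝓡 n) p).source) : differential u x w
      = ∑ k, chartDeriv p x w k
        * pd k (fun z ↦ u ((extChartAt (𝓡 n) p).symm z)) (extChartAt (𝓡 n) p x) := by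
    obtain ⟨y, hy, rfl⟩ : ∃ y ∈ (extChartAt (𝓡 n) p).target, (extChartAt (𝓡 n) p).symm y = x :=
      ⟨_, (extChartAt (𝓡 n) p).map_source hx, (extChartAt (𝓡 n) p).left_inv hx⟩
    rw [differential_symm hu hy, (extChartAt (𝓡 n) p).right_inv hy]
  exact key x (mem_extChartAt_source x)

theorem sum_differential_eq_zero {ι : Type*} [Fintype ι] {ρ : ι → M → ℝ}
    (hρ : ∀ a, ContMDiff (𝓡 n) 𝓘(ℝ, ℝ) ∞ (ρ a)) (hsum : ∀ x, ∑ a, ρ a x = 1) (x : M)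
    (w : TangentSpace (𝓡 n) x) : ∑ a, differential (ρ a) x w = 0 := by
  simp only [differential_eq ((hρ _).mdifferentiableAt (by simp))]
  rw [Finset.sum_comm]
  refine Finset.sum_eq_zero fun k _ ↦ ?_
  rw [← Finset.mul_sum, ← pd_sum k fun a ↦ (contDiffAt_comp_symm (hρ a)
    (mem_extChartAt_target x)).differentiableAt (by simp)]
  simp only [hsum, pd_const, mul_zero]

end Differential

section ChartExtension

variable {n : ℕ} {M : Type*} [TopologicalSpace M] [ChartedSpace (Rn n) M] {p : M} {y : Rn n}
  {ρ : M → ℝ}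

/-- A function on `M`, to be supported in the domain of the chart at `p`, read in that chart and
extended by zero to `ℝⁿ`; this makes it a test function for integration by parts. -/
def chartExtension (p : M) (ρ : M → ℝ) : Rn n → ℝ :=
  (extChartAt (𝓡 n) p).target.indicator fun y ↦ ρ ((extChartAt (𝓡 n) p).symm y)

theorem chartExtension_of_mem (hy : y ∈ (extChartAt (𝓡 n) p).target) :
    chartExtension p ρ y = ρ ((extChartAt (𝓡 n) p).symm y) :=
  indicator_of_mem hy _

theorem support_chartExtension_subset (p : M) (ρ : M → ℝ) :
    Function.support (chartExtension p ρ) ⊆ extChartAt (𝓡 n) p '' tsupport ρ := by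
  intro y hy
  rw [chartExtension, support_indicator] at hy
  exact ⟨_, subset_tsupport ρ hy.2, (extChartAt (𝓡 n) p).right_inv hy.1⟩

theorem isCompact_image_tsupport (hc : HasCompactSupport ρ)
    (hs : tsupport ρ ⊆ (extChartAt (𝓡 n) p).source) :
    IsCompact (extChartAt (𝓡 n) p '' tsupport ρ) :=
  hc.isCompact.image_of_continuousOn ((continuousOn_extChartAt p).mono hs)

theorem hasCompactSupport_chartExtension (hc : HasCompactSupport ρ)
    (hs : tsupport ρ ⊆ (extChartAt (𝓡 n) p).source) :
    HasCompactSupport (chartExtension (n := n) p ρ) :=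
  .of_support_subset_isCompact (isCompact_image_tsupport (n := n) hc hs)
    (support_chartExtension_subset p ρ)

theorem tsupport_chartExtension_subset (hc : HasCompactSupport ρ)
    (hs : tsupport ρ ⊆ (extChartAt (𝓡 n) p).source) :
    tsupport (chartExtension p ρ) ⊆ (extChartAt (𝓡 n) p).target :=
  (closure_minimal (support_chartExtension_subset p ρ)
    (isCompact_image_tsupport (n := n) hc hs).isClosed).trans <|
    image_subset_iff.2 fun _ hx ↦ (extChartAt (𝓡 n) p).map_source (hs hx)

theorem contDiff_chartExtension [IsManifold (𝓡 n) ∞ M] (hρ : ContMDiff (𝓡 n) 𝓘(ℝ, ℝ) ∞ ρ)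
    (hc : HasCompactSupport ρ) (hs : tsupport ρ ⊆ (extChartAt (𝓡 n) p).source) :
    ContDiff ℝ ∞ (chartExtension (n := n) p ρ) := by
  refine contMDiff_iff_contDiff.1 (contMDiff_of_tsupport fun y hy ↦ ?_)
  have target := (isOpen_extChartAt_target (I := 𝓡 n) p).mem_nhds
    (tsupport_chartExtension_subset hc hs hy)
  exact ((contDiffAt_comp_symm hρ (mem_of_mem_nhds target)).congr_of_eventuallyEq
    (eventuallyEq_of_mem target fun _ ↦ chartExtension_of_mem)).contMDiffAt

end ChartExtension

section DivergenceTheorem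

variable {n : ℕ} {M : Type*} [TopologicalSpace M] [ChartedSpace (Rn n) M] [IsManifold (𝓡 n) ∞ M]
  (g : RiemMetric n M) (θ : OneForm n M) {p : M} {y : Rn n}

theorem contDiffAt_lieMatrix (hy : y ∈ (extChartAt (𝓡 n) p).target) (i j : Fin n) :
    ContDiffAt ℝ ∞
      (fun z ↦ lieMatrix (coordMetric g p) (coordField (sharp g θ) p) z i j) y := by
  have hA := (isMetricAt_coordMetric g hy).smooth
  have hX := contDiffAt_coordField_sharp g θ hy
  have smooth : ContDiffAt ℝ ∞ (fun z ↦ ∑ k, (coordField (sharp g θ) p z k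
      * pd k (fun z ↦ coordMetric g p z i j) z
      + coordMetric g p z k j * pd i (fun z ↦ coordField (sharp g θ) p z k) z
      + coordMetric g p z i k * pd j (fun z ↦ coordField (sharp g θ) p z k) z)) y :=
    ContDiffAt.sum fun k _ ↦ (((hX k).mul (contDiffAt_pd (hA i j) (by simp) k)).add
      ((hA k j).mul (contDiffAt_pd (hX k) (by simp) i))).add
      ((hA i k).mul (contDiffAt_pd (hX k) (by simp) j))
  exact smooth

theorem divForm_symm (hy : y ∈ (extChartAt (𝓡 n) p).target) :
    divForm g (fun x v ↦ θ x v) ((extChartAt (𝓡 n) p).symm y)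
      = -(1 / 2) * contract (coordMetric g p y)⁻¹
        (lieMatrix (coordMetric g p) (coordField (sharp g θ) p) y) := by
  rw [divForm_eq, metricTrace_eq g hy (isBilinAt_lieMetric g _ _),
    coordTensor_lieMetric_sharp g θ hy]

theorem contDiffAt_divForm_symm (hy : y ∈ (extChartAt (𝓡 n) p).target) :
    ContDiffAt ℝ ∞ (fun y ↦ divForm g (fun x v ↦ θ x v) ((extChartAt (𝓡 n) p).symm y)) y := by
  have smooth : ContDiffAt ℝ ∞ (fun y ↦ -(1 / 2) * contract (coordMetric g p y)⁻¹
      (lieMatrix (coordMetric g p) (coordField (sharp g θ) p) y)) y :=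
    contDiffAt_const.mul (ContDiffAt.sum fun i _ ↦ ContDiffAt.sum fun j _ ↦
      ((isMetricAt_coordMetric g hy).smooth_inv i j).mul (contDiffAt_lieMatrix g θ hy i j))
  exact smooth.congr_of_eventuallyEq
    (eventuallyEq_of_mem ((isOpen_extChartAt_target p).mem_nhds hy) fun z ↦ divForm_symm g θ)

theorem continuousOn_divForm_symm (p : M) :
    ContinuousOn (fun y ↦ divForm g (fun x v ↦ θ x v) ((extChartAt (𝓡 n) p).symm y))
      (extChartAt (𝓡 n) p).target := fun _ hy ↦
  (contDiffAt_divForm_symm g θ hy).continuousAt.continuousWithinAt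

theorem continuous_divForm : Continuous (divForm g fun x v ↦ θ x v) :=
  continuous_of_symm (continuousOn_divForm_symm g θ)

theorem continuousOn_differential_sharp_symm {u : M → ℝ} (hu : ContMDiff (𝓡 n) 𝓘(ℝ, ℝ) ∞ u)
    (p : M) :
    ContinuousOn (fun y ↦ differential u ((extChartAt (𝓡 n) p).symm y)
      (sharp g θ ((extChartAt (𝓡 n) p).symm y))) (extChartAt (𝓡 n) p).target := by
  refine ContinuousOn.congr (fun y hy ↦ ?_)
    fun y hy ↦ differential_symm (hu.mdifferentiableAt (by simp)) hy _
  have smooth : ContDiffAt ℝ ∞ (fun y ↦ ∑ k, coordField (sharp g θ) p y k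
      * pd k (fun z ↦ u ((extChartAt (𝓡 n) p).symm z)) y) y :=
    ContDiffAt.sum fun k _ ↦ (contDiffAt_coordField_sharp g θ hy k).mul
      (contDiffAt_pd (contDiffAt_comp_symm hu hy) (by simp) k)
  exact smooth.continuousAt.continuousWithinAt

/-- The components `√det(gᵢⱼ) ξᵏ`, in the chart at `p`, of the vector density of `ξ = θ^#`; its
flat divergence is `-√det(gᵢⱼ) δθ`. -/
def sharpDensity (p : M) (k : Fin n) (y : Rn n) : ℝ :=
  √(coordMetric g p y).det * coordField (sharp g θ) p y k

theorem contDiffAt_sharpDensity (hy : y ∈ (extChartAt (𝓡 n) p).target) (k : Fin n) :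
    ContDiffAt ℝ ∞ (sharpDensity g θ p k) y :=
  (isMetricAt_coordMetric g hy).contDiffAt_sqrt_det.mul (contDiffAt_coordField_sharp g θ hy k)

theorem sqrt_det_mul_divForm_symm (hy : y ∈ (extChartAt (𝓡 n) p).target) :
    √(coordMetric g p y).det * divForm g (fun x v ↦ θ x v) ((extChartAt (𝓡 n) p).symm y)
      = -∑ k, pd k (sharpDensity g θ p k) y := by
  have flat_divergence := (isMetricAt_coordMetric g hy).sqrt_det_mul_contract_lieMatrix
    (differentiableAt_coordField_sharp g θ hy)
  rw [divForm_symm g θ hy, mul_left_comm, flat_divergence, neg_mul, one_div,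
    inv_mul_cancel_left₀ two_ne_zero]
  rfl

theorem sqrt_det_mul_differential_symm {ρ : M → ℝ} (hρ : ContMDiff (𝓡 n) 𝓘(ℝ, ℝ) ∞ ρ)
    (hy : y ∈ (extChartAt (𝓡 n) p).target) :
    √(coordMetric g p y).det * differential ρ ((extChartAt (𝓡 n) p).symm y)
        (sharp g θ ((extChartAt (𝓡 n) p).symm y))
      = ∑ k, sharpDensity g θ p k y * pd k (chartExtension p ρ) y := by
  have extension : chartExtension p ρ =ᶠ[𝓝 y] fun z ↦ ρ ((extChartAt (𝓡 n) p).symm z) :=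
    eventuallyEq_of_mem ((isOpen_extChartAt_target p).mem_nhds hy) fun _ ↦ chartExtension_of_mem
  rw [differential_symm (hρ.mdifferentiableAt (by simp)) hy, Finset.mul_sum]
  refine Finset.sum_congr rfl fun k _ ↦ ?_
  rw [pd_congr extension, ← mul_assoc]
  rfl

variable [MeasurableSpace M] [BorelSpace M] {ρ : M → ℝ}

theorem integral_riemVol_of_support_subset {F : M → ℝ}
    (hs : Function.support F ⊆ (extChartAt (𝓡 n) p).source)
    (hF : ContinuousOn (fun y ↦ F ((extChartAt (𝓡 n) p).symm y)) (extChartAt (𝓡 n) p).target) :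
    ∫ x, F x ∂(riemVol g) = ∫ y in (extChartAt (𝓡 n) p).target,
      √(coordMetric g p y).det * F ((extChartAt (𝓡 n) p).symm y) := by
  rw [← setIntegral_eq_integral_of_forall_compl_eq_zero (s := (extChartAt (𝓡 n) p).source)
    fun x hx ↦ Function.notMem_support.1 fun h ↦ hx (hs h), setIntegral_riemVol g
    (isOpen_extChartAt_source p).measurableSet subset_rfl hF,
    inter_eq_right.2 (extChartAt (𝓡 n) p).target_subset_preimage_source]

theorem integral_mul_divForm_eq_neg_sum (hρ : ContMDiff (𝓡 n) 𝓘(ℝ, ℝ) ∞ ρ)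
    (hc : HasCompactSupport ρ) (hs : tsupport ρ ⊆ (extChartAt (𝓡 n) p).source) :
    ∫ x, ρ x * divForm g (fun x v ↦ θ x v) x ∂(riemVol g)
      = -∑ k, ∫ y, pd k (sharpDensity g θ p k) y * chartExtension p ρ y := by
  have target_open := isOpen_extChartAt_target (I := 𝓡 n) p
  have support_subset : Function.support (fun x ↦ ρ x * divForm g (fun x v ↦ θ x v) x)
      ⊆ (extChartAt (𝓡 n) p).source :=
    (Function.support_mul_subset_left _ _).trans ((subset_tsupport ρ).trans hs)
  have integrand (y : Rn n) (hy : y ∈ (extChartAt (𝓡 n) p).target) :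
      √(coordMetric g p y).det * (ρ ((extChartAt (𝓡 n) p).symm y)
        * divForm g (fun x v ↦ θ x v) ((extChartAt (𝓡 n) p).symm y))
      = -∑ k, pd k (sharpDensity g θ p k) y * chartExtension p ρ y := by
    rw [chartExtension_of_mem hy, mul_left_comm, sqrt_det_mul_divForm_symm g θ hy,
      ← Finset.sum_mul, mul_neg, mul_comm]
  have vanishing (y : Rn n) (hy : y ∉ (extChartAt (𝓡 n) p).target) :
      chartExtension p ρ y = 0 := indicator_of_notMem hy _
  rw [integral_riemVol_of_support_subset g support_subset ((ContinuousOn.mul (fun y hy ↦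
      (contDiffAt_comp_symm hρ hy).continuousAt.continuousWithinAt)
      (continuousOn_divForm_symm g θ p))),
    setIntegral_congr_fun target_open.measurableSet integrand,
    setIntegral_eq_integral_of_forall_compl_eq_zero fun y hy ↦ by simp [vanishing y hy],
    integral_neg, integral_finsetSum _ fun k _ ↦ ?_]
  exact integrable_mul_of_tsupport_subset target_open
    (continuousOn_pd (fun y hy ↦ (contDiffAt_sharpDensity g θ hy k).of_le (by simp)) k)
    (contDiff_chartExtension hρ hc hs).continuous (hasCompactSupport_chartExtension hc hs)
    (tsupport_chartExtension_subset hc hs)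

theorem integral_differential_sharp_eq_sum (hρ : ContMDiff (𝓡 n) 𝓘(ℝ, ℝ) ∞ ρ)
    (hc : HasCompactSupport ρ) (hs : tsupport ρ ⊆ (extChartAt (𝓡 n) p).source) :
    ∫ x, differential ρ x (sharp g θ x) ∂(riemVol g)
      = ∑ k, ∫ y, sharpDensity g θ p k y * pd k (chartExtension p ρ) y := by
  have target_open := isOpen_extChartAt_target (I := 𝓡 n) p
  have support_subset : Function.support (fun x ↦ differential ρ x (sharp g θ x))
      ⊆ (extChartAt (𝓡 n) p).source := fun x hx ↦ by
    by_contra h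
    exact hx (differential_eq_zero_of_notMem_tsupport (fun h' ↦ h (hs h')) _)
  have vanishing (k : Fin n) (y : Rn n) (hy : y ∉ (extChartAt (𝓡 n) p).target) :
      pd k (chartExtension p ρ) y = 0 :=
    image_eq_zero_of_notMem_tsupport fun h ↦
      hy (tsupport_chartExtension_subset hc hs (tsupport_pd_subset k _ h))
  rw [integral_riemVol_of_support_subset g support_subset
      (continuousOn_differential_sharp_symm g θ hρ p),
    setIntegral_congr_fun target_open.measurableSet fun y hy ↦
      sqrt_det_mul_differential_symm g θ hρ hy,
    setIntegral_eq_integral_of_forall_compl_eq_zero fun y hy ↦ by simp [vanishing _ y hy],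
    integral_finsetSum _ fun k _ ↦ ?_]
  exact integrable_mul_pd_of_tsupport_subset target_open
    (fun y hy ↦ (contDiffAt_sharpDensity g θ hy k).continuousAt.continuousWithinAt)
    ((contDiff_chartExtension hρ hc hs).of_le (by simp)) (hasCompactSupport_chartExtension hc hs)
    (tsupport_chartExtension_subset hc hs) k

theorem integral_mul_divForm (hρ : ContMDiff (𝓡 n) 𝓘(ℝ, ℝ) ∞ ρ)
    (hc : HasCompactSupport ρ) (hs : tsupport ρ ⊆ (extChartAt (𝓡 n) p).source) :
    ∫ x, ρ x * divForm g (fun x v ↦ θ x v) x ∂(riemVol g)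
      = ∫ x, differential ρ x (sharp g θ x) ∂(riemVol g) := by
  rw [integral_mul_divForm_eq_neg_sum g θ hρ hc hs, integral_differential_sharp_eq_sum g θ hρ hc hs,
    ← Finset.sum_neg_distrib]
  exact Finset.sum_congr rfl fun k _ ↦ (integral_mul_pd_eq_neg (isOpen_extChartAt_target p)
    (fun y hy ↦ (contDiffAt_sharpDensity g θ hy k).of_le (by simp))
    ((contDiff_chartExtension hρ hc hs).of_le (by simp)) (hasCompactSupport_chartExtension hc hs)
    (tsupport_chartExtension_subset hc hs) k).symm

variable [CompactSpace M]

theorem integrable_riemVol_of_continuous {F : M → ℝ} (hF : Continuous F) :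
    Integrable F (riemVol g) :=
  hF.integrable_of_hasCompactSupport (HasCompactSupport.of_compactSpace F)

theorem integral_divForm [T2Space M] :
    ∫ x, divForm g (fun x v ↦ θ x v) x ∂(riemVol g) = 0 := by
  obtain ⟨S, -, hS⟩ := isCompact_univ.elim_nhds_subcover
    (fun p : M ↦ (extChartAt (𝓡 n) p).source) fun p _ ↦ extChartAt_source_mem_nhds p
  obtain ⟨ρ, hρ⟩ := SmoothPartitionOfUnity.exists_isSubordinate (𝓡 n) (isClosed_univ (X := M))
    (fun p : S ↦ (extChartAt (𝓡 n) (p : M)).source) (fun p ↦ isOpen_extChartAt_source _)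
    (by simpa [iUnion_subtype] using hS)
  have smooth (p : S) : ContMDiff (𝓡 n) 𝓘(ℝ, ℝ) ∞ (ρ p) := (ρ p).contMDiff
  have sum_eq_one (x : M) : ∑ p, ρ p x = 1 := by
    rw [← finsum_eq_sum_of_fintype]
    exact ρ.sum_eq_one (mem_univ x)
  calc ∫ x, divForm g (fun x v ↦ θ x v) x ∂(riemVol g)
      = ∫ x, ∑ p, ρ p x * divForm g (fun x v ↦ θ x v) x ∂(riemVol g) := by
        simp only [← Finset.sum_mul, sum_eq_one, one_mul]
    _ = ∑ p, ∫ x, ρ p x * divForm g (fun x v ↦ θ x v) x ∂(riemVol g) :=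
        integral_finsetSum _ fun p _ ↦ integrable_riemVol_of_continuous g
          ((smooth p).continuous.fun_mul (continuous_divForm g θ))
    _ = ∑ p, ∫ x, differential (ρ p) x (sharp g θ x) ∂(riemVol g) :=
        Finset.sum_congr rfl fun p _ ↦
          integral_mul_divForm g θ (smooth p) (.of_compactSpace _) (hρ p)
    _ = ∫ x, ∑ p, differential (ρ p) x (sharp g θ x) ∂(riemVol g) :=
        (integral_finsetSum _ fun p _ ↦ integrable_riemVol_of_continuous g
          (continuous_of_symm (continuousOn_differential_sharp_symm g θ (smooth p)))).symm
    _ = 0 := by simp only [sum_differential_eq_zero smooth sum_eq_one, integral_zero]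

end DivergenceTheorem

section StressDivergence

variable {n : ℕ} {M : Type*} [TopologicalSpace M] [ChartedSpace (Rn n) M] [IsManifold (𝓡 n) ∞ M]

theorem exists_vecComp_eq_single (x : M) (k : Fin n) :
    ∃ w : TangentSpace (𝓡 n) x, ∀ l, vecComp x w l = if l = k then 1 else 0 := by
  have inverse := chartDeriv_symmDeriv (mem_extChartAt_target x) (EuclideanSpace.single k (1 : ℝ))
  rw [(extChartAt (𝓡 n) x).left_inv (mem_extChartAt_source x)] at inverse
  exact ⟨symmDeriv x (extChartAt (𝓡 n) x x) (EuclideanSpace.single k (1 : ℝ) : Rn n), fun l ↦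
    (congrArg (fun v : Rn n ↦ v l) inverse).trans (by simp)⟩

theorem sum_mul_vecComp_eq_zero_iff {x : M} {a : Fin n → ℝ} :
    (∀ w : TangentSpace (𝓡 n) x, ∑ k, a k * vecComp x w k = 0) ↔ ∀ k, a k = 0 := by
  refine ⟨fun h k ↦ ?_, fun h w ↦ by simp only [h, zero_mul, Finset.sum_const_zero]⟩
  obtain ⟨w, hw⟩ := exists_vecComp_eq_single x k
  simpa [hw] using h w

variable (g : RiemMetric n M)

theorem divTensor_eq {h : ∀ x : M, TangentSpace (𝓡 n) x → TangentSpace (𝓡 n) x → ℝ} {x : M}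
    (hb : ∀ x, IsBilinAt h x)
    (hd : ∀ i j, DifferentiableAt ℝ (fun z ↦ coordTensor h x z i j) (extChartAt (𝓡 n) x x))
    (hs : (coordTensor h x (extChartAt (𝓡 n) x x)).IsSymm) (w : TangentSpace (𝓡 n) x) :
    divTensor g h x w = -∑ k, (stressDiv (coordMetric g x) (coordTensor h x) k
        (extChartAt (𝓡 n) x x)
      + (1 / 2) * pd k (fun z ↦ metricTrace g h ((extChartAt (𝓡 n) x).symm z))
        (extChartAt (𝓡 n) x x)) * vecComp x w k := by
  have target : extChartAt (𝓡 n) x x ∈ (extChartAt (𝓡 n) x).target := mem_extChartAt_target x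
  have trace (k : Fin n) : pd k (fun z ↦ metricTrace g h ((extChartAt (𝓡 n) x).symm z))
      (extChartAt (𝓡 n) x x)
      = pd k (fun z ↦ contract (coordMetric g x z)⁻¹ (coordTensor h x z)) (extChartAt (𝓡 n) x x) :=
    pd_congr <| eventuallyEq_of_mem ((isOpen_extChartAt_target x).mem_nhds target) fun z hz ↦
      metricTrace_eq g hz (hb _)
  simp only [trace, ← (isMetricAt_coordMetric g target).divergence_eq hd hs, ← christoffel_eq]
  rfl

variable {g} in
theorem IsTT.stressDiv_eq_zero {φ : TwoTensor n M} (hφ : IsTT g φ) (x : M) (k : Fin n) :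
    stressDiv (coordMetric g x) (coordTensor (fun x v w ↦ φ x v w) x) k
      (extChartAt (𝓡 n) x x) = 0 := by
  have formula := divTensor_eq g (isBilinAt_clm fun x ↦ φ x) (fun i j ↦
    (contDiffAt_coordTensor φ (mem_extChartAt_target x) i j).differentiableAt (by simp))
    (.ext fun i j ↦ hφ.symm _ _ _)
  simp only [hφ.trace, pd_const, mul_zero, add_zero, hφ.div] at formula
  exact sum_mul_vecComp_eq_zero_iff.1 (fun w ↦ neg_eq_zero.1 (formula w).symm) k

end StressDivergence

section SampsonLaplacian

variable {n : ℕ} {M : Type*} [TopologicalSpace M] [ChartedSpace (Rn n) M] [IsManifold (𝓡 n) ∞ M]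
  (g : RiemMetric n M) (θ : OneForm n M)

theorem coordTensor_deltaStar {p : M} {y : Rn n} (hy : y ∈ (extChartAt (𝓡 n) p).target) :
    coordTensor (deltaStar g θ) p y
      = (1 / 2 : ℝ) • lieMatrix (coordMetric g p) (coordField (sharp g θ) p) y := by
  rw [← coordTensor_lieMetric_sharp g θ hy]
  rfl

theorem isBilinAt_deltaStar (x : M) : IsBilinAt (deltaStar g θ) x := by
  obtain ⟨B, hB⟩ := isBilinAt_lieMetric g (sharp g θ) x
  exact ⟨(1 / 2 : ℝ) • B, fun v w ↦ congrArg (fun c : ℝ ↦ 1 / 2 * c) (hB v w)⟩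

theorem metricTrace_deltaStar (x : M) :
    metricTrace g (deltaStar g θ) x = -divForm g (fun x v ↦ θ x v) x := by
  rw [divForm_eq, neg_mul, neg_neg]
  exact contract_const_mul _ _

theorem mdifferentiableAt_divForm (x : M) :
    MDifferentiableAt (𝓡 n) 𝓘(ℝ, ℝ) (divForm g fun x v ↦ θ x v) x := by
  have smooth : ContMDiffAt (𝓡 n) 𝓘(ℝ, ℝ) ∞ (fun x' ↦ divForm g (fun x v ↦ θ x v)
      ((extChartAt (𝓡 n) x).symm (extChartAt (𝓡 n) x x'))) x :=
    ContMDiffAt.comp (g := fun y ↦ divForm g (fun x v ↦ θ x v) ((extChartAt (𝓡 n) x).symm y)) x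
      (contDiffAt_divForm_symm g θ (mem_extChartAt_target x)).contMDiffAt
      (contMDiffAt_chart (mem_extChartAt_source x))
  refine (smooth.congr_of_eventuallyEq ?_).mdifferentiableAt (by simp)
  filter_upwards [extChartAt_source_mem_nhds (I := 𝓡 n) x] with x' hx'
  exact congrArg _ ((extChartAt (𝓡 n) x).left_inv hx').symm

theorem isSymm_lieMatrix {A : Rn n → Matrix (Fin n) (Fin n) ℝ} (hA : ∀ y, (A y).IsSymm)
    (X : Rn n → Fin n → ℝ) (y : Rn n) : (lieMatrix A X y).IsSymm := by
  ext i j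
  have symm_fun : (fun z ↦ A z i j) = fun z ↦ A z j i := funext fun z ↦ (hA z).apply j i
  simp only [lieMatrix, Matrix.transpose_apply, Matrix.of_apply, symm_fun]
  refine Finset.sum_congr rfl fun k _ ↦ ?_
  rw [(hA y).apply k j, (hA y).apply k i]
  ring

theorem divTensor_deltaStar (x : M) (w : TangentSpace (𝓡 n) x) :
    2 * divTensor g (deltaStar g θ) x w
      = -(∑ k, stressDiv (coordMetric g x) (lieMatrix (coordMetric g x)
          (coordField (sharp g θ) x)) k (extChartAt (𝓡 n) x x) * vecComp x w k)
        + differential (divForm g fun x v ↦ θ x v) x w := by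
  have target : extChartAt (𝓡 n) x x ∈ (extChartAt (𝓡 n) x).target := mem_extChartAt_target x
  have lie_diff (i j : Fin n) :=
    (contDiffAt_lieMatrix g θ target i j).differentiableAt (by simp)
  have coord : coordTensor (deltaStar g θ) x =ᶠ[𝓝 (extChartAt (𝓡 n) x x)]
      fun z ↦ (1 / 2 : ℝ) • lieMatrix (coordMetric g x) (coordField (sharp g θ) x) z :=
    eventuallyEq_of_mem ((isOpen_extChartAt_target x).mem_nhds target)
      fun z ↦ coordTensor_deltaStar g θ
  have diff (i j : Fin n) : DifferentiableAt ℝ (fun z ↦ coordTensor (deltaStar g θ) x z i j)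
      (extChartAt (𝓡 n) x x) :=
    ((lie_diff i j).const_mul (1 / 2 : ℝ)).congr_of_eventuallyEq
      (coord.mono fun z hz ↦ congrArg (fun B : Matrix (Fin n) (Fin n) ℝ ↦ B i j) hz)
  have symm : (coordTensor (deltaStar g θ) x (extChartAt (𝓡 n) x x)).IsSymm := by
    rw [coord.self_of_nhds]
    exact (isSymm_lieMatrix (isSymm_coordMetric g x) _ _).smul _
  have pd_neg (k : Fin n) :
      pd k (fun z ↦ -divForm g (fun x v ↦ θ x v) ((extChartAt (𝓡 n) x).symm z))
        (extChartAt (𝓡 n) x x)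
      = -pd k (fun z ↦ divForm g (fun x v ↦ θ x v) ((extChartAt (𝓡 n) x).symm z))
        (extChartAt (𝓡 n) x x) := by
    simpa using pd_const_mul k (-1)
      ((contDiffAt_divForm_symm g θ target).differentiableAt (by simp))
  rw [divTensor_eq g (isBilinAt_deltaStar g θ) diff symm,
    differential_eq (mdifferentiableAt_divForm g θ x)]
  simp only [stressDiv_congr coord, stressDiv_const_smul _ lie_diff, metricTrace_deltaStar,
    pd_neg, mul_neg, Finset.mul_sum, ← Finset.sum_neg_distrib, ← Finset.sum_add_distrib]
  exact Finset.sum_congr rfl fun k _ ↦ by ring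

theorem sampsonLaplacian_eq (x : M) (w : TangentSpace (𝓡 n) x) :
    sampsonLaplacian g θ x w = -∑ k, stressDiv (coordMetric g x)
      (lieMatrix (coordMetric g x) (coordField (sharp g θ) x)) k (extChartAt (𝓡 n) x x)
        * vecComp x w k := by
  rw [sampsonLaplacian, divTensor_deltaStar, add_sub_cancel_right]

theorem isInfinitesimalHarmonic_sharp_iff :
    IsInfinitesimalHarmonic g (sharp g θ)
      ↔ ∀ (x : M) (w : TangentSpace (𝓡 n) x), sampsonLaplacian g θ x w = 0 := by
  simp only [isInfinitesimalHarmonic_iff g fun p k ↦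
    contDiffAt_coordField_sharp g θ (mem_extChartAt_target p) k, sampsonLaplacian_eq, neg_eq_zero,
    sum_mul_vecComp_eq_zero_iff]
  refine forall_congr' fun x ↦ ?_
  have target : extChartAt (𝓡 n) x x ∈ (extChartAt (𝓡 n) x).target := mem_extChartAt_target x
  have metric := isMetricAt_coordMetric g target
  simp only [metric.stressDiv_lieMatrix fun k ↦
    (contDiffAt_coordField_sharp g θ target k).of_le ENat.LEInfty.out]
  refine ⟨fun h l ↦ by simp only [h, mul_zero, Finset.sum_const_zero], fun h ↦ congrFun ?_⟩
  exact Matrix.eq_zero_of_mulVec_eq_zero metric.pos.ne' (funext h)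

end SampsonLaplacian

section Constancy

variable {n : ℕ} {M : Type*} [TopologicalSpace M] [ChartedSpace (Rn n) M] [IsManifold (𝓡 n) ∞ M]
  {u : M → ℝ}

theorem isLocallyConstant_of_differential_eq_zero (hu : ContMDiff (𝓡 n) 𝓘(ℝ, ℝ) ∞ u)
    (h : ∀ (x : M) (w : TangentSpace (𝓡 n) x), differential u x w = 0) :
    IsLocallyConstant u := by
  refine (IsLocallyConstant.iff_eventually_eq u).2 fun p ↦ ?_
  set e := extChartAt (𝓡 n) p
  have differentiable : DifferentiableOn ℝ (fun y ↦ u (e.symm y)) e.target := fun y hy ↦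
    ((contDiffAt_comp_symm hu hy).differentiableAt (by simp)).differentiableWithinAt
  have fderiv_eq_zero : e.target.EqOn (fderiv ℝ fun y ↦ u (e.symm y)) 0 := fun y hy ↦ by
    ext v
    have chain := (differential_symm (hu.mdifferentiableAt (by simp)) hy
      (symmDeriv p y v)).symm.trans (h _ _)
    rwa [chartDeriv_symmDeriv hy, ← fderiv_eq_sum_pd] at chain
  have fiber_open := (isOpen_extChartAt_target p).isOpen_inter_preimage_of_fderiv_eq_zero
    differentiable fderiv_eq_zero {u p}
  have mem_fiber : e p ∈ e.target ∩ (fun y ↦ u (e.symm y)) ⁻¹' {u p} :=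
    ⟨mem_extChartAt_target p, congrArg u (e.left_inv (mem_extChartAt_source p))⟩
  filter_upwards [(continuousAt_extChartAt p).preimage_mem_nhds (fiber_open.mem_nhds mem_fiber),
    extChartAt_source_mem_nhds (I := 𝓡 n) p] with x hx hxs
  exact (congrArg u (e.left_inv hxs)).symm.trans hx.2

theorem exists_eq_const_iff_differential_eq_zero [ConnectedSpace M]
    (hu : ContMDiff (𝓡 n) 𝓘(ℝ, ℝ) ∞ u) :
    (∃ c : ℝ, ∀ x, u x = c)
      ↔ ∀ (x : M) (w : TangentSpace (𝓡 n) x), differential u x w = 0 := by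
  refine ⟨fun ⟨c, hc⟩ x w ↦ ?_, fun h ↦ ?_⟩
  · simp only [differential_eq (hu.mdifferentiableAt (by simp)), hc, pd_const, mul_zero,
      Finset.sum_const_zero]
  · obtain ⟨x₀⟩ := ‹ConnectedSpace M›.toNonempty
    exact ⟨u x₀, fun x ↦
      (isLocallyConstant_of_differential_eq_zero hu h).apply_eq_of_preconnectedSpace x x₀⟩

end Constancy

section Energy

variable {n m : ℕ} {M N : Type*}
  [TopologicalSpace M] [ChartedSpace (Rn n) M]
  [TopologicalSpace N] [ChartedSpace (Rn m) N] [IsManifold (𝓡 m) ∞ N]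

theorem inner_self_nonneg (gbar : RiemMetric m N) (x : N) (v : TangentSpace (𝓡 m) x) :
    0 ≤ gbar.inner x v v := by
  rcases eq_or_ne v 0 with rfl | hv
  · rw [map_zero]
  · exact (gbar.pos x v hv).le

theorem posSemidef_coordTensor_pullbackMetric (gbar : RiemMetric m N) (f : M → N) (p : M)
    (y : Rn n) : (coordTensor (pullbackMetric gbar f) p y).PosSemidef := by
  refine Matrix.posSemidef_iff_dotProduct_mulVec.2
    ⟨Matrix.IsSymm.ext fun i j ↦ gbar.symm _ _ _, fun v ↦ ?_⟩
  rw [star_trivial, dotProduct_coordTensor_mulVec (isBilinAt_pullbackMetric gbar f _)]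
  exact inner_self_nonneg gbar _ _

variable [IsManifold (𝓡 n) ∞ M]

theorem energyDensity_nonneg (g : RiemMetric n M) (gbar : RiemMetric m N) (f : M → N) (x : M) :
    0 ≤ energyDensity g gbar f x :=
  contract_nonneg (posDef_coordMetric g (mem_extChartAt_target x)).inv.posSemidef
    (posSemidef_coordTensor_pullbackMetric gbar f x _)

theorem energy_nonneg [MeasurableSpace M] (g : RiemMetric n M) (gbar : RiemMetric m N)
    (f : M → N) : 0 ≤ energy g gbar f :=
  mul_nonneg (by norm_num) (integral_nonneg fun x ↦ energyDensity_nonneg g gbar f x)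

end Energy

section York

variable {n m : ℕ} {M N : Type*}
  [TopologicalSpace M] [ChartedSpace (Rn n) M] [IsManifold (𝓡 n) ∞ M]
  [TopologicalSpace N] [ChartedSpace (Rn m) N] [IsManifold (𝓡 m) ∞ N]

/-- A York decomposition `h = (δ*θ + λ g) + φ` of a two-tensor field `h`, with `φ` a
`TT`-tensor. -/
structure IsYorkDecomposition (g : RiemMetric n M)
    (h : ∀ x : M, TangentSpace (𝓡 n) x → TangentSpace (𝓡 n) x → ℝ)
    (θ : OneForm n M) (lam : M → ℝ) (φ : TwoTensor n M) : Prop where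
  isTT : IsTT g φ
  eq : ∀ (x : M) (v w : TangentSpace (𝓡 n) x),
    h x v w = (deltaStar g θ x v w + lam x * g.inner x v w) + φ x v w

namespace IsYorkDecomposition

variable {g : RiemMetric n M} {h : ∀ x : M, TangentSpace (𝓡 n) x → TangentSpace (𝓡 n) x → ℝ}
  {θ : OneForm n M} {lam : M → ℝ} {φ : TwoTensor n M}

theorem metricTrace_eq (hY : IsYorkDecomposition g h θ lam φ) (x : M) :
    metricTrace g h x = -divForm g (fun x v ↦ θ x v) x + n * lam x := by
  set y := extChartAt (𝓡 n) x x
  have metric := isMetricAt_coordMetric g (mem_extChartAt_target x)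
  have components (i j : Fin n) : coordTensor h x y i j
      = (coordTensor (deltaStar g θ) x y i j + lam x * coordMetric g x y i j)
        + coordTensor (fun x v w ↦ φ x v w) x y i j := by
    refine (hY.eq _ _ _).trans ?_
    rw [congrArg lam ((extChartAt (𝓡 n) x).left_inv (mem_extChartAt_source x))]
    rfl
  have conformal : (contract (coordMetric g x y)⁻¹ fun i j ↦ lam x * coordMetric g x y i j)
      = lam x * n :=
    (contract_const_mul _ _).trans <| congrArg (lam x * ·) <|
      (contract_self metric.inv_mul (isSymm_coordMetric g x y)).trans (by rw [Fintype.card_fin])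
  calc metricTrace g h x
      = contract (coordMetric g x y)⁻¹ fun i j ↦ (coordTensor (deltaStar g θ) x y i j
          + lam x * coordMetric g x y i j) + coordTensor (fun x v w ↦ φ x v w) x y i j :=
        congrArg (contract _) (funext₂ components)
    _ = (metricTrace g (deltaStar g θ) x + contract (coordMetric g x y)⁻¹ fun i j ↦
          lam x * coordMetric g x y i j) + metricTrace g (fun x v w ↦ φ x v w) x :=
        (contract_add _ _).trans (congrArg (· + _) (contract_add _ _))
    _ = -divForm g (fun x v ↦ θ x v) x + n * lam x := by
        rw [conformal, metricTrace_deltaStar, hY.isTT.trace, add_zero, mul_comm]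

theorem stressDiv_eq (hY : IsYorkDecomposition g h θ lam φ)
    (hlam : ContMDiff (𝓡 n) 𝓘(ℝ, ℝ) ∞ lam) (x : M) (k : Fin n) :
    stressDiv (coordMetric g x) (coordTensor h x) k (extChartAt (𝓡 n) x x)
      = (1 / 2) * stressDiv (coordMetric g x)
          (lieMatrix (coordMetric g x) (coordField (sharp g θ) x)) k (extChartAt (𝓡 n) x x)
        + (1 - (n : ℝ) / 2) * pd k (fun z ↦ lam ((extChartAt (𝓡 n) x).symm z))
          (extChartAt (𝓡 n) x x) := by
  have target : extChartAt (𝓡 n) x x ∈ (extChartAt (𝓡 n) x).target := mem_extChartAt_target x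
  have metric := isMetricAt_coordMetric g target
  have lie_diff (i j : Fin n) :=
    (contDiffAt_lieMatrix g θ target i j).differentiableAt (by simp)
  have lam_diff := (contDiffAt_comp_symm hlam target).differentiableAt (by simp)
  have φ_diff (i j : Fin n) := (contDiffAt_coordTensor φ target i j).differentiableAt (by simp)
  have coord : coordTensor h x =ᶠ[𝓝 (extChartAt (𝓡 n) x x)]
      fun z ↦ ((1 / 2 : ℝ) • lieMatrix (coordMetric g x) (coordField (sharp g θ) x) z
        + lam ((extChartAt (𝓡 n) x).symm z) • coordMetric g x z)
        + coordTensor (fun x v w ↦ φ x v w) x z := by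
    filter_upwards [(isOpen_extChartAt_target x).mem_nhds target] with z hz
    rw [← coordTensor_deltaStar g θ hz]
    ext i j
    exact hY.eq _ _ _
  have half_lie_diff (i j : Fin n) : DifferentiableAt ℝ (fun z ↦ ((1 / 2 : ℝ) •
      lieMatrix (coordMetric g x) (coordField (sharp g θ) x) z) i j) (extChartAt (𝓡 n) x x) :=
    (lie_diff i j).const_mul (1 / 2 : ℝ)
  have conformal_diff (i j : Fin n) : DifferentiableAt ℝ (fun z ↦
      (lam ((extChartAt (𝓡 n) x).symm z) • coordMetric g x z) i j) (extChartAt (𝓡 n) x x) :=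
    lam_diff.fun_mul (metric.differentiableAt i j)
  have sum_diff (i j : Fin n) : DifferentiableAt ℝ (fun z ↦ ((1 / 2 : ℝ) •
      lieMatrix (coordMetric g x) (coordField (sharp g θ) x) z
        + lam ((extChartAt (𝓡 n) x).symm z) • coordMetric g x z) i j) (extChartAt (𝓡 n) x x) :=
    (half_lie_diff i j).fun_add (conformal_diff i j)
  rw [stressDiv_congr coord, stressDiv_add sum_diff φ_diff,
    stressDiv_add half_lie_diff conformal_diff, stressDiv_const_smul _ lie_diff,
    metric.stressDiv_smul_metric lam_diff, hY.isTT.stressDiv_eq_zero, add_zero]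

theorem sampsonLaplacian_eq (hY : IsYorkDecomposition g h θ lam φ)
    (hlam : ContMDiff (𝓡 n) 𝓘(ℝ, ℝ) ∞ lam)
    (hdiv : ∀ (x : M) k,
      stressDiv (coordMetric g x) (coordTensor h x) k (extChartAt (𝓡 n) x x) = 0)
    (x : M) (w : TangentSpace (𝓡 n) x) :
    sampsonLaplacian g θ x w = -((n : ℝ) - 2) * differential lam x w := by
  rw [RiemGeom.sampsonLaplacian_eq, differential_eq (hlam.mdifferentiableAt (by simp)),
    Finset.mul_sum, ← Finset.sum_neg_distrib]
  refine Finset.sum_congr rfl fun k _ ↦ ?_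
  linear_combination (2 * vecComp x w k) * (hdiv x k).symm.trans (hY.stressDiv_eq hlam x k)

variable [T2Space M] [CompactSpace M] [MeasurableSpace M] [BorelSpace M]
  {gbar : RiemMetric m N} {f : M → N} {c : ℝ}

theorem energy_eq (hY : IsYorkDecomposition g (pullbackMetric gbar f) θ lam φ)
    (hc : ∀ x, lam x = c) :
    energy g gbar f = (n : ℝ) / 2 * c * (riemVol g).real univ := by
  have density (x : M) : energyDensity g gbar f x = -divForm g (fun x v ↦ θ x v) x + n * c :=
    (hY.metricTrace_eq x).trans (by rw [hc])
  have divForm_integrable : Integrable (fun x ↦ -divForm g (fun x v ↦ θ x v) x) (riemVol g) :=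
    (integrable_riemVol_of_continuous g (continuous_divForm g θ)).neg
  rw [energy, energyOn, setIntegral_univ]
  simp only [density]
  rw [integral_add divForm_integrable (integrable_const _), integral_neg, integral_divForm,
    integral_const, smul_eq_mul]
  ring

theorem const_nonneg [Nonempty M]
    (hY : IsYorkDecomposition g (pullbackMetric gbar f) θ lam φ)
    (hc : ∀ x, lam x = c) (hn : 0 < n) : 0 ≤ c := by
  have volume_pos : 0 < (riemVol g).real univ :=
    ENNReal.toReal_pos (riemVol_univ_pos g).ne' (measure_ne_top _ _)
  have energy_nonneg := (energy_nonneg g gbar f).trans_eq (hY.energy_eq hc)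
  have half_pos : (0 : ℝ) < n / 2 := half_pos (Nat.cast_pos.2 hn)
  exact nonneg_of_mul_nonneg_right (nonneg_of_mul_nonneg_left energy_nonneg volume_pos) half_pos

end IsYorkDecomposition

end York

end RiemGeom

end

theorem corollary2_general {n m : ℕ} {M N : Type*}
    [TopologicalSpace M] [ChartedSpace (Rn n) M] [IsManifold (𝓡 n) ∞ M]
    [T2Space M] [ConnectedSpace M] [MeasurableSpace M] [BorelSpace M]
    [TopologicalSpace N] [ChartedSpace (Rn m) N] [IsManifold (𝓡 m) ∞ N]
    (g : RiemMetric n M) (gbar : RiemMetric m N)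
    (f : M → N) (hf : IsHarmonicMap g gbar f)
    (θ : OneForm n M) (lam : M → ℝ) (hlam : ContMDiff (𝓡 n) 𝓘(ℝ, ℝ) ∞ lam)
    (φ : TwoTensor n M) (hφ : IsTT g φ)
    (hdec : ∀ (x : M) (v w : TangentSpace (𝓡 n) x),
      pullbackMetric gbar f x v w
        = (deltaStar g θ x v w + lam x * g.inner x v w) + φ x v w) :
    (∀ (x : M) (w : TangentSpace (𝓡 n) x),
      sampsonLaplacian g θ x w = -((n : ℝ) - 2) * differential lam x w) ∧
    (n = 2 → IsInfinitesimalHarmonic g (sharp g θ)) ∧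
    (n ≠ 2 → (IsInfinitesimalHarmonic g (sharp g θ) ↔ ∃ c : ℝ, ∀ x, lam x = c)) ∧
    (CompactSpace M → 2 < n → IsInfinitesimalHarmonic g (sharp g θ) →
      ∃ c : ℝ, 0 ≤ c ∧ (∀ x, lam x = c) ∧
        energy g gbar f = (n : ℝ) / 2 * c * (riemVol g).real univ) := by
  have york : IsYorkDecomposition g (pullbackMetric gbar f) θ lam φ := ⟨hφ, hdec⟩
  have laplacian := york.sampsonLaplacian_eq hlam fun x ↦
    stressDiv_pullbackMetric_eq_zero hf (mem_extChartAt_target x)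
  have harmonic_iff (hn : n ≠ 2) :
      IsInfinitesimalHarmonic g (sharp g θ) ↔ ∃ c : ℝ, ∀ x, lam x = c := by
    have factor_ne_zero : -((n : ℝ) - 2) ≠ 0 :=
      neg_ne_zero.2 (sub_ne_zero.2 (by exact_mod_cast hn))
    simp only [isInfinitesimalHarmonic_sharp_iff, laplacian, mul_eq_zero, factor_ne_zero, false_or,
      exists_eq_const_iff_differential_eq_zero hlam]
  refine ⟨laplacian, fun hn ↦ ?_, harmonic_iff, fun _ hn h ↦ ?_⟩
  · exact (isInfinitesimalHarmonic_sharp_iff g θ).2 fun x w ↦ by simp [laplacian, hn]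
  · obtain ⟨c, hc⟩ := (harmonic_iff hn.ne').1 h
    exact ⟨c, york.const_nonneg hc (by omega), hc, york.energy_eq hc⟩

theorem corollary2 {n m : ℕ} (hn : 2 ≤ n) (hm : 2 ≤ m) {M N : Type*}
    [TopologicalSpace M] [ChartedSpace (Rn n) M] [IsManifold (𝓡 n) ∞ M]
    [T2Space M] [CompactSpace M] [ConnectedSpace M] [MeasurableSpace M] [BorelSpace M]
    [TopologicalSpace N] [ChartedSpace (Rn m) N] [IsManifold (𝓡 m) ∞ N]
    [T2Space N] [SecondCountableTopology N]
    (g : RiemMetric n M) (gbar : RiemMetric m N) (hgbar : IsCompleteMetric gbar)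
    (f : M → N) (hf : IsHarmonicMap g gbar f)
    (θ : OneForm n M) (lam : M → ℝ) (hlam : ContMDiff (𝓡 n) 𝓘(ℝ, ℝ) ∞ lam)
    (φ : TwoTensor n M) (hφ : IsTT g φ)
    (hdec : ∀ (x : M) (v w : TangentSpace (𝓡 n) x),
      pullbackMetric gbar f x v w
        = (deltaStar g θ x v w + lam x * g.inner x v w) + φ x v w) :
    (∀ (x : M) (w : TangentSpace (𝓡 n) x),
      sampsonLaplacian g θ x w = -((n : ℝ) - 2) * differential lam x w) ∧
    (n = 2 → IsInfinitesimalHarmonic g (sharp g θ)) ∧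
    (2 < n → (IsInfinitesimalHarmonic g (sharp g θ) ↔ ∃ c : ℝ, ∀ x, lam x = c)) ∧
    (2 < n → IsInfinitesimalHarmonic g (sharp g θ) →
      ∃ c : ℝ, 0 ≤ c ∧ (∀ x, lam x = c) ∧
        energy g gbar f = (n : ℝ) / 2 * c * (riemVol g).real univ) := by
  have ⟨laplacian, dim_two, harmonic_iff, energy⟩ :=
    corollary2_general g gbar f hf θ lam hlam φ hφ hdec
  exact ⟨laplacian, dim_two, fun h ↦ harmonic_iff h.ne', energy inferInstance⟩
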